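/- Let $k\ge 1$ and let $\Lambda$ be a finitely aligned $k$-graph: a countable small category with a degree functor $d:\Lambda\to\mathbb N^k$ satisfying the unique factorisation property, such that $\Lambda^{\min}(\mu,\nu)=\{(\alpha,\beta):\mu\alpha=\nu\beta,\ d(\mu\alpha)=d(\mu)\vee d(\nu)\}$ is finite for all $\mu,\nu\in\Lambda$. Let $\mathcal TC^*(\Lambda)$ be the $C^*$-algebra generated by a universal Toeplitz--Cuntz--Krieger family $\{t^\Lambda_\lambda\}$, that is, the elements $t^\Lambda_v$ ($v$ a vertex) are mutually orthogonal projections, $t^\Lambda_\mu t^\Lambda_\nu=t^\Lambda_{\mu\nu}$ if $s(\mu)=r(\nu)$, and $(t^\Lambda_\mu)^*t^\Lambda_\nu=\sum_{(\alpha,\beta)\in\Lambda^{\min}(\mu,\nu)}t^\Lambda_\alpha (t^\Lambda_\beta)^*$. Fix $i\in\{1,\dots,k\}$, let $\Lambda^i=\{\lambda\in\Lambda: d(\lambda)_i=0\}$, viewed as a $(k-1)$-graph, and write $A=\mathcal TC^*(\Lambda^i)$. There is an injective $*$-homomorphism $\phi:A\to\mathcal TC^*(\Lambda)$ with $\phi(t^{\Lambda^i}_\lambda)=t^\Lambda_\lambda$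 for $\lambda\in\Lambda^i$, and for every $n\ge0$ the closed subspace $$X_n=\overline{\mathrm{span}}\{t^\Lambda_\lambda (t^\Lambda_\mu)^*: d(\lambda)_i=n,\ d(\mu)_i=0\}\subseteq\mathcal TC^*(\Lambda)$$ is a Hilbert $A$-bimodule under $\langle x,y\rangle=\phi^{-1}(x^*y)$, $x\cdot a=x\phi(a)$ and $a\cdot x=\phi(a)x$. Put $X=X_1$, let $\iota:X\to\mathcal TC^*(\Lambda)$ be the inclusion, and let $(i_X,i_A)$ be the universal Toeplitz representation of $X$ in its Toeplitz algebra $\mathcal T_X$. Then: 1. $(\iota,\phi)$ is a Toeplitz representation of $X$ in $\mathcal TC^*(\Lambda)$, i.e. $\iota(a\cdot x)=\phi(a)\iota(x)$, $\iota(x\cdot a)=\iota(x)\phi(a)$ and $\iota(x)^*\iota(y)=\phi(\langle x,y\rangle)$; hence there is a $*$-homomorphism $\iota\times_{\mathcal T}\phi:\mathcal T_X\to\mathcal TC^*(\Lambda)$ with $(\iota\times_{\mathcal T}\phi)\circ i_X=\iota$ and $(\iota\times_{\mathcal T}\phi)\circ i_A=\phi$. 2. Let $X^{\otimes n}$ be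 the balanced tensor powers of $X$, with $X^{\otimes0}=A$, $X^{\otimes1}=X$ and $X^{\otimes (n+1)}=X\otimes_A X^{\otimes n}$. There are Hilbert $A$-bimodule isomorphisms $\Omega_n:X_n\to X^{\otimes n}$ with $\Omega_0=\phi^{-1}$ and $\Omega_{n+1}(t^\Lambda_{\xi\nu}(t^\Lambda_\eta)^*)=t^\Lambda_\xi\otimes\Omega_n(t^\Lambda_\nu (t^\Lambda_\eta)^*)$ whenever $d(\xi)=e_i$, $s(\xi)=r(\nu)$, $d(\nu)_i=n$ and $d(\eta)_i=0$ (where $x\otimes a$ means $x\cdot a$ for $a\in X^{\otimes 0}$), and linear maps $i_X^{\otimes n}:X^{\otimes n}\to\mathcal T_X$ with $i_X^{\otimes0}=i_A$, $i_X^{\otimes1}=i_X$ and $i_X^{\otimes (n+1)}(x\otimes y)=i_X(x)\,i_X^{\otimes n}(y)$, such that each $(i_X^{\otimes n},i_A)$ is a Toeplitz representation of $X^{\otimes n}$. The elements $u_\lambda=i_X^{\otimes d(\lambda)_i}\big(\Omega_{d(\lambda)_i}(t^\Lambda_\lambda)\big)$ form a Toeplitz--Cuntz--Krieger $\Lambda$-family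 in $\mathcal T_X$, so they induce a $*$-homomorphism $\pi_u:\mathcal TC^*(\Lambda)\to\mathcal T_X$ with $\pi_u(t^\Lambda_\lambda)=u_\lambda$. 3. $\pi_u$ and $\iota\times_{\mathcal T}\phi$ are mutually inverse. Thus $\mathcal TC^*(\Lambda)\cong\mathcal T_X$. -/

import Mathlib

open CategoryTheory
open scoped NNReal

universe u v

noncomputable section

/-! ### Free *-algebras -/

/-- The free unital complex `*`-algebra on `G`: noncommutative polynomials in the letters
`inl g` (the generator `g`) and `inr g` (its formal adjoint). -/
def FreeStarAlgebra (G : Type u) : Type u := FreeAlgebra ℂ (G ⊕ G)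

namespace FreeStarAlgebra

variable {G : Type u}

instance : Ring (FreeStarAlgebra G) := inferInstanceAs (Ring (FreeAlgebra ℂ (G ⊕ G)))
instance : Algebra ℂ (FreeStarAlgebra G) := inferInstanceAs (Algebra ℂ (FreeAlgebra ℂ (G ⊕ G)))

/-- The generator attached to `g`. -/
def of (g : G) : FreeStarAlgebra G := FreeAlgebra.ι ℂ (Sum.inl g)

/-- The formal adjoint of the generator attached to `g`. -/
def ofAdj (g : G) : FreeStarAlgebra G := FreeAlgebra.ι ℂ (Sum.inr g)

theorem induction_on {P : FreeStarAlgebra G → Prop} (a : FreeStarAlgebra G)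
    (scalar : ∀ c : ℂ, P (algebraMap ℂ _ c)) (of_gen : ∀ g, P (of g)) (adj : ∀ g, P (ofAdj g))
    (mul : ∀ a b, P a → P b → P (a * b)) (add : ∀ a b, P a → P b → P (a + b)) : P a :=
  FreeAlgebra.induction ℂ (G ⊕ G) (motive := P) scalar
    (fun x => match x with
      | Sum.inl g => of_gen g
      | Sum.inr g => adj g) mul add a

/-- The opposite of the free `*`-algebra, as a complex algebra through complex conjugation. -/
@[reducible] def conjAlgebra : Algebra ℂ (FreeStarAlgebra G)ᵐᵒᵖ :=
  RingHom.toAlgebra' ((algebraMap ℂ (FreeStarAlgebra G)ᵐᵒᵖ).comp (starRingEnd ℂ))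
    (fun c x => Algebra.commutes (R := ℂ) (starRingEnd ℂ c) x)

/-- The conjugate-linear anti-homomorphism exchanging each generator with its adjoint. -/
def starHom : FreeStarAlgebra G →+* (FreeStarAlgebra G)ᵐᵒᵖ :=
  letI : Algebra ℂ (FreeStarAlgebra G)ᵐᵒᵖ := conjAlgebra
  (FreeAlgebra.lift ℂ (Sum.elim (fun g => MulOpposite.op (ofAdj g))
    (fun g => MulOpposite.op (of g))) : FreeAlgebra ℂ (G ⊕ G) →ₐ[ℂ] _).toRingHom

theorem starHom_of (g : G) : starHom (of g) = MulOpposite.op (ofAdj g) := by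
  let _ : Algebra ℂ (FreeStarAlgebra G)ᵐᵒᵖ := conjAlgebra
  exact FreeAlgebra.lift_ι_apply (R := ℂ) (A := (FreeStarAlgebra G)ᵐᵒᵖ) _ (Sum.inl g)

theorem starHom_ofAdj (g : G) : starHom (ofAdj g) = MulOpposite.op (of g) := by
  let _ : Algebra ℂ (FreeStarAlgebra G)ᵐᵒᵖ := conjAlgebra
  exact FreeAlgebra.lift_ι_apply (R := ℂ) (A := (FreeStarAlgebra G)ᵐᵒᵖ) _ (Sum.inr g)

theorem starHom_algebraMap (c : ℂ) : starHom (algebraMap ℂ (FreeStarAlgebra G) c) =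
    MulOpposite.op (algebraMap ℂ (FreeStarAlgebra G) (starRingEnd ℂ c)) := by
  let _ : Algebra ℂ (FreeStarAlgebra G)ᵐᵒᵖ := conjAlgebra
  exact (FreeAlgebra.lift (A := (FreeStarAlgebra G)ᵐᵒᵖ) ℂ _).commutes c

instance : StarRing (FreeStarAlgebra G) where
  star x := (starHom x).unop
  star_involutive x := by
    induction x using induction_on with
    | scalar c => simp [starHom_algebraMap]
    | of_gen g => simp [starHom_of, starHom_ofAdj]
    | adj g => simp [starHom_of, starHom_ofAdj]
    | mul a b ha hb => simp only [map_mul, MulOpposite.unop_mul, ha, hb]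
    | add a b ha hb => simp only [map_add, MulOpposite.unop_add, ha, hb]
  star_mul a b := by simp
  star_add a b := by simp

theorem star_of (g : G) : star (of g) = ofAdj g := by
  change (starHom (of g)).unop = _
  simp [starHom_of]

theorem star_algebraMap (c : ℂ) : star (algebraMap ℂ (FreeStarAlgebra G) c) =
    algebraMap ℂ (FreeStarAlgebra G) (star c) := by
  change (starHom (algebraMap ℂ (FreeStarAlgebra G) c)).unop = _
  simp [starHom_algebraMap]

instance : StarModule ℂ (FreeStarAlgebra G) where
  star_smul c x := by
    rw [Algebra.smul_def, Algebra.smul_def, star_mul, star_algebraMap, Algebra.commutes]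

variable {B : Type v} [Ring B] [StarRing B] [Algebra ℂ B] [StarModule ℂ B]

/-- Evaluation of `*`-polynomials at a family `q` in a unital `*`-algebra. -/
def eval (q : G → B) : FreeStarAlgebra G →⋆ₐ[ℂ] B where
  __ := (FreeAlgebra.lift ℂ (Sum.elim q (fun g => star (q g))) : FreeAlgebra ℂ (G ⊕ G) →ₐ[ℂ] B)
  map_star' x := by
    set f : FreeStarAlgebra G →ₐ[ℂ] B :=
      (FreeAlgebra.lift ℂ (Sum.elim q (fun g => star (q g))) : FreeAlgebra ℂ (G ⊕ G) →ₐ[ℂ] B)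
    have h1 : ∀ g, f (of g) = q g := fun g =>
      FreeAlgebra.lift_ι_apply (R := ℂ) (A := B) _ (Sum.inl g)
    have h2 : ∀ g, f (ofAdj g) = star (q g) := fun g =>
      FreeAlgebra.lift_ι_apply (R := ℂ) (A := B) _ (Sum.inr g)
    change f (star x) = star (f x)
    induction x using induction_on with
    | scalar c => rw [star_algebraMap, AlgHom.commutes, AlgHom.commutes, algebraMap_star_comm]
    | of_gen g => rw [star_of, h1, h2]
    | adj g => rw [← star_of, star_star, star_of, h1, h2, star_star]
    | mul a b ha hb => rw [star_mul, map_mul, map_mul, ha, hb, star_mul]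
    | add a b ha hb => rw [star_add, map_add, map_add, ha, hb, star_add]

theorem eval_of (q : G → B) (g : G) : eval q (of g) = q g :=
  FreeAlgebra.lift_ι_apply (R := ℂ) (A := B) _ (Sum.inl g)

end FreeStarAlgebra

theorem continuous_starHom {A : Type u} {B : Type v} [NonUnitalCStarAlgebra A]
    [NonUnitalCStarAlgebra B] (f : A →⋆ₙₐ[ℂ] B) : Continuous f :=
  AddMonoidHomClass.continuous_of_bound f 1
    (by simpa only [one_mul] using NonUnitalStarAlgHom.norm_apply_le f)

/-! ### C*-seminorms and their completions -/

/-- A C*-seminorm on a unital complex `*`-algebra. -/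
structure CStarSeminorm (F : Type u) [Ring F] [StarRing F] [Algebra ℂ F] extends Seminorm ℂ F where
  mul_le' : ∀ x y, toFun (x * y) ≤ toFun x * toFun y
  star_mul_self' : ∀ x, toFun (star x * x) = toFun x ^ 2

namespace CStarSeminorm

section
variable {F : Type u} [Ring F] [StarRing F] [Algebra ℂ F]

instance : CoeFun (CStarSeminorm F) (fun _ => F → ℝ) := ⟨fun p => p.toSeminorm⟩

variable (p : CStarSeminorm F)

theorem nonneg (x : F) : 0 ≤ p x := apply_nonneg p.toSeminorm x
theorem mul_le (x y : F) : p (x * y) ≤ p x * p y := p.mul_le' x y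
theorem star_mul_self (x : F) : p (star x * x) = p x ^ 2 := p.star_mul_self' x

theorem le_star (x : F) : p x ≤ p (star x) := by
  have h := p.mul_le (star x) x
  rw [star_mul_self] at h
  by_contra! hlt
  nlinarith [p.nonneg x, p.nonneg (star x)]

theorem apply_star (x : F) : p (star x) = p x :=
  le_antisymm (by simpa using p.le_star (star x)) (p.le_star x)

theorem map_one_le : p 1 ≤ 1 := by
  have h := p.star_mul_self 1
  simp only [star_one, mul_one] at h
  by_contra! hlt
  nlinarith

/-- The algebra `F` regarded as a seminormed algebra through `p`. -/
def Alg (_p : CStarSeminorm F) : Type u := F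

instance : Ring p.Alg := inferInstanceAs (Ring F)
instance : StarRing p.Alg := inferInstanceAs (StarRing F)
instance : Algebra ℂ p.Alg := inferInstanceAs (Algebra ℂ F)
instance [StarModule ℂ F] : StarModule ℂ p.Alg := inferInstanceAs (StarModule ℂ F)

instance : SeminormedRing p.Alg where
  __ := (inferInstance : Ring p.Alg)
  __ := (p.toSeminorm.toAddGroupSeminorm.toSeminormedAddCommGroup : SeminormedAddCommGroup F)
  norm_mul_le x y := p.mul_le x y

theorem norm_def (x : p.Alg) : ‖x‖ = p x := rfl

instance : NormedSpace ℂ p.Alg where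
  norm_smul_le c x := le_of_eq (map_smul_eq_mul p.toSeminorm c x)

instance : NormedStarGroup p.Alg := ⟨fun x => le_of_eq (p.apply_star x)⟩

/-- The completion of `F` in the C*-seminorm `p` (elements of seminorm zero are identified
with zero). -/
def Compl : Type u := UniformSpace.Completion p.Alg

open UniformSpace

instance : NormedRing p.Compl := inferInstanceAs (NormedRing (Completion p.Alg))
instance : CompleteSpace p.Compl := inferInstanceAs (CompleteSpace (Completion p.Alg))
instance : NormedAlgebra ℂ p.Compl where
  __ := (inferInstance : Algebra ℂ (Completion p.Alg))
  norm_smul_le := (inferInstance : NormedSpace ℂ (Completion p.Alg)).norm_smul_le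

/-- The canonical map of `F` into its completion. -/
def toCompl (x : F) : p.Compl := ((show p.Alg from x : p.Alg) : Completion p.Alg)

theorem norm_toCompl (x : F) : ‖p.toCompl x‖ = p x := Completion.norm_coe (E := p.Alg) x

theorem denseRange_toCompl : DenseRange p.toCompl := Completion.denseRange_coe (α := p.Alg)

theorem toCompl_add (x y : F) : p.toCompl (x + y) = p.toCompl x + p.toCompl y :=
  Completion.coe_add (α := p.Alg) x y

theorem toCompl_mul (x y : F) : p.toCompl (x * y) = p.toCompl x * p.toCompl y :=
  Completion.coe_mul (α := p.Alg) x y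

theorem toCompl_one : p.toCompl 1 = 1 := rfl

theorem toCompl_smul (c : ℂ) (x : F) : p.toCompl (c • x) = c • p.toCompl x :=
  Completion.coe_smul (X := p.Alg) c x

instance : Star p.Compl := ⟨Completion.map (star : p.Alg → p.Alg)⟩

theorem continuous_star_compl : Continuous (star : p.Compl → p.Compl) :=
  Completion.continuous_map (α := p.Alg) (β := p.Alg)

theorem toCompl_star (x : F) : p.toCompl (star x) = star (p.toCompl x) :=
  (Completion.map_coe (α := p.Alg) (β := p.Alg) 
    (AddMonoidHomClass.isometry_of_norm (starAddEquiv (R := p.Alg))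
      (fun x : p.Alg => p.apply_star x)).uniformContinuous x).symm

instance [StarModule ℂ F] : CStarAlgebra p.Compl where
  star_involutive x := by
    refine congrFun (p.denseRange_toCompl.equalizer
      (p.continuous_star_compl.comp p.continuous_star_compl) continuous_id ?_) x
    ext y
    simp only [Function.comp_apply, ← toCompl_star, star_star, id]
  star_mul x y := by
    refine p.denseRange_toCompl.induction_on₂ (isClosed_eq
      (p.continuous_star_compl.comp continuous_mul)
      ((p.continuous_star_compl.comp continuous_snd).mul
        (p.continuous_star_compl.comp continuous_fst))) ?_ x y
    intro a b
    simp only [← toCompl_mul, ← toCompl_star, star_mul]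
  star_add x y := by
    refine p.denseRange_toCompl.induction_on₂ (isClosed_eq
      (p.continuous_star_compl.comp continuous_add)
      ((p.continuous_star_compl.comp continuous_fst).add
        (p.continuous_star_compl.comp continuous_snd))) ?_ x y
    intro a b
    simp only [← toCompl_add, ← toCompl_star, star_add]
  norm_mul_self_le x := by
    refine p.denseRange_toCompl.induction_on x (isClosed_le
      (continuous_norm.mul continuous_norm)
      (continuous_norm.comp (p.continuous_star_compl.mul continuous_id))) ?_
    intro a
    simp only [← toCompl_mul, ← toCompl_star, norm_toCompl, star_mul_self]
    exact le_of_eq (sq _).symm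
  star_smul c x := by
    refine congrFun (p.denseRange_toCompl.equalizer
      (p.continuous_star_compl.comp (continuous_const_smul c))
      ((continuous_const_smul (star c)).comp p.continuous_star_compl) ?_) x
    ext y
    simp only [Function.comp_apply, ← toCompl_smul, ← toCompl_star, star_smul]

/-- The canonical map into the completion as a `*`-homomorphism. -/
def toComplHom [StarModule ℂ F] : F →⋆ₐ[ℂ] p.Compl where
  toFun := p.toCompl
  map_one' := rfl
  map_mul' := p.toCompl_mul
  map_zero' := by simpa using p.toCompl_smul 0 0
  map_add' := p.toCompl_add
  commutes' c := by rw [Algebra.algebraMap_eq_smul_one, toCompl_smul, toCompl_one,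
    Algebra.algebraMap_eq_smul_one]
  map_star' := p.toCompl_star

/-- A `*`-homomorphism bounded by a C*-seminorm extends to the completion. -/
theorem exists_extension [StarModule ℂ F] {B : Type v} [CStarAlgebra B] (e : F →⋆ₐ[ℂ] B)
    (he : ∀ x, ‖e x‖ ≤ p x) : 
    ∃ f : p.Compl →⋆ₐ[ℂ] B, Continuous f ∧ ∀ x, f (p.toCompl x) = e x := by
  let e' : p.Alg →+ B := (e : F →+ B)
  have hu : UniformContinuous e' := AddMonoidHomClass.uniformContinuous_of_bound e' 1
    (fun x => by rw [one_mul]; exact he x)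
  let h : p.Compl → B := Completion.extension e'
  have hcont : Continuous h := Completion.continuous_extension
  have hcoe : ∀ x, h (p.toCompl x) = e x := fun x => Completion.extension_coe hu x
  have hd := p.denseRange_toCompl
  have hsmul : ∀ (c : ℂ) x, h (c • x) = c • h x := fun c x => by
    refine hd.induction_on x (isClosed_eq (hcont.comp (continuous_const_smul c))
      (hcont.const_smul c)) (fun a => ?_)
    rw [← toCompl_smul, hcoe, hcoe, map_smul]
  have hone : h 1 = 1 := (hcoe 1).trans (map_one e)
  exact ⟨{
    toFun := h
    map_one' := hone
    map_zero' := by simpa using hsmul 0 0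
    map_add' := fun x y => by
      refine hd.induction_on₂ (isClosed_eq (hcont.comp continuous_add)
        ((hcont.comp continuous_fst).add (hcont.comp continuous_snd))) (fun a b => ?_) x y
      rw [← toCompl_add, hcoe, hcoe, hcoe, map_add]
    map_mul' := fun x y => by
      refine hd.induction_on₂ (isClosed_eq (hcont.comp continuous_mul)
        ((hcont.comp continuous_fst).mul (hcont.comp continuous_snd))) (fun a b => ?_) x y
      rw [← toCompl_mul, hcoe, hcoe, hcoe, map_mul]
    commutes' := fun c => by
      rw [Algebra.algebraMap_eq_smul_one, Algebra.algebraMap_eq_smul_one, hsmul, hone]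
    map_star' := fun x => by
      refine hd.induction_on x (isClosed_eq (hcont.comp continuous_star) hcont.star) (fun a => ?_)
      rw [← toCompl_star, hcoe, hcoe, map_star] }, hcont, hcoe⟩

end

/-- The C*-seminorm obtained by composing the norm of a C*-algebra with a `*`-homomorphism. -/
def comap {F : Type u} [Ring F] [StarRing F] [Algebra ℂ F] {B : Type v} [CStarAlgebra B]
    (f : F →⋆ₐ[ℂ] B) : CStarSeminorm F where
  __ := (normSeminorm ℂ B).comp (f.toAlgHom.toLinearMap)
  mul_le' x y := by
    change ‖f (x * y)‖ ≤ ‖f x‖ * ‖f y‖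
    rw [map_mul]
    exact norm_mul_le _ _
  star_mul_self' x := by
    change ‖f (star x * x)‖ = ‖f x‖ ^ 2
    rw [map_mul, map_star, CStarRing.norm_star_mul_self, sq]

theorem comap_apply {F : Type u} [Ring F] [StarRing F] [Algebra ℂ F] {B : Type v} [CStarAlgebra B]
    (f : F →⋆ₐ[ℂ] B) (x : F) : comap f x = ‖f x‖ := rfl

end CStarSeminorm

/-! ### Universal C*-algebras -/

section Universal

variable {G : Type u} (R : Set (FreeStarAlgebra G)) (C : G → ℝ≥0)

/-- The C*-seminorms on the free `*`-algebra that vanish on the relators `R` and are bounded by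
`C` on the generators. -/
def AdmissibleSeminorm : Type u :=
  {p : CStarSeminorm (FreeStarAlgebra G) // (∀ r ∈ R, p r = 0) ∧ ∀ g, p (.of g) ≤ C g}

instance : Inhabited (AdmissibleSeminorm R C) :=
  ⟨⟨{ (0 : Seminorm ℂ (FreeStarAlgebra G)) with
      mul_le' := fun _ _ => (mul_zero (0 : ℝ)).ge
      star_mul_self' := fun _ => (zero_pow two_ne_zero).symm }, fun _ _ => rfl, fun g => (C g).2⟩⟩

theorem bddAbove_admissible (x : FreeStarAlgebra G) :
    BddAbove (Set.range fun p : AdmissibleSeminorm R C => p.1 x) := by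
  suffices h : ∃ b : ℝ, ∀ p : AdmissibleSeminorm R C, p.1 x ≤ b by
    obtain ⟨b, hb⟩ := h
    exact ⟨b, by rintro _ ⟨p, rfl⟩; exact hb p⟩
  induction x using FreeStarAlgebra.induction_on with
  | scalar c =>
    refine ⟨‖c‖, fun p => ?_⟩
    rw [Algebra.algebraMap_eq_smul_one]
    calc p.1 (c • 1) = ‖c‖ * p.1 1 := map_smul_eq_mul p.1.toSeminorm c 1
      _ ≤ ‖c‖ := mul_le_of_le_one_right (norm_nonneg c) p.1.map_one_le
  | of_gen g => exact ⟨C g, fun p => p.2.2 g⟩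
  | adj g =>
    refine ⟨C g, fun p => ?_⟩
    rw [← FreeStarAlgebra.star_of, p.1.apply_star]
    exact p.2.2 g
  | mul a b ha hb =>
    obtain ⟨s, hs⟩ := ha
    obtain ⟨t, ht⟩ := hb
    exact ⟨s * t, fun p => (p.1.mul_le a b).trans
      (mul_le_mul (hs p) (ht p) (p.1.nonneg b) ((p.1.nonneg a).trans (hs p)))⟩
  | add a b ha hb =>
    obtain ⟨s, hs⟩ := ha
    obtain ⟨t, ht⟩ := hb
    exact ⟨s + t, fun p => (map_add_le_add p.1.toSeminorm a b).trans (add_le_add (hs p) (ht p))⟩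

/-- The largest C*-seminorm that vanishes on the relators `R` and is bounded by `C` on the
generators. -/
def universalSeminorm : CStarSeminorm (FreeStarAlgebra G) where
  toFun x := ⨆ p : AdmissibleSeminorm R C, p.1 x
  map_zero' := by
    have : ∀ p : AdmissibleSeminorm R C, p.1 0 = 0 := fun p => map_zero p.1.toSeminorm
    simp [this]
  add_le' x y := ciSup_le fun p => (map_add_le_add p.1.toSeminorm x y).trans
    (add_le_add (le_ciSup (bddAbove_admissible R C x) p) (le_ciSup (bddAbove_admissible R C y) p))
  neg' x := by
    have : ∀ p : AdmissibleSeminorm R C, p.1 (-x) = p.1 x := fun p => map_neg_eq_map p.1.toSeminorm x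
    simp [this]
  smul' c x := by
    have : ∀ p : AdmissibleSeminorm R C, p.1 (c • x) = ‖c‖ * p.1 x :=
      fun p => map_smul_eq_mul p.1.toSeminorm c x
    simp only [this]
    exact (Real.mul_iSup_of_nonneg (norm_nonneg c) _).symm
  mul_le' x y := ciSup_le fun p => (p.1.mul_le x y).trans
    (mul_le_mul (le_ciSup (bddAbove_admissible R C x) p) (le_ciSup (bddAbove_admissible R C y) p)
      (p.1.nonneg y) ((p.1.nonneg x).trans (le_ciSup (bddAbove_admissible R C x) p)))
  star_mul_self' x := by
    have h0 : 0 ≤ ⨆ p : AdmissibleSeminorm R C, p.1 x := Real.iSup_nonneg fun p => p.1.nonneg x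
    simp only [CStarSeminorm.star_mul_self]
    refine le_antisymm (ciSup_le fun p => pow_le_pow_left₀ (p.1.nonneg x)
      (le_ciSup (bddAbove_admissible R C x) p) 2) ?_
    have hb : BddAbove (Set.range fun p : AdmissibleSeminorm R C => p.1 x ^ 2) := by
      simpa only [CStarSeminorm.star_mul_self] using bddAbove_admissible R C (star x * x)
    have h1 : (⨆ p : AdmissibleSeminorm R C, p.1 x) ≤
        √(⨆ p : AdmissibleSeminorm R C, p.1 x ^ 2) :=
      ciSup_le fun p => Real.le_sqrt_of_sq_le (le_ciSup hb p)
    calc (⨆ p : AdmissibleSeminorm R C, p.1 x) ^ 2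
        ≤ √(⨆ p : AdmissibleSeminorm R C, p.1 x ^ 2) ^ 2 := pow_le_pow_left₀ h0 h1 2
      _ = _ := Real.sq_sqrt (Real.iSup_nonneg fun p => sq_nonneg _)

theorem le_universalSeminorm (p : AdmissibleSeminorm R C) (x : FreeStarAlgebra G) :
    p.1 x ≤ universalSeminorm R C x :=
  le_ciSup (bddAbove_admissible R C x) p

theorem universalSeminorm_le {x : FreeStarAlgebra G} {b : ℝ}
    (h : ∀ p : AdmissibleSeminorm R C, p.1 x ≤ b) : universalSeminorm R C x ≤ b :=
  ciSup_le h

/-- The universal unital C*-algebra generated by `G` subject to the relations `r = 0` for `r ∈ R`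
and `‖g‖ ≤ C g`. -/
abbrev UniversalUnital : Type u := (universalSeminorm R C).Compl

/-- The generators inside the universal unital C*-algebra. -/
def universalUnitalGen (g : G) : UniversalUnital R C := (universalSeminorm R C).toCompl (.of g)

/-- The C*-subalgebra of the universal unital C*-algebra generated by the generators. -/
def universalSubalgebra : NonUnitalStarSubalgebra ℂ (UniversalUnital R C) :=
  (NonUnitalStarAlgebra.adjoin ℂ (Set.range (universalUnitalGen R C))).topologicalClosure

/-- The universal (not necessarily unital) C*-algebra generated by `G` subject to the relations
`r = 0` for `r ∈ R` and `‖g‖ ≤ C g`. -/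
def UniversalCStar : Type u := universalSubalgebra R C

instance : NonUnitalCStarAlgebra (UniversalCStar R C) :=
  NonUnitalStarSubalgebra.nonUnitalCStarAlgebra (universalSubalgebra R C)
    (h_closed := NonUnitalStarSubalgebra.isClosed_topologicalClosure _)

/-- The generators of the universal C*-algebra. -/
def universalGen (g : G) : UniversalCStar R C :=
  ⟨universalUnitalGen R C g, NonUnitalStarSubalgebra.le_topologicalClosure _
    (NonUnitalStarAlgebra.subset_adjoin ℂ _ ⟨g, rfl⟩)⟩

theorem universalUnital_rel {r : FreeStarAlgebra G} (hr : r ∈ R) :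
    (universalSeminorm R C).toComplHom r = 0 := by
  have h : ‖(universalSeminorm R C).toCompl r‖ ≤ 0 := by
    rw [CStarSeminorm.norm_toCompl]
    exact universalSeminorm_le R C fun p => le_of_eq (p.2.1 r hr)
  exact norm_le_zero_iff.1 h

variable {R C} in
/-- A closed property that holds for the generators and is stable under the `*`-algebra operations
holds on the whole universal C*-algebra. -/
theorem universal_induction {P : UniversalCStar R C → Prop} (closed : IsClosed {a | P a})
    (gen : ∀ g, P (universalGen R C g)) (zero : P 0) (add : ∀ a b, P a → P b → P (a + b))
    (mul : ∀ a b, P a → P b → P (a * b)) (smul : ∀ (c : ℂ) a, P a → P (c • a))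
    (star : ∀ a, P a → P (star a)) (a : UniversalCStar R C) : P a := by
  obtain ⟨x, hx⟩ := a
  have hcl : IsClosed (Subtype.val '' {a : universalSubalgebra R C | P a}) :=
    (Topology.IsClosedEmbedding.isClosedMap
      (NonUnitalStarSubalgebra.isClosed_topologicalClosure _).isClosedEmbedding_subtypeVal) _ closed
  have hsub : (NonUnitalStarAlgebra.adjoin ℂ (Set.range (universalUnitalGen R C)) :
      Set (UniversalUnital R C)) ⊆ Subtype.val '' {a : universalSubalgebra R C | P a} := by
    intro y hy
    induction hy using NonUnitalStarAlgebra.adjoin_induction with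
    | mem y hy =>
      obtain ⟨g, rfl⟩ := hy
      exact ⟨_, gen g, rfl⟩
    | add y z _ _ hy hz =>
      obtain ⟨a, ha, rfl⟩ := hy
      obtain ⟨b, hb, rfl⟩ := hz
      exact ⟨_, add a b ha hb, rfl⟩
    | zero => exact ⟨_, zero, rfl⟩
    | mul y z _ _ hy hz =>
      obtain ⟨a, ha, rfl⟩ := hy
      obtain ⟨b, hb, rfl⟩ := hz
      exact ⟨_, mul a b ha hb, rfl⟩
    | smul c y _ hy =>
      obtain ⟨a, ha, rfl⟩ := hy
      exact ⟨_, smul c a ha, rfl⟩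
    | star y _ hy =>
      obtain ⟨a, ha, rfl⟩ := hy
      exact ⟨_, star a ha, rfl⟩
  obtain ⟨a, ha, rfl⟩ := closure_minimal hsub hcl hx
  exact ha

variable {R C} in
/-- Two `*`-homomorphisms out of the universal C*-algebra that agree on the generators agree. -/
theorem universal_hom_ext {B : Type v} [NonUnitalCStarAlgebra B]
    {f g : UniversalCStar R C →⋆ₙₐ[ℂ] B}
    (h : ∀ x, f (universalGen R C x) = g (universalGen R C x)) : f = g := by
  refine NonUnitalStarAlgHom.ext fun a => ?_
  induction a using universal_induction with
  | closed => exact isClosed_eq (continuous_starHom f) (continuous_starHom g)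
  | gen x => exact h x
  | zero => rw [map_zero, map_zero]
  | add a b ha hb => rw [map_add, map_add, ha, hb]
  | mul a b ha hb => rw [map_mul, map_mul, ha, hb]
  | smul c a ha => rw [map_smul, map_smul, ha]
  | star a ha => rw [map_star, map_star, ha]

variable {R} in
/-- A universal C*-algebra satisfies its relations. -/
theorem eval_universalGen {r : FreeStarAlgebra G} (hr : r ∈ R) :
    FreeStarAlgebra.eval (fun g => (universalGen R C g).1) r = 0 := by
  rw [← universalUnital_rel R C hr]
  refine congrFun (?_ : (FreeStarAlgebra.eval _ : FreeStarAlgebra G → UniversalUnital R C) = _) r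
  ext x
  induction x using FreeStarAlgebra.induction_on with
  | scalar c => exact (AlgHomClass.commutes _ c).trans (AlgHomClass.commutes _ c).symm
  | of_gen g => exact FreeStarAlgebra.eval_of _ g
  | adj g =>
    rw [← FreeStarAlgebra.star_of, map_star, map_star, FreeStarAlgebra.eval_of]
    rfl
  | mul a b ha hb => rw [map_mul, map_mul, ha, hb]
  | add a b ha hb => rw [map_add, map_add, ha, hb]

/-- The universal property: a family in a C*-algebra that satisfies the relations and the norm
bounds factors uniquely through the universal C*-algebra. -/
theorem universal_lift {B : Type v} [NonUnitalCStarAlgebra B] (q : G → B)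
    (hR : ∀ r ∈ R, FreeStarAlgebra.eval (fun g => (q g : Unitization ℂ B)) r = 0)
    (hC : ∀ g, ‖q g‖ ≤ C g) :
    ∃! f : UniversalCStar R C →⋆ₙₐ[ℂ] B, ∀ g, f (universalGen R C g) = q g := by
  set e := FreeStarAlgebra.eval (fun g => (q g : Unitization ℂ B)) with he
  have heq : ∀ g, e (.of g) = (q g : Unitization ℂ B) := FreeStarAlgebra.eval_of _
  let p : AdmissibleSeminorm R C := ⟨CStarSeminorm.comap e,
    fun r hr => by rw [CStarSeminorm.comap_apply, hR r hr, norm_zero],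
    fun g => by
      rw [CStarSeminorm.comap_apply, heq, Unitization.norm_inr]
      exact hC g⟩
  obtain ⟨h, hcont, hcoe⟩ := (universalSeminorm R C).exists_extension e (le_universalSeminorm R C p)
  have hiso : Isometry (fun b : B => (b : Unitization ℂ B)) :=
    AddMonoidHomClass.isometry_of_norm (Unitization.inrNonUnitalStarAlgHom ℂ B)
      (fun b => Unitization.norm_inr b)
  have hclosed : IsClosed (Set.range (fun b : B => (b : Unitization ℂ B))) :=
    hiso.isClosedEmbedding.isClosed_range
  have hrange : ∀ a : UniversalCStar R C, h a.1 ∈ Set.range (fun b : B => (b : Unitization ℂ B)) := by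
    intro a
    induction a using universal_induction with
    | closed => exact hclosed.preimage (hcont.comp continuous_subtype_val)
    | gen g => exact ⟨q g, ((hcoe _).trans (heq g)).symm⟩
    | zero => exact ⟨0, (map_zero h).symm⟩
    | add a b ha hb =>
      obtain ⟨x, hx⟩ := ha
      obtain ⟨y, hy⟩ := hb
      exact ⟨x + y, by
        rw [show (a + b).1 = a.1 + b.1 from rfl, map_add, ← hx, ← hy]; simp⟩
    | mul a b ha hb =>
      obtain ⟨x, hx⟩ := ha
      obtain ⟨y, hy⟩ := hb
      exact ⟨x * y, by
        rw [show (a * b).1 = a.1 * b.1 from rfl, map_mul, ← hx, ← hy]; simp⟩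
    | smul c a ha =>
      obtain ⟨x, hx⟩ := ha
      exact ⟨c • x, by
        rw [show (c • a).1 = c • a.1 from rfl, map_smul, ← hx]; simp⟩
    | star a ha =>
      obtain ⟨x, hx⟩ := ha
      exact ⟨star x, by
        rw [show (star a).1 = star a.1 from rfl, map_star, ← hx]; simp⟩
  have hsnd : ∀ a : UniversalCStar R C, ((h a.1).snd : Unitization ℂ B) = h a.1 := by
    intro a
    obtain ⟨b, hb⟩ := hrange a
    rw [← hb]
    rfl
  have hinj := Unitization.inr_injective (R := ℂ) (A := B)
  let f : UniversalCStar R C →⋆ₙₐ[ℂ] B :=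
    { toFun := fun a => (h a.1).snd
      map_smul' := fun c a => by
        change (h (c • a.1)).snd = _
        rw [map_smul]; rfl
      map_zero' := by
        change (h 0).snd = _
        rw [map_zero]; rfl
      map_add' := fun a b => by
        change (h (a.1 + b.1)).snd = _
        rw [map_add]; rfl
      map_mul' := fun a b => by
        apply hinj
        change ((h (a.1 * b.1)).snd : Unitization ℂ B) = _
        rw [Unitization.inr_mul, hsnd, hsnd]
        exact (hsnd (a * b)).trans (map_mul h _ _)
      map_star' := fun a => by
        change (h (star a.1)).snd = _
        rw [map_star]; rfl }
  have hf : ∀ g, f (universalGen R C g) = q g := fun g => by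
    change (h ((universalSeminorm R C).toCompl (.of g))).snd = _
    rw [hcoe, heq]
    rfl
  exact ⟨f, hf, fun f' hf' => universal_hom_ext fun g => by rw [hf, hf' g]⟩

end Universal
/-! ### Higher-rank graphs -/

/-- A higher-rank graph of rank `k`: a countable small category with a degree functor to `ℕ^k`
satisfying the factorisation property. A morphism `f : a ⟶ b` is a path with source `a` and range
`b`, and the path `μν` of the literature (`s(μ) = r(ν)`) is the composite `ν ≫ μ`. -/
structure KGraph (k : ℕ) where
  Obj : Type u
  [cat : SmallCategory Obj]
  countable_obj : Countable Obj
  countable_hom : ∀ a b : Obj, Countable (a ⟶ b)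
  d : ∀ {a b : Obj}, (a ⟶ b) → Fin k → ℕ
  d_id : ∀ a : Obj, d (𝟙 a) = 0
  d_comp : ∀ {a b c : Obj} (f : a ⟶ b) (g : b ⟶ c), d (f ≫ g) = d f + d g
  factor : ∀ {a b : Obj} (f : a ⟶ b) (m n : Fin k → ℕ), d f = m + n →
    ∃! p : Σ c : Obj, (c ⟶ b) × (a ⟶ c), d p.2.1 = m ∧ d p.2.2 = n ∧ p.2.2 ≫ p.2.1 = f

namespace KGraph

attribute [instance] KGraph.cat

variable {k : ℕ} (Λ : KGraph.{u} k)

/-- The set of all paths. -/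
def Path : Type u := Σ a b : Λ.Obj, (a ⟶ b)

/-- A morphism as a path. -/
def path {a b : Λ.Obj} (f : a ⟶ b) : Λ.Path := ⟨a, b, f⟩

/-- A vertex as a path of degree zero. -/
def vertex (v : Λ.Obj) : Λ.Path := Λ.path (𝟙 v)

/-- The degree of a path. -/
def deg (μ : Λ.Path) : Fin k → ℕ := Λ.d μ.2.2

/-- `Λ^min(μ, ν)`: the pairs `(α, β)` with `μα = νβ` and `d(μα) = d(μ) ∨ d(ν)`. -/
def minExt (μ ν : Λ.Path) : Set (Λ.Path × Λ.Path) :=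
  {p | ∃ (w a b c : Λ.Obj) (f : a ⟶ c) (g : b ⟶ c) (α : w ⟶ a) (β : w ⟶ b),
    μ = Λ.path f ∧ ν = Λ.path g ∧ p = (Λ.path α, Λ.path β) ∧
      α ≫ f = β ≫ g ∧ Λ.d (α ≫ f) = Λ.d f ⊔ Λ.d g}

/-- `Λ` is finitely aligned if every `Λ^min(μ, ν)` is finite. -/
def FinitelyAligned : Prop := ∀ μ ν : Λ.Path, (Λ.minExt μ ν).Finite

variable {Λ} in
theorem eq_id_of_d_eq_zero {a b : Λ.Obj} (f : a ⟶ b) (hf : Λ.d f = 0) :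
    Λ.path f = Λ.vertex b := by
  obtain ⟨p, -, hp⟩ := Λ.factor f 0 0 (by simpa using hf)
  have h1 := hp ⟨b, 𝟙 b, f⟩ ⟨Λ.d_id b, hf, Category.comp_id f⟩
  have h2 := hp ⟨a, f, 𝟙 a⟩ ⟨hf, Λ.d_id a, Category.id_comp f⟩
  have h3 := h1.trans h2.symm
  obtain rfl : b = a := congrArg Sigma.fst h3
  have h4 := eq_of_heq (Sigma.mk.inj h3).2
  rw [← (Prod.mk.inj h4).1]
  rfl

variable {Λ} in
theorem minExt_self {a b : Λ.Obj} (f : a ⟶ b) :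
    Λ.minExt (Λ.path f) (Λ.path f) = {(Λ.vertex a, Λ.vertex a)} := by
  ext p
  constructor
  · rintro ⟨w, a', b', c, f', g', α, β, h1, h2, rfl, he, hd⟩
    obtain ⟨rfl, h1⟩ := Sigma.mk.inj h1
    obtain ⟨rfl, h1⟩ := Sigma.mk.inj (eq_of_heq h1)
    obtain ⟨rfl, h2⟩ := Sigma.mk.inj h2
    obtain ⟨-, h2⟩ := Sigma.mk.inj (eq_of_heq h2)
    obtain rfl := eq_of_heq h1
    obtain rfl := eq_of_heq h2
    rw [sup_idem] at hd
    have hα : Λ.d α = 0 := by simpa [Λ.d_comp] using hd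
    have hβ : Λ.d β = 0 := by simpa [he, Λ.d_comp] using hd
    rw [eq_id_of_d_eq_zero α hα, eq_id_of_d_eq_zero β hβ]
    rfl
  · rintro rfl
    exact ⟨a, a, a, b, f, f, 𝟙 a, 𝟙 a, rfl, rfl, rfl, rfl, by simp⟩

/-- The graph `Λ^i` obtained by removing all edges of degree `e_i`: the paths are those with
`d(λ)_i = 0`, and the `i`-th coordinate of the degree is dropped. -/
def remove {k : ℕ} (Λ : KGraph.{u} (k + 1)) (i : Fin (k + 1)) : KGraph.{u} k where
  Obj := Λ.Obj
  cat :=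
    { Hom := fun a b => {f : a ⟶ b // Λ.d f i = 0}
      id := fun a => ⟨𝟙 a, by rw [Λ.d_id]; rfl⟩
      comp := fun f g => ⟨f.1 ≫ g.1, by rw [Λ.d_comp, Pi.add_apply, f.2, g.2]⟩
      id_comp := fun f => Subtype.ext (Category.id_comp f.1)
      comp_id := fun f => Subtype.ext (Category.comp_id f.1)
      assoc := fun f g h => Subtype.ext (Category.assoc f.1 g.1 h.1) }
  countable_obj := Λ.countable_obj
  countable_hom a b := by
    have := Λ.countable_hom a b
    exact Subtype.countable
  d f := i.removeNth (Λ.d f.1)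
  d_id a := by
    change i.removeNth (Λ.d (𝟙 a)) = 0
    rw [Λ.d_id]; rfl
  d_comp f g := by
    change i.removeNth (Λ.d (f.1 ≫ g.1)) = _
    rw [Λ.d_comp]; rfl
  factor {a b} f m n h := by
    have h' : Λ.d f.1 = i.insertNth 0 m + i.insertNth 0 n := by
      funext j
      refine Fin.succAboveCases i ?_ (fun j => ?_) j
      · simpa using f.2
      · simpa [Fin.removeNth_apply] using congrFun h j
    have key : ∀ {a b : Λ.Obj} (g : a ⟶ b) (m : Fin k → ℕ),
        Λ.d g = i.insertNth 0 m ↔ Λ.d g i = 0 ∧ i.removeNth (Λ.d g) = m := by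
      intro a b g m
      exact Fin.eq_insertNth_iff
    obtain ⟨⟨c, μ, ν⟩, ⟨h1, h2, h3⟩, huniq⟩ := Λ.factor f.1 _ _ h'
    rw [key] at h1 h2
    refine ⟨⟨c, ⟨μ, h1.1⟩, ⟨ν, h2.1⟩⟩, ⟨h1.2, h2.2, Subtype.ext h3⟩, ?_⟩
    rintro ⟨c', μ', ν'⟩ ⟨h1', h2', h3'⟩
    have := huniq ⟨c', μ'.1, ν'.1⟩
      ⟨(key _ _).2 ⟨μ'.2, h1'⟩, (key _ _).2 ⟨ν'.2, h2'⟩, congrArg Subtype.val h3'⟩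
    obtain ⟨rfl, h4⟩ := Sigma.mk.inj this
    have h5 := Prod.mk.inj (eq_of_heq h4)
    refine Sigma.ext rfl (heq_of_eq (Prod.ext (Subtype.ext h5.1) (Subtype.ext h5.2)))

/-- The inclusion of the paths of `Λ^i` into the paths of `Λ`. -/
def incl {k : ℕ} (Λ : KGraph.{u} (k + 1)) (i : Fin (k + 1)) (μ : (Λ.remove i).Path) : Λ.Path :=
  ⟨μ.1, μ.2.1, μ.2.2.1⟩

theorem incl_injective {k : ℕ} (Λ : KGraph.{u} (k + 1)) (i : Fin (k + 1)) :
    Function.Injective (Λ.incl i) := by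
  rintro ⟨a, b, f⟩ ⟨a', b', f'⟩ h
  obtain ⟨rfl, h⟩ := Sigma.mk.inj h
  obtain ⟨rfl, h⟩ := Sigma.mk.inj (eq_of_heq h)
  obtain rfl := Subtype.ext (eq_of_heq h)
  rfl

theorem bijOn_minExt {k : ℕ} (Λ : KGraph.{u} (k + 1)) (i : Fin (k + 1))
    (μ ν : (Λ.remove i).Path) :
    Set.BijOn (Prod.map (Λ.incl i) (Λ.incl i)) ((Λ.remove i).minExt μ ν)
      (Λ.minExt (Λ.incl i μ) (Λ.incl i ν)) := by
  refine ⟨?_, ((Λ.incl_injective i).prodMap (Λ.incl_injective i)).injOn, ?_⟩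
  · rintro _ ⟨w, a, b, c, f, g, α, β, rfl, rfl, rfl, he, hd⟩
    refine ⟨w, a, b, c, f.1, g.1, α.1, β.1, rfl, rfl, rfl, congrArg Subtype.val he, ?_⟩
    funext j
    refine Fin.succAboveCases i ?_ (fun j => ?_) j
    · refine (congrFun (Λ.d_comp (a := w) (b := a) (c := c) α.1 f.1) i).trans ?_
      rw [Pi.add_apply, Pi.sup_apply, f.2, g.2, α.2, sup_idem]
    · exact congrFun hd j
  · rintro _ ⟨w, a, b, c, f, g, α, β, h1, h2, rfl, he, hd⟩
    obtain ⟨a', c', f'⟩ := μ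
    obtain ⟨b', c'', g'⟩ := ν
    obtain ⟨rfl, h1⟩ := Sigma.mk.inj h1
    obtain ⟨rfl, h1⟩ := Sigma.mk.inj (eq_of_heq h1)
    obtain ⟨rfl, h2⟩ := Sigma.mk.inj h2
    obtain ⟨rfl, h2⟩ := Sigma.mk.inj (eq_of_heq h2)
    obtain rfl := eq_of_heq h1
    obtain rfl := eq_of_heq h2
    have hd' : Λ.d (α ≫ f'.1) i = 0 := by
      rw [hd, Pi.sup_apply, f'.2, g'.2, sup_idem]
    have hα : Λ.d α i = 0 :=
      (Nat.add_eq_zero_iff.1 ((congrFun (Λ.d_comp α f'.1) i).symm.trans hd')).1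
    have hβ : Λ.d β i = 0 :=
      (Nat.add_eq_zero_iff.1 ((congrFun (Λ.d_comp β g'.1) i).symm.trans (he ▸ hd'))).1
    refine ⟨((Λ.remove i).path (a := w) ⟨α, hα⟩, (Λ.remove i).path (a := w) ⟨β, hβ⟩),
      ⟨w, _, _, _, f', g', ⟨α, hα⟩, ⟨β, hβ⟩, rfl, rfl, rfl, Subtype.ext he, ?_⟩, rfl⟩
    funext j
    exact congrFun hd (i.succAbove j)

theorem FinitelyAligned.remove {k : ℕ} {Λ : KGraph.{u} (k + 1)} (h : Λ.FinitelyAligned)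
    (i : Fin (k + 1)) : (Λ.remove i).FinitelyAligned :=
  fun μ ν => (Λ.bijOn_minExt i μ ν).finite_iff_finite.2 (h _ _)

end KGraph

/-! ### Toeplitz--Cuntz--Krieger algebras -/

/-- A Toeplitz--Cuntz--Krieger `Λ`-family in a C*-algebra: the vertex elements are mutually
orthogonal projections, `q_μ q_ν = q_{μν}` if `s(μ) = r(ν)`, and `q_μ^* q_ν = ∑ q_α q_β^*` over
`(α, β) ∈ Λ^min(μ, ν)` (a finite sum when `Λ` is finitely aligned). -/
structure IsTCKFamily {k : ℕ} (Λ : KGraph.{u} k) {B : Type v} [NonUnitalCStarAlgebra B]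
    (q : Λ.Path → B) : Prop where
  proj : ∀ v, IsStarProjection (q (Λ.vertex v))
  orth : ∀ v w, v ≠ w → q (Λ.vertex v) * q (Λ.vertex w) = 0
  mul : ∀ {a b c : Λ.Obj} (μ : b ⟶ c) (ν : a ⟶ b),
    q (Λ.path μ) * q (Λ.path ν) = q (Λ.path (ν ≫ μ))
  star_mul : ∀ μ ν, star (q μ) * q ν = ∑ᶠ p ∈ Λ.minExt μ ν, q p.1 * star (q p.2)

/-- The relators expressing, in the free `*`-algebra on the paths, that the generators form a
Toeplitz--Cuntz--Krieger family. -/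
inductive TCKRel {k : ℕ} (Λ : KGraph.{u} k) : FreeStarAlgebra Λ.Path → Prop
  | selfAdjoint (v : Λ.Obj) :
      TCKRel Λ (star (.of (Λ.vertex v)) - .of (Λ.vertex v))
  | idempotent (v : Λ.Obj) :
      TCKRel Λ (.of (Λ.vertex v) * .of (Λ.vertex v) - .of (Λ.vertex v))
  | orth (v w : Λ.Obj) (h : v ≠ w) :
      TCKRel Λ (.of (Λ.vertex v) * .of (Λ.vertex w))
  | mul {a b c : Λ.Obj} (μ : b ⟶ c) (ν : a ⟶ b) :
      TCKRel Λ (.of (Λ.path μ) * .of (Λ.path ν) - .of (Λ.path (ν ≫ μ)))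
  | star_mul (μ ν : Λ.Path) :
      TCKRel Λ (star (.of μ) * .of ν - ∑ᶠ p ∈ Λ.minExt μ ν, .of p.1 * star (.of p.2))

/-- The Toeplitz--Cuntz--Krieger algebra `TC*(Λ)` of a finitely aligned `k`-graph: the universal
C*-algebra generated by a Toeplitz--Cuntz--Krieger `Λ`-family. (The bound `1` on the generators is
automatic, see `tck_lift`.) -/
def TCK {k : ℕ} (Λ : KGraph.{u} k) : Type u := UniversalCStar {r | TCKRel Λ r} (fun _ => 1)

instance {k : ℕ} (Λ : KGraph.{u} k) : NonUnitalCStarAlgebra (TCK Λ) :=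
  inferInstanceAs (NonUnitalCStarAlgebra (UniversalCStar {r | TCKRel Λ r} (fun _ => 1)))

/-- The universal Toeplitz--Cuntz--Krieger family `t_λ`. -/
def tck {k : ℕ} (Λ : KGraph.{u} k) (μ : Λ.Path) : TCK Λ := universalGen _ _ μ

/-- A family kills the relators exactly when it is a Toeplitz--Cuntz--Krieger family. -/
theorem isTCKFamily_iff {k : ℕ} {Λ : KGraph.{u} k} (hΛ : Λ.FinitelyAligned) {B : Type v}
    [NonUnitalCStarAlgebra B] {D : Type*} [CStarAlgebra D] (j : B →⋆ₙₐ[ℂ] D)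
    (hj : Function.Injective j) (q : Λ.Path → B) :
    (∀ r, TCKRel Λ r → FreeStarAlgebra.eval (fun μ => j (q μ)) r = 0) ↔ IsTCKFamily Λ q := by
  set e := FreeStarAlgebra.eval (fun μ => j (q μ)) with he
  have hof : ∀ μ, e (.of μ) = j (q μ) := FreeStarAlgebra.eval_of _
  have hsum : ∀ μ ν, e (∑ᶠ p ∈ Λ.minExt μ ν, .of p.1 * star (.of p.2)) =
      j (∑ᶠ p ∈ Λ.minExt μ ν, q p.1 * star (q p.2)) := by
    intro μ ν
    rw [finsum_mem_eq_finite_toFinset_sum _ (hΛ μ ν), finsum_mem_eq_finite_toFinset_sum _ (hΛ μ ν),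
      map_sum, map_sum]
    simp only [map_mul, map_star, hof]
  constructor
  · intro h
    refine ⟨fun v => ⟨?_, ?_⟩, fun v w hvw => ?_, fun μ ν => ?_, fun μ ν => ?_⟩ <;> apply hj
    · simpa [hof, sub_eq_zero] using h _ (.idempotent v)
    · have h1 := h _ (.selfAdjoint v)
      rwa [map_sub, map_star, hof, ← map_star, sub_eq_zero] at h1
    · simpa [hof, sub_eq_zero] using h _ (.orth v w hvw)
    · simpa [hof, sub_eq_zero] using h _ (.mul μ ν)
    · have h1 := h _ (.star_mul μ ν)
      rwa [map_sub, map_mul, map_star, hof, hof, hsum, ← map_star, ← map_mul, sub_eq_zero] at h1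
  · rintro h r (v | v | ⟨v, w, hvw⟩ | ⟨μ, ν⟩ | ⟨μ, ν⟩)
    · rw [map_sub, map_star, hof, ← map_star, (h.proj v).isSelfAdjoint.star_eq, sub_self]
    · rw [map_sub, map_mul, hof, ← map_mul, (h.proj v).isIdempotentElem.eq, sub_self]
    · rw [map_mul, hof, hof, ← map_mul, h.orth v w hvw, map_zero]
    · rw [map_sub, map_mul, hof, hof, hof, ← map_mul, h.mul, sub_self]
    · rw [map_sub, map_mul, map_star, hof, hof, hsum, ← map_star, ← map_mul, h.star_mul, sub_self]

theorem isTCKFamily_tck {k : ℕ} {Λ : KGraph.{u} k} (hΛ : Λ.FinitelyAligned) :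
    IsTCKFamily Λ (tck Λ) :=
  (isTCKFamily_iff hΛ (NonUnitalStarSubalgebraClass.subtype (universalSubalgebra _ _))
    Subtype.val_injective (tck Λ)).1 fun _ hr => eval_universalGen _ hr

/-- The universal property of `TC*(Λ)`. -/
theorem tck_lift {k : ℕ} {Λ : KGraph.{u} k} (hΛ : Λ.FinitelyAligned) {B : Type v}
    [NonUnitalCStarAlgebra B] (q : Λ.Path → B) (hq : IsTCKFamily Λ q) :
    ∃! f : TCK Λ →⋆ₙₐ[ℂ] B, ∀ μ, f (tck Λ μ) = q μ := by
  refine universal_lift _ _ q ((isTCKFamily_iff hΛ (Unitization.inrNonUnitalStarAlgHom ℂ B)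
    Unitization.inr_injective q).2 hq) ?_
  have hv : ∀ v, ‖q (Λ.vertex v)‖ ≤ 1 := fun v => (hq.proj v).norm_le
  rintro ⟨a, b, f⟩
  have h := hq.star_mul (Λ.path f) (Λ.path f)
  rw [KGraph.minExt_self, finsum_mem_singleton, (hq.proj a).isSelfAdjoint.star_eq,
    (hq.proj a).isIdempotentElem.eq] at h
  have h2 : ‖q (Λ.path f)‖ * ‖q (Λ.path f)‖ ≤ 1 := by
    rw [← CStarRing.norm_star_mul_self, h]
    exact hv a
  change ‖q (Λ.path f)‖ ≤ 1
  nlinarith [norm_nonneg (q (Λ.path f))]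

/-- A closed property of elements of `TC*(Λ)` that holds for the generators and is stable under the
`*`-algebra operations always holds. -/
theorem tck_induction {k : ℕ} {Λ : KGraph.{u} k} {P : TCK Λ → Prop} (closed : IsClosed {a | P a})
    (gen : ∀ μ, P (tck Λ μ)) (zero : P 0) (add : ∀ a b, P a → P b → P (a + b))
    (mul : ∀ a b, P a → P b → P (a * b)) (smul : ∀ (c : ℂ) a, P a → P (c • a))
    (star : ∀ a, P a → P (star a)) (a : TCK Λ) : P a :=
  universal_induction (P := P) closed gen zero add mul smul star a

/-! ### Hilbert bimodules and their Toeplitz algebras -/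

/-- The operations of a Hilbert `A`-bimodule: a complex vector space with an `A`-valued inner
product, a right action and a left action of `A`. The laws are those of `IsHilbertBimodule`. -/
structure BimoduleData (A : Type u) [NonUnitalCStarAlgebra A] where
  carrier : Type u
  [addCommGroup : AddCommGroup carrier]
  [module : Module ℂ carrier]
  inner : carrier → carrier → A
  rsmul : carrier → A → carrier
  lsmul : A → carrier → carrier

attribute [instance] BimoduleData.addCommGroup BimoduleData.module

section Bimodule

variable {A : Type u} [NonUnitalCStarAlgebra A]

/-- The laws of a Hilbert `A`-bimodule: a right Hilbert `A`-module (inner product linear in the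
second variable, complete for the norm `‖⟨x, x⟩‖^(1/2)`) on which `A` acts from the left by a
`*`-homomorphism into the adjointable operators. Positivity of `⟨x, x⟩` is expressed as
`⟨x, x⟩ = b^* b`. -/
structure IsHilbertBimodule (X : BimoduleData A) : Prop where
  add_rsmul : ∀ x y a, X.rsmul (x + y) a = X.rsmul x a + X.rsmul y a
  rsmul_add : ∀ x a b, X.rsmul x (a + b) = X.rsmul x a + X.rsmul x b
  rsmul_mul : ∀ x a b, X.rsmul x (a * b) = X.rsmul (X.rsmul x a) b
  smul_rsmul : ∀ (c : ℂ) x a, X.rsmul (c • x) a = c • X.rsmul x a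
  rsmul_smul : ∀ (c : ℂ) x a, X.rsmul x (c • a) = c • X.rsmul x a
  inner_add_right : ∀ x y z, X.inner x (y + z) = X.inner x y + X.inner x z
  inner_smul_right : ∀ (c : ℂ) x y, X.inner x (c • y) = c • X.inner x y
  star_inner : ∀ x y, star (X.inner y x) = X.inner x y
  inner_rsmul : ∀ x y a, X.inner x (X.rsmul y a) = X.inner x y * a
  inner_self_nonneg : ∀ x, ∃ b, X.inner x x = star b * b
  inner_self_eq_zero : ∀ x, X.inner x x = 0 ↔ x = 0
  complete : ∀ s : ℕ → X.carrier,
    (∀ ε > 0, ∃ N, ∀ m ≥ N, ∀ n ≥ N, √‖X.inner (s m - s n) (s m - s n)‖ < ε) →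
    ∃ x, ∀ ε > 0, ∃ N, ∀ n ≥ N, √‖X.inner (s n - x) (s n - x)‖ < ε
  lsmul_add : ∀ a x y, X.lsmul a (x + y) = X.lsmul a x + X.lsmul a y
  lsmul_smul : ∀ a (c : ℂ) x, X.lsmul a (c • x) = c • X.lsmul a x
  lsmul_rsmul : ∀ a x b, X.lsmul a (X.rsmul x b) = X.rsmul (X.lsmul a x) b
  inner_lsmul : ∀ a x y, X.inner (X.lsmul a x) y = X.inner x (X.lsmul (star a) y)
  add_lsmul : ∀ a b x, X.lsmul (a + b) x = X.lsmul a x + X.lsmul b x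
  smul_lsmul : ∀ (c : ℂ) a x, X.lsmul (c • a) x = c • X.lsmul a x
  mul_lsmul : ∀ a b x, X.lsmul (a * b) x = X.lsmul a (X.lsmul b x)

/-- The Hilbert bimodule `A` over itself, with `⟨a, b⟩ = a^* b`. -/
def selfBimodule (A : Type u) [NonUnitalCStarAlgebra A] : BimoduleData A where
  carrier := A
  inner a b := star a * b
  rsmul x a := x * a
  lsmul a x := a * x

/-- Hilbert bimodule isomorphisms: surjective, left linear, inner product preserving maps. -/
structure IsBimoduleIso (X Y : BimoduleData A) (f : X.carrier → Y.carrier) : Prop where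
  surjective : Function.Surjective f
  map_lsmul : ∀ a x, f (X.lsmul a x) = Y.lsmul a (f x)
  inner_map : ∀ x y, Y.inner (f x) (f y) = X.inner x y

/-- `Z`, with `τ x y` in the role of `x ⊗ y`, is the balanced tensor product `X ⊗_A Y`: it is a
Hilbert bimodule in which the elements `τ x y` are balanced, have dense span, and satisfy
`⟨x ⊗ y, x' ⊗ y'⟩ = ⟨y, ⟨x, x'⟩ · y'⟩` and `a · (x ⊗ y) · b = (a · x) ⊗ (y · b)`. -/
structure IsBalancedTensor (X Y Z : BimoduleData A)
    (τ : X.carrier →ₗ[ℂ] Y.carrier →ₗ[ℂ] Z.carrier) : Prop where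
  isHilbertBimodule : IsHilbertBimodule Z
  balanced : ∀ x a y, τ (X.rsmul x a) y = τ x (Y.lsmul a y)
  inner_tmul : ∀ x y x' y', Z.inner (τ x y) (τ x' y') = Y.inner y (Y.lsmul (X.inner x x') y')
  lsmul_tmul : ∀ a x y, Z.lsmul a (τ x y) = τ (X.lsmul a x) y
  rsmul_tmul : ∀ x y b, Z.rsmul (τ x y) b = τ x (Y.rsmul y b)
  dense : ∀ z, ∀ ε > 0, ∃ w ∈ Submodule.span ℂ {w | ∃ x y, w = τ x y},
    √‖Z.inner (z - w) (z - w)‖ < ε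

/-- The sequence of bimodules `A, X, Q 0, Q 1, …`. -/
def powerSeq (X : BimoduleData A) (Q : ℕ → BimoduleData A) : ℕ → BimoduleData A
  | 0 => selfBimodule A
  | 1 => X
  | n + 2 => Q n

/-- The balanced tensor powers of `X`: `X^{⊗ 0} = A`, `X^{⊗ 1} = X` and
`X^{⊗ (n + 2)} = X ⊗_A X^{⊗ (n + 1)}`, the latter being `higher n`. -/
structure TensorPowers (X : BimoduleData A) where
  higher : ℕ → BimoduleData A
  tensor : ∀ n, X.carrier →ₗ[ℂ] (powerSeq X higher (n + 1)).carrier →ₗ[ℂ] (higher n).carrier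
  isBalancedTensor : ∀ n, IsBalancedTensor X (powerSeq X higher (n + 1)) (higher n) (tensor n)

namespace TensorPowers

variable {X : BimoduleData A} (T : TensorPowers X)

/-- The `n`-th tensor power `X^{⊗ n}`. -/
def pow (n : ℕ) : BimoduleData A := powerSeq X T.higher n

/-- The map `(x, y) ↦ x ⊗ y` from `X × X^{⊗ n}` to `X^{⊗ (n + 1)}`; for `n = 0` it is the right
action of `A` on `X`. -/
def tmul : ∀ n : ℕ, X.carrier → (T.pow n).carrier → (T.pow (n + 1)).carrier
  | 0 => fun x a => X.rsmul x a
  | n + 1 => fun x y => T.tensor n x y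

end TensorPowers

/-- Toeplitz representations `(ψ, π)` of a Hilbert bimodule in a C*-algebra. -/
structure IsToeplitzRep (X : BimoduleData A) {B : Type v} [NonUnitalCStarAlgebra B]
    (ψ : X.carrier →ₗ[ℂ] B) (π : A →⋆ₙₐ[ℂ] B) : Prop where
  lsmul : ∀ a x, ψ (X.lsmul a x) = π a * ψ x
  rsmul : ∀ x a, ψ (X.rsmul x a) = ψ x * π a
  inner : ∀ x y, star (ψ x) * ψ y = π (X.inner x y)

/-- The relators expressing, in the free `*`-algebra on the disjoint union of `X` and `A`, that
`ψ` is linear, `π` is a `*`-homomorphism and `(ψ, π)` is a Toeplitz representation. -/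
inductive ToeplitzRel (X : BimoduleData A) : FreeStarAlgebra (X.carrier ⊕ A) → Prop
  | add (x y : X.carrier) :
      ToeplitzRel X (.of (.inl (x + y)) - (.of (.inl x) + .of (.inl y)))
  | smul (c : ℂ) (x : X.carrier) :
      ToeplitzRel X (.of (.inl (c • x)) - c • .of (.inl x))
  | coeff_add (a b : A) :
      ToeplitzRel X (.of (.inr (a + b)) - (.of (.inr a) + .of (.inr b)))
  | coeff_smul (c : ℂ) (a : A) :
      ToeplitzRel X (.of (.inr (c • a)) - c • .of (.inr a))
  | coeff_mul (a b : A) :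
      ToeplitzRel X (.of (.inr (a * b)) - .of (.inr a) * .of (.inr b))
  | coeff_star (a : A) :
      ToeplitzRel X (.of (.inr (star a)) - star (.of (.inr a)))
  | lsmul (a : A) (x : X.carrier) :
      ToeplitzRel X (.of (.inl (X.lsmul a x)) - .of (.inr a) * .of (.inl x))
  | rsmul (x : X.carrier) (a : A) :
      ToeplitzRel X (.of (.inl (X.rsmul x a)) - .of (.inl x) * .of (.inr a))
  | inner (x y : X.carrier) :
      ToeplitzRel X (star (.of (.inl x)) * .of (.inl y) - .of (.inr (X.inner x y)))

/-- Norm bounds on the generators of the Toeplitz algebra; they hold automatically in every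
Toeplitz representation, see `toeplitz_lift`. -/
def toeplitzBound (X : BimoduleData A) : X.carrier ⊕ A → ℝ≥0 :=
  Sum.elim (fun x => NNReal.sqrt ‖X.inner x x‖₊) (fun a => ‖a‖₊)

/-- The Toeplitz algebra `T_X`: the universal C*-algebra for Toeplitz representations of `X`. -/
def ToeplitzAlgebra (X : BimoduleData A) : Type u :=
  UniversalCStar {r | ToeplitzRel X r} (toeplitzBound X)

instance (X : BimoduleData A) : NonUnitalCStarAlgebra (ToeplitzAlgebra X) :=
  inferInstanceAs (NonUnitalCStarAlgebra (UniversalCStar {r | ToeplitzRel X r} (toeplitzBound X)))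

variable (X : BimoduleData A)

theorem toeplitz_eval {r : FreeStarAlgebra (X.carrier ⊕ A)} (hr : ToeplitzRel X r) :
    FreeStarAlgebra.eval (fun g => NonUnitalStarSubalgebraClass.subtype
      (universalSubalgebra {r | ToeplitzRel X r} (toeplitzBound X)) (universalGen _ _ g)) r = 0 :=
  eval_universalGen (R := {r | ToeplitzRel X r}) (toeplitzBound X) hr

/-- The universal map `i_X` of `X` into its Toeplitz algebra. -/
def toeplitzX : X.carrier →ₗ[ℂ] ToeplitzAlgebra X where
  toFun x := universalGen _ _ (.inl x)
  map_add' x y := Subtype.val_injective <| by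
    have h := toeplitz_eval X (.add x y)
    simp only [map_sub, map_add, FreeStarAlgebra.eval_of, sub_eq_zero] at h
    exact h
  map_smul' c x := Subtype.val_injective <| by
    have h := toeplitz_eval X (.smul c x)
    simp only [map_sub, map_smul, FreeStarAlgebra.eval_of, sub_eq_zero] at h
    exact h

/-- The universal map `i_A` of `A` into the Toeplitz algebra of `X`. -/
def toeplitzA : A →⋆ₙₐ[ℂ] ToeplitzAlgebra X where
  toFun a := universalGen _ _ (.inr a)
  map_add' a b := Subtype.val_injective <| by
    have h := toeplitz_eval X (.coeff_add a b)
    simp only [map_sub, map_add, FreeStarAlgebra.eval_of, sub_eq_zero] at h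
    exact h
  map_smul' c a := Subtype.val_injective <| by
    have h := toeplitz_eval X (.coeff_smul c a)
    simp only [map_sub, map_smul, FreeStarAlgebra.eval_of, sub_eq_zero] at h
    exact h
  map_zero' := Subtype.val_injective <| by
    have h := toeplitz_eval X (.coeff_smul 0 0)
    rw [map_sub, FreeStarAlgebra.eval_of, zero_smul, zero_smul, map_zero, sub_zero] at h
    exact h
  map_mul' a b := Subtype.val_injective <| by
    have h := toeplitz_eval X (.coeff_mul a b)
    simp only [map_sub, map_mul, FreeStarAlgebra.eval_of, sub_eq_zero] at h
    exact h
  map_star' a := Subtype.val_injective <| by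
    have h := toeplitz_eval X (.coeff_star a)
    rw [map_sub, map_star, FreeStarAlgebra.eval_of, FreeStarAlgebra.eval_of, sub_eq_zero] at h
    exact h

theorem isToeplitzRep_toeplitz : IsToeplitzRep X (toeplitzX X) (toeplitzA X) where
  lsmul a x := Subtype.val_injective <| by
    have h := toeplitz_eval X (.lsmul a x)
    simp only [map_sub, map_mul, FreeStarAlgebra.eval_of, sub_eq_zero] at h
    exact h
  rsmul x a := Subtype.val_injective <| by
    have h := toeplitz_eval X (.rsmul x a)
    simp only [map_sub, map_mul, FreeStarAlgebra.eval_of, sub_eq_zero] at h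
    exact h
  inner x y := Subtype.val_injective <| by
    have h := toeplitz_eval X (.inner x y)
    rw [map_sub, map_mul, map_star, FreeStarAlgebra.eval_of, FreeStarAlgebra.eval_of,
      FreeStarAlgebra.eval_of, sub_eq_zero] at h
    exact h

variable {X} in
/-- The universal property of `T_X`. -/
theorem toeplitz_lift {B : Type v} [NonUnitalCStarAlgebra B] {ψ : X.carrier →ₗ[ℂ] B}
    {π : A →⋆ₙₐ[ℂ] B} (h : IsToeplitzRep X ψ π) :
    ∃! f : ToeplitzAlgebra X →⋆ₙₐ[ℂ] B,
      (∀ x, f (toeplitzX X x) = ψ x) ∧ ∀ a, f (toeplitzA X a) = π a := by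
  have key : ∃! f : ToeplitzAlgebra X →⋆ₙₐ[ℂ] B,
      ∀ g, f (universalGen _ _ g : ToeplitzAlgebra X) = Sum.elim ψ π g := by
    refine universal_lift _ _ (Sum.elim ψ π) ?_ ?_
    · set e := FreeStarAlgebra.eval (fun g => ((Sum.elim ψ π g : B) : Unitization ℂ B)) with he
      have h1 : ∀ x, e (.of (.inl x)) = (ψ x : Unitization ℂ B) :=
        fun x => FreeStarAlgebra.eval_of _ (Sum.inl x)
      have h2 : ∀ a, e (.of (.inr a)) = (π a : Unitization ℂ B) :=
        fun x => FreeStarAlgebra.eval_of _ (Sum.inr x)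
      rintro r (⟨x, y⟩ | ⟨c, x⟩ | ⟨a, b⟩ | ⟨c, a⟩ | ⟨a, b⟩ | a | ⟨a, x⟩ | ⟨x, a⟩ | ⟨x, y⟩)
      · simp [h1]
      · simp [h1]
      · simp [h2]
      · simp [h2]
      · simp [h2]
      · rw [map_sub, map_star, h2, h2, map_star, Unitization.inr_star, sub_self]
      · simp [h1, h2, h.lsmul]
      · simp [h1, h2, h.rsmul]
      · rw [map_sub, map_mul, map_star, h1, h1, h2, ← h.inner, Unitization.inr_mul,
          Unitization.inr_star, sub_self]
    · rintro (x | a)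
      · change ‖ψ x‖ ≤ ((NNReal.sqrt ‖X.inner x x‖₊ : ℝ≥0) : ℝ)
        rw [Real.coe_sqrt]
        refine Real.le_sqrt_of_sq_le ?_
        rw [sq, ← CStarRing.norm_star_mul_self, h.inner]
        exact NonUnitalStarAlgHom.norm_apply_le π _
      · exact NonUnitalStarAlgHom.norm_apply_le π a
  refine (existsUnique_congr fun f => ?_).1 key
  exact Sum.forall

end Bimodule

/-! ### The bimodules `X_n` -/

section Graded

variable {k : ℕ} {Λ : KGraph.{u} (k + 1)}

theorem isTCKFamily_incl (hΛ : Λ.FinitelyAligned) (i : Fin (k + 1)) :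
    IsTCKFamily (Λ.remove i) (fun μ => tck Λ (Λ.incl i μ)) where
  proj v := (isTCKFamily_tck hΛ).proj v
  orth v w h := (isTCKFamily_tck hΛ).orth v w h
  mul μ ν := (isTCKFamily_tck hΛ).mul μ.1 ν.1
  star_mul μ ν := ((isTCKFamily_tck hΛ).star_mul _ _).trans
    (finsum_mem_eq_of_bijOn _ (Λ.bijOn_minExt i μ ν) fun _ _ => rfl).symm

/-- The `*`-homomorphism `φ : TC*(Λ^i) → TC*(Λ)` with `φ(t_μ) = t_μ` for `μ ∈ Λ^i`. -/
def inclHom (hΛ : Λ.FinitelyAligned) (i : Fin (k + 1)) : TCK (Λ.remove i) →⋆ₙₐ[ℂ] TCK Λ :=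
  (tck_lift (hΛ.remove i) _ (isTCKFamily_incl hΛ i)).choose

theorem inclHom_tck (hΛ : Λ.FinitelyAligned) (i : Fin (k + 1)) (μ : (Λ.remove i).Path) :
    inclHom hΛ i (tck (Λ.remove i) μ) = tck Λ (Λ.incl i μ) :=
  (tck_lift (hΛ.remove i) _ (isTCKFamily_incl hΛ i)).choose_spec.1 μ

variable (Λ) in
/-- The closed subspace `X_n` of `TC*(Λ)`, the closed span of the elements `t_λ t_μ^*` with
`d(λ)_i = n` and `d(μ)_i = 0`. -/
def gradedSubspace (i : Fin (k + 1)) (n : ℕ) : Submodule ℂ (TCK Λ) :=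
  (Submodule.span ℂ {x | ∃ μ ν : Λ.Path, Λ.deg μ i = n ∧ Λ.deg ν i = 0 ∧
    x = tck Λ μ * star (tck Λ ν)}).topologicalClosure

theorem mul_star_mem (i : Fin (k + 1)) {n : ℕ} {μ ν : Λ.Path} (hμ : Λ.deg μ i = n)
    (hν : Λ.deg ν i = 0) : tck Λ μ * star (tck Λ ν) ∈ gradedSubspace Λ i n :=
  Submodule.le_topologicalClosure _ (Submodule.subset_span ⟨μ, ν, hμ, hν, rfl⟩)

theorem tck_mul_vertex (hΛ : Λ.FinitelyAligned) (μ : Λ.Path) :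
    tck Λ μ * tck Λ (Λ.vertex μ.1) = tck Λ μ := by
  obtain ⟨a, b, f⟩ := μ
  have h := (isTCKFamily_tck hΛ).mul f (𝟙 a)
  rwa [Category.id_comp] at h

theorem vertex_mul_tck (hΛ : Λ.FinitelyAligned) (μ : Λ.Path) :
    tck Λ (Λ.vertex μ.2.1) * tck Λ μ = tck Λ μ := by
  obtain ⟨a, b, f⟩ := μ
  have h := (isTCKFamily_tck hΛ).mul (𝟙 b) f
  rwa [Category.comp_id] at h

theorem tck_mem (hΛ : Λ.FinitelyAligned) (i : Fin (k + 1)) (μ : Λ.Path) :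
    tck Λ μ ∈ gradedSubspace Λ i (Λ.deg μ i) := by
  have h := mul_star_mem i (n := Λ.deg μ i) (ν := Λ.vertex μ.1) rfl
    (congrFun (Λ.d_id μ.1) i)
  rwa [((isTCKFamily_tck hΛ).proj μ.1).isSelfAdjoint.star_eq, tck_mul_vertex hΛ] at h

/-- A product `t_μ t_ν` is zero or of the form `t_{μν}`. -/
theorem tck_mul_tck (hΛ : Λ.FinitelyAligned) (μ ν : Λ.Path) : tck Λ μ * tck Λ ν = 0 ∨
    ∃ ξ, tck Λ μ * tck Λ ν = tck Λ ξ ∧ Λ.deg ξ = Λ.deg μ + Λ.deg ν := by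
  by_cases h : μ.1 = ν.2.1
  · right
    obtain ⟨a, b, f⟩ := μ
    obtain ⟨c, a', g⟩ := ν
    obtain rfl : a = a' := h
    exact ⟨Λ.path (g ≫ f), (isTCKFamily_tck hΛ).mul f g, (Λ.d_comp g f).trans (add_comm _ _)⟩
  · left
    rw [← tck_mul_vertex hΛ μ, ← vertex_mul_tck hΛ ν, mul_assoc, ← mul_assoc (tck Λ (Λ.vertex _)),
      (isTCKFamily_tck hΛ).orth _ _ h, zero_mul, mul_zero]

theorem deg_of_mem_minExt {μ ν : Λ.Path} {p : Λ.Path × Λ.Path} (hp : p ∈ Λ.minExt μ ν) :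
    Λ.deg p.1 + Λ.deg μ = Λ.deg μ ⊔ Λ.deg ν ∧ Λ.deg p.2 + Λ.deg ν = Λ.deg μ ⊔ Λ.deg ν := by
  obtain ⟨w, a, b, c, f, g, α, β, rfl, rfl, rfl, he, hd⟩ := hp
  refine ⟨(Λ.d_comp α f).symm.trans hd, (Λ.d_comp β g).symm.trans ?_⟩
  rw [← he]
  exact hd

theorem gradedSubspace_induction {i : Fin (k + 1)} {n m : ℕ} {f : TCK Λ →ₗ[ℂ] TCK Λ}
    (hf : Continuous f) (h : ∀ μ ν : Λ.Path, Λ.deg μ i = n → Λ.deg ν i = 0 →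
      f (tck Λ μ * star (tck Λ ν)) ∈ gradedSubspace Λ i m)
    {x : TCK Λ} (hx : x ∈ gradedSubspace Λ i n) : f x ∈ gradedSubspace Λ i m := by
  have hcl : IsClosed ((gradedSubspace Λ i m).comap f : Set (TCK Λ)) :=
    (Submodule.isClosed_topologicalClosure _).preimage hf
  have hle : Submodule.span ℂ {x | ∃ μ ν : Λ.Path, Λ.deg μ i = n ∧ Λ.deg ν i = 0 ∧
      x = tck Λ μ * star (tck Λ ν)} ≤ (gradedSubspace Λ i m).comap f := by
    rw [Submodule.span_le]
    rintro _ ⟨μ, ν, hμ, hν, rfl⟩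
    exact h μ ν hμ hν
  exact Submodule.topologicalClosure_minimal _ hle hcl hx

theorem mul_tck_mem (hΛ : Λ.FinitelyAligned) {i : Fin (k + 1)} {n : ℕ} {ξ : Λ.Path}
    (hξ : Λ.deg ξ i = 0) {x : TCK Λ} (hx : x ∈ gradedSubspace Λ i n) :
    x * tck Λ ξ ∈ gradedSubspace Λ i n := by
  refine gradedSubspace_induction (f := LinearMap.mulRight ℂ (tck Λ ξ))
    (continuous_mul_const _) (fun μ ν hμ hν => ?_) hx
  rw [LinearMap.mulRight_apply, mul_assoc, (isTCKFamily_tck hΛ).star_mul,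
    finsum_mem_eq_finite_toFinset_sum _ (hΛ ν ξ), Finset.mul_sum]
  refine Submodule.sum_mem _ fun p hp => ?_
  obtain ⟨h1, h2⟩ := deg_of_mem_minExt ((Set.Finite.mem_toFinset _).1 hp)
  have h1 := congrFun h1 i
  have h2 := congrFun h2 i
  simp only [Pi.add_apply, Pi.sup_apply, hν, hξ, sup_idem, add_zero] at h1 h2
  rw [← mul_assoc]
  obtain h | ⟨η, h, hd⟩ := tck_mul_tck hΛ μ p.1
  · rw [h, zero_mul]
    exact zero_mem _
  · rw [h]
    exact mul_star_mem i (by rw [hd, Pi.add_apply, hμ, h1, add_zero]) h2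

theorem mul_star_tck_mem (hΛ : Λ.FinitelyAligned) {i : Fin (k + 1)} {n : ℕ} {ξ : Λ.Path}
    (hξ : Λ.deg ξ i = 0) {x : TCK Λ} (hx : x ∈ gradedSubspace Λ i n) :
    x * star (tck Λ ξ) ∈ gradedSubspace Λ i n := by
  refine gradedSubspace_induction (f := LinearMap.mulRight ℂ (star (tck Λ ξ)))
    (continuous_mul_const _) (fun μ ν hμ hν => ?_) hx
  rw [LinearMap.mulRight_apply, mul_assoc, ← star_mul]
  obtain h | ⟨η, h, hd⟩ := tck_mul_tck hΛ ξ ν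
  · rw [h, star_zero, mul_zero]
    exact zero_mem _
  · rw [h]
    exact mul_star_mem i hμ (by rw [hd, Pi.add_apply, hξ, hν])

theorem tck_mul_mem (hΛ : Λ.FinitelyAligned) {i : Fin (k + 1)} {n : ℕ} {ξ : Λ.Path}
    (hξ : Λ.deg ξ i = 0) {x : TCK Λ} (hx : x ∈ gradedSubspace Λ i n) :
    tck Λ ξ * x ∈ gradedSubspace Λ i n := by
  refine gradedSubspace_induction (f := LinearMap.mulLeft ℂ (tck Λ ξ))
    (continuous_const_mul _) (fun μ ν hμ hν => ?_) hx
  rw [LinearMap.mulLeft_apply, ← mul_assoc]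
  obtain h | ⟨η, h, hd⟩ := tck_mul_tck hΛ ξ μ
  · rw [h, zero_mul]
    exact zero_mem _
  · rw [h]
    exact mul_star_mem i (by rw [hd, Pi.add_apply, hξ, hμ, zero_add]) hν

theorem star_tck_mul_mem (hΛ : Λ.FinitelyAligned) {i : Fin (k + 1)} {n : ℕ} {ξ : Λ.Path}
    (hξ : Λ.deg ξ i = 0) {x : TCK Λ} (hx : x ∈ gradedSubspace Λ i n) :
    star (tck Λ ξ) * x ∈ gradedSubspace Λ i n := by
  refine gradedSubspace_induction (f := LinearMap.mulLeft ℂ (star (tck Λ ξ)))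
    (continuous_const_mul _) (fun μ ν hμ hν => ?_) hx
  rw [LinearMap.mulLeft_apply, ← mul_assoc, (isTCKFamily_tck hΛ).star_mul,
    finsum_mem_eq_finite_toFinset_sum _ (hΛ ξ μ), Finset.sum_mul]
  refine Submodule.sum_mem _ fun p hp => ?_
  obtain ⟨h1, h2⟩ := deg_of_mem_minExt ((Set.Finite.mem_toFinset _).1 hp)
  have h1 := congrFun h1 i
  have h2 := congrFun h2 i
  simp only [Pi.add_apply, Pi.sup_apply, hμ, hξ, zero_le, sup_of_le_right, add_zero] at h1 h2
  rw [mul_assoc, ← star_mul]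
  obtain h | ⟨η, h, hd⟩ := tck_mul_tck hΛ ν p.2
  · rw [h, star_zero, mul_zero]
    exact zero_mem _
  · rw [h]
    exact mul_star_mem i h1 (by rw [hd, Pi.add_apply, hν]; omega)

theorem deg_incl (i : Fin (k + 1)) (μ : (Λ.remove i).Path) : Λ.deg (Λ.incl i μ) i = 0 := μ.2.2.2

/-- `X_n` is stable under multiplication by `φ(TC*(Λ^i))` from both sides. -/
theorem mul_inclHom_mem (hΛ : Λ.FinitelyAligned) (i : Fin (k + 1)) (n : ℕ)
    (a : TCK (Λ.remove i)) : ∀ x ∈ gradedSubspace Λ i n,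
      x * inclHom hΛ i a ∈ gradedSubspace Λ i n ∧ x * star (inclHom hΛ i a) ∈ gradedSubspace Λ i n ∧
      inclHom hΛ i a * x ∈ gradedSubspace Λ i n ∧
      star (inclHom hΛ i a) * x ∈ gradedSubspace Λ i n := by
  have hc : Continuous (inclHom hΛ i) := continuous_starHom _
  have hcl : IsClosed (gradedSubspace Λ i n : Set (TCK Λ)) :=
    Submodule.isClosed_topologicalClosure _
  refine tck_induction (P := fun a => ∀ x ∈ gradedSubspace Λ i n,
      x * inclHom hΛ i a ∈ gradedSubspace Λ i n ∧ x * star (inclHom hΛ i a) ∈ gradedSubspace Λ i n ∧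
      inclHom hΛ i a * x ∈ gradedSubspace Λ i n ∧
      star (inclHom hΛ i a) * x ∈ gradedSubspace Λ i n) ?_ ?_ ?_ ?_ ?_ ?_ ?_ a
  · simp only [Set.ofPred_forall]
    refine isClosed_iInter fun x => isClosed_iInter fun _ => ?_
    exact (hcl.preimage (hc.const_mul x)).inter ((hcl.preimage (hc.star.const_mul x)).inter
      ((hcl.preimage (hc.mul_const x)).inter (hcl.preimage (hc.star.mul_const x))))
  · intro μ x hx
    rw [inclHom_tck]
    exact ⟨mul_tck_mem hΛ (deg_incl i μ) hx, mul_star_tck_mem hΛ (deg_incl i μ) hx,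
      tck_mul_mem hΛ (deg_incl i μ) hx, star_tck_mul_mem hΛ (deg_incl i μ) hx⟩
  · intro x _
    simp
  · intro a b ha hb x hx
    obtain ⟨a1, a2, a3, a4⟩ := ha x hx
    obtain ⟨b1, b2, b3, b4⟩ := hb x hx
    simp only [map_add, star_add, mul_add, add_mul]
    exact ⟨add_mem a1 b1, add_mem a2 b2, add_mem a3 b3, add_mem a4 b4⟩
  · intro a b ha hb x hx
    simp only [map_mul, star_mul, ← mul_assoc x]
    simp only [mul_assoc _ _ x]
    exact ⟨(hb _ (ha x hx).1).1, (ha _ (hb x hx).2.1).2.1, (ha _ (hb x hx).2.2.1).2.2.1,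
      (hb _ (ha x hx).2.2.2).2.2.2⟩
  · intro c a ha x hx
    obtain ⟨a1, a2, a3, a4⟩ := ha x hx
    simp only [map_smul, star_smul, mul_smul_comm, smul_mul_assoc]
    exact ⟨Submodule.smul_mem _ _ a1, Submodule.smul_mem _ _ a2, Submodule.smul_mem _ _ a3,
      Submodule.smul_mem _ _ a4⟩
  · intro a ha x hx
    obtain ⟨a1, a2, a3, a4⟩ := ha x hx
    simp only [map_star, star_star]
    exact ⟨a2, a1, a4, a3⟩

/-- The Hilbert `TC*(Λ^i)`-bimodule `X_n`: `⟨x, y⟩ = φ⁻¹(x^* y)`, `x · a = x φ(a)` and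
`a · x = φ(a) x`. -/
def gradedBimodule (hΛ : Λ.FinitelyAligned) (i : Fin (k + 1)) (n : ℕ) :
    BimoduleData (TCK (Λ.remove i)) where
  carrier := gradedSubspace Λ i n
  inner x y := Function.invFun (inclHom hΛ i) (star (x : TCK Λ) * y)
  rsmul x a := ⟨x * inclHom hΛ i a, (mul_inclHom_mem hΛ i n a x x.2).1⟩
  lsmul a x := ⟨inclHom hΛ i a * x, (mul_inclHom_mem hΛ i n a x x.2).2.2.1⟩

/-- The inclusion of `X_n` into `TC*(Λ)`. -/
def gradedIncl (hΛ : Λ.FinitelyAligned) (i : Fin (k + 1)) (n : ℕ) :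
    (gradedBimodule hΛ i n).carrier →ₗ[ℂ] TCK Λ := (gradedSubspace Λ i n).subtype

/-- The element `t_μ t_ν^*` of `X_n`, where `d(μ)_i = n` and `d(ν)_i = 0`. -/
def gradedElt (hΛ : Λ.FinitelyAligned) (i : Fin (k + 1)) (n : ℕ) (μ ν : Λ.Path)
    (hμ : Λ.deg μ i = n) (hν : Λ.deg ν i = 0) : (gradedBimodule hΛ i n).carrier :=
  ⟨tck Λ μ * star (tck Λ ν), mul_star_mem i hμ hν⟩

/-- The element `t_μ` of `X_n`, where `d(μ)_i = n`. -/
def gradedGen (hΛ : Λ.FinitelyAligned) (i : Fin (k + 1)) (n : ℕ) (μ : Λ.Path)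
    (hμ : Λ.deg μ i = n) : (gradedBimodule hΛ i n).carrier :=
  ⟨tck Λ μ, hμ ▸ tck_mem hΛ i μ⟩

end Graded

end

/-!
The proof compares two kinds of representations of the bimodules `X_n`: their inclusions in `TC*(Λ)`
and the representations that a Toeplitz representation of `X_1` induces on its tensor powers.

*Injectivity of `φ`* (`inclHom_injective`). Everything below needs `φ : TC*(Λ^i) → TC*(Λ)` to be
injective, already to make sense of `φ⁻¹(x^* y)`. A positive functional `f` of `A = TC*(Λ^i)`
induces a Fock representation of `TC*(Λ)` (`exists_fock_rep`). It acts on a completion of the formal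
sums of symbols `ξ ⊗ a`, with `ξ` a path of `Λ` and `a ∈ A`, by `t_μ (ξ ⊗ a) = μξ ⊗ a`, for the
inner product `⟨ξ ⊗ a, ζ ⊗ b⟩ = f(a^* K(ξ, ζ) b)`. Here `K(ξ, ζ)` is `fockKernel`, the sum of the
`t_α t_β^*` over the minimal common extensions `(α, β)` of `ξ` and `ζ` for which `α` and `β` have
degree zero in direction `i`. The kernel is positive: if `ξ = ητ` and `ζ = η'τ'` with
`d(η), d(η') ∈ ℕ e_i` and `d(τ)_i = d(τ')_i = 0`, then `K(ξ, ζ)` is `t_τ^* t_τ'` for `η = η'` and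
vanishes otherwise (`fockKernel_eq`). The Toeplitz--Cuntz--Krieger relations reduce to the fact that
minimal common extensions of `μ` and `νξ` may be formed in two steps (`KGraph.mem_minExt_comp`). The
vector functionals at the vertices recover `f` on `φ(A)`, and positive functionals separate the
points of `A`.

*The bimodules.* Since `X_m^* X_{m + n} ⊆ X_n`, `X_m X_n ⊆ X_{m + n}` and `X_0 = φ(A)`, each `X_n`
is a Hilbert bimodule; its norm is the norm of `TC*(Λ)`. Factoring paths shows that multiplication
makes `X_{n + 1}` the balanced tensor product of `X_1` and `X_n` (`isBalancedTensor_graded`), which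
also provides a realisation of the tensor powers of `X_1`.

*Representations of tensor powers.* Toeplitz representations of `X` and `Y` with the same
coefficient map induce one of `X ⊗_A Y` (`IsBalancedTensor.exists_toeplitzRep`), hence of all tensor
powers. For the universal representation of `X_1` these are the maps `i_X^{⊗ n}`. For the inclusion
of `X_1` in `TC*(Λ)` they are isometric with range `X_n`, and their inverses are the maps `Ω_n`
(`TensorPowers.exists_iso`).

*The isomorphism.* The maps `Ψ_n = i_X^{⊗ n} ∘ Ω_n` represent the `X_n` multiplicatively
(`IsGradedRep`). If `d(μ)_i = m ≤ d(ν)_i` and `ν = ν'ν''` with `d(ν')_i = m`, then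
`Ψ(t_μ)^* Ψ(t_ν) = i_A(⟨t_μ, t_ν'⟩) Ψ(t_ν'') = Ψ(t_μ^* t_ν)`, so the elements `Ψ(t_μ)` form a
Toeplitz--Cuntz--Krieger family (`IsGradedRep.isTCKFamily`). The resulting homomorphism is inverse
to `ι × φ`, as one sees on the generators of both algebras.
-/

noncomputable section

/-! ### Composition and common extensions of paths -/

namespace KGraph

section Paths

variable {k : ℕ} {Λ : KGraph.{u} k}

/-- The uniqueness of factorisations. -/
theorem path_eq_of_comp_eq {a b c c' : Λ.Obj} {g : a ⟶ c} {f : c ⟶ b} {g' : a ⟶ c'} {f' : c' ⟶ b}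
    (h : g ≫ f = g' ≫ f') (hd : Λ.d f = Λ.d f') : Λ.path f = Λ.path f' ∧ Λ.path g = Λ.path g' := by
  have hg : Λ.d g = Λ.d g' := by
    have h1 := Λ.d_comp g f
    rw [h, Λ.d_comp, hd] at h1
    exact (add_right_cancel h1).symm
  have h3 := (Λ.factor (g ≫ f) (Λ.d f) (Λ.d g) ((Λ.d_comp g f).trans (add_comm _ _))).unique
    (y₁ := ⟨c, f, g⟩) (y₂ := ⟨c', f', g'⟩) ⟨rfl, rfl, rfl⟩ ⟨hd.symm, hg.symm, h.symm⟩
  obtain ⟨rfl, h4⟩ := Sigma.mk.inj h3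
  obtain ⟨rfl, rfl⟩ := Prod.mk.inj (eq_of_heq h4)
  exact ⟨rfl, rfl⟩

theorem path_inj {a b : Λ.Obj} {f g : a ⟶ b} (h : Λ.path f = Λ.path g) : f = g :=
  eq_of_heq (Sigma.mk.inj (eq_of_heq (Sigma.mk.inj h).2)).2

instance {b c : Λ.Obj} (f : b ⟶ c) : Mono f :=
  ⟨fun _ _ h => path_inj (path_eq_of_comp_eq h rfl).2⟩

theorem exists_factor {a b : Λ.Obj} (f : a ⟶ b) {m : Fin k → ℕ} (h : m ≤ Λ.d f) :
    ∃ (c : Λ.Obj) (g : c ⟶ b) (r : a ⟶ c), Λ.d g = m ∧ r ≫ g = f := by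
  obtain ⟨⟨c, g, r⟩, ⟨h1, -, h3⟩, -⟩ := Λ.factor f m (Λ.d f - m) (add_tsub_cancel_of_le h).symm
  exact ⟨c, g, r, h1, h3⟩

variable (Λ) in
/-- The composite path `μν`, with the junk value `μ` if `s(μ) ≠ r(ν)`. -/
def comp (μ ν : Λ.Path) : Λ.Path :=
  open scoped Classical in
  if h : ν.2.1 = μ.1 then Λ.path (ν.2.2 ≫ eqToHom h ≫ μ.2.2) else μ

theorem comp_path {a b c : Λ.Obj} (f : b ⟶ c) (g : a ⟶ b) :
    Λ.comp (Λ.path f) (Λ.path g) = Λ.path (g ≫ f) := by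
  refine (dif_pos rfl).trans ?_
  change Λ.path (g ≫ 𝟙 b ≫ f) = _
  rw [Category.id_comp]

theorem mem_minExt {a b c : Λ.Obj} {f : a ⟶ c} {g : b ⟶ c} {p : Λ.Path × Λ.Path} :
    p ∈ Λ.minExt (Λ.path f) (Λ.path g) ↔ ∃ (w : Λ.Obj) (α : w ⟶ a) (β : w ⟶ b),
      p = (Λ.path α, Λ.path β) ∧ α ≫ f = β ≫ g ∧ Λ.d (α ≫ f) = Λ.d f ⊔ Λ.d g := by
  constructor
  · rintro ⟨w, a', b', c', f', g', α, β, h1, h2, rfl, he, hd⟩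
    obtain ⟨rfl, h1⟩ := Sigma.mk.inj h1
    obtain ⟨rfl, h1⟩ := Sigma.mk.inj (eq_of_heq h1)
    obtain ⟨rfl, h2⟩ := Sigma.mk.inj h2
    obtain ⟨-, h2⟩ := Sigma.mk.inj (eq_of_heq h2)
    obtain rfl := eq_of_heq h1
    obtain rfl := eq_of_heq h2
    exact ⟨w, α, β, rfl, he, hd⟩
  · rintro ⟨w, α, β, rfl, he, hd⟩
    exact ⟨w, a, b, c, f, g, α, β, rfl, rfl, rfl, he, hd⟩

theorem range_eq_of_mem_minExt {μ ν : Λ.Path} {p : Λ.Path × Λ.Path} (hp : p ∈ Λ.minExt μ ν) :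
    μ.2.1 = ν.2.1 := by
  obtain ⟨w, a, b, c, f, g, α, β, rfl, rfl, rfl, he, hd⟩ := hp
  rfl

theorem composable_of_mem_minExt {μ ν : Λ.Path} {p : Λ.Path × Λ.Path} (hp : p ∈ Λ.minExt μ ν) :
    p.1.2.1 = μ.1 ∧ p.2.2.1 = ν.1 := by
  obtain ⟨w, a, b, c, f, g, α, β, rfl, rfl, rfl, he, hd⟩ := hp
  exact ⟨rfl, rfl⟩

theorem source_eq_of_mem_minExt {μ ν : Λ.Path} {p : Λ.Path × Λ.Path} (hp : p ∈ Λ.minExt μ ν) :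
    p.1.1 = p.2.1 := by
  obtain ⟨w, a, b, c, f, g, α, β, rfl, rfl, rfl, he, hd⟩ := hp
  rfl

theorem swap_mem_minExt {μ ν : Λ.Path} {p : Λ.Path × Λ.Path} :
    p.swap ∈ Λ.minExt ν μ ↔ p ∈ Λ.minExt μ ν := by
  have key : ∀ {μ ν : Λ.Path} {p : Λ.Path × Λ.Path}, p ∈ Λ.minExt μ ν → p.swap ∈ Λ.minExt ν μ := by
    rintro _ _ _ ⟨w, a, b, c, f, g, α, β, rfl, rfl, rfl, he, hd⟩
    exact ⟨w, b, a, c, g, f, β, α, rfl, rfl, rfl, he.symm, by rw [← he, hd, sup_comm]⟩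
  exact ⟨fun h => by simpa using key h, key⟩

theorem minExt_vertex {a b : Λ.Obj} (f : a ⟶ b) :
    Λ.minExt (Λ.vertex b) (Λ.path f) = {(Λ.path f, Λ.vertex a)} := by
  ext p
  rw [vertex, mem_minExt, Set.mem_singleton_iff]
  constructor
  · rintro ⟨w, α, β, rfl, he, hd⟩
    rw [Category.comp_id] at he hd
    have hβ : Λ.d β = 0 := by
      have h := Λ.d_comp β f
      rw [← he, hd, Λ.d_id, sup_eq_right.2 (fun _ => Nat.zero_le _)] at h
      exact left_eq_add.1 (h.trans (add_comm _ _))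
    have h1 := eq_id_of_d_eq_zero β hβ
    obtain ⟨rfl, -⟩ := Sigma.mk.inj h1
    obtain rfl := path_inj h1
    rw [he, Category.id_comp]
    rfl
  · rintro rfl
    exact ⟨a, f, 𝟙 a, rfl, by simp, by simp [Λ.d_id]⟩

theorem minExt_comp_comp {a b c e : Λ.Obj} (f : c ⟶ e) (g : a ⟶ c) (h : b ⟶ c) :
    Λ.minExt (Λ.path (g ≫ f)) (Λ.path (h ≫ f)) = Λ.minExt (Λ.path g) (Λ.path h) := by
  ext p
  rw [mem_minExt, mem_minExt]
  refine exists_congr fun w => exists_congr fun α => exists_congr fun β =>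
    and_congr_right fun _ => ?_
  rw [← Category.assoc, ← Category.assoc, cancel_mono, Λ.d_comp _ f, Λ.d_comp g, Λ.d_comp h]
  refine and_congr_right fun _ => ?_
  simp only [funext_iff, Pi.add_apply, Pi.sup_apply]
  refine forall_congr' fun j => ?_
  omega

/-- Minimal common extensions of `μ` and `νξ` are obtained in two steps, by extending `μ` and `ν`
first. -/
theorem mem_minExt_comp {a b c e : Λ.Obj} {f : a ⟶ c} {g : b ⟶ c} {h : e ⟶ b}
    {r : Λ.Path × Λ.Path} : r ∈ Λ.minExt (Λ.path f) (Λ.path (h ≫ g)) ↔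
      ∃ p ∈ Λ.minExt (Λ.path f) (Λ.path g), ∃ q ∈ Λ.minExt p.2 (Λ.path h),
        r = (Λ.comp p.1 q.1, q.2) := by
  constructor
  · intro hr
    obtain ⟨w, σ, δ, rfl, he, hd⟩ := mem_minExt.1 hr
    obtain ⟨x, ρ, γ, hρ, hγ⟩ := exists_factor (σ ≫ f) (m := Λ.d f ⊔ Λ.d g) (by
      rw [hd]
      refine sup_le_sup_left ?_ _
      rw [Λ.d_comp]
      exact le_add_self)
    obtain ⟨y, f', α, hf', hα⟩ := exists_factor ρ (m := Λ.d f) (hρ ▸ le_sup_left)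
    obtain ⟨z, g', β, hg', hβ⟩ := exists_factor ρ (m := Λ.d g) (hρ ▸ le_sup_right)
    obtain ⟨h1, h2⟩ := path_eq_of_comp_eq (g := γ ≫ α) (g' := σ) (f := f') (f' := f)
      (by rw [Category.assoc, hα, hγ]) hf'
    obtain ⟨h3, h4⟩ := path_eq_of_comp_eq (g := γ ≫ β) (g' := δ ≫ h) (f := g') (f' := g)
      (by rw [Category.assoc, hβ, hγ, Category.assoc, he]) hg'
    obtain ⟨rfl, -⟩ := Sigma.mk.inj h1
    obtain rfl := path_inj h1
    obtain ⟨rfl, -⟩ := Sigma.mk.inj h3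
    obtain rfl := path_inj h3
    obtain rfl := path_inj h2
    have h4 := path_inj h4
    refine ⟨(Λ.path α, Λ.path β), mem_minExt.2 ⟨x, α, β, rfl, hα.trans hβ.symm, hα ▸ hρ⟩,
      (Λ.path γ, Λ.path δ), mem_minExt.2 ⟨w, γ, δ, rfl, h4, ?_⟩, by rw [comp_path]⟩
    have e1 := Λ.d_comp (γ ≫ β) g'
    rw [Category.assoc, hβ, hγ, hd, Λ.d_comp h g'] at e1
    have e2 := Λ.d_comp β g'
    rw [hβ, hρ] at e2
    simp only [funext_iff, Pi.add_apply, Pi.sup_apply] at e1 e2 ⊢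
    intro j
    have := e1 j
    have := e2 j
    omega
  · rintro ⟨p, hp, q, hq, rfl⟩
    obtain ⟨x, α, β, rfl, he, hd⟩ := mem_minExt.1 hp
    obtain ⟨w, γ, δ, rfl, he', hd'⟩ := mem_minExt.1 hq
    refine mem_minExt.2 ⟨w, γ ≫ α, δ, by rw [comp_path], ?_, ?_⟩
    · rw [Category.assoc, he, ← Category.assoc, he', Category.assoc]
    · have e1 := Λ.d_comp β g
      rw [← he, hd] at e1
      rw [Category.assoc, he, ← Category.assoc, Λ.d_comp _ g, hd', Λ.d_comp h g]
      simp only [funext_iff, Pi.add_apply, Pi.sup_apply] at e1 ⊢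
      intro j
      have := e1 j
      omega

/-- The two steps in `mem_minExt_comp` are determined by their result. -/
theorem minExt_comp_injOn {a b c e : Λ.Obj} {f : a ⟶ c} {g : b ⟶ c} {h : e ⟶ b}
    {p q p' q' : Λ.Path × Λ.Path} (hp : p ∈ Λ.minExt (Λ.path f) (Λ.path g))
    (hq : q ∈ Λ.minExt p.2 (Λ.path h)) (hp' : p' ∈ Λ.minExt (Λ.path f) (Λ.path g))
    (hq' : q' ∈ Λ.minExt p'.2 (Λ.path h)) (h1 : Λ.comp p.1 q.1 = Λ.comp p'.1 q'.1)
    (h2 : q.2 = q'.2) : p = p' ∧ q = q' := by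
  obtain ⟨x, α, β, rfl, he, hd⟩ := mem_minExt.1 hp
  obtain ⟨w, γ, δ, rfl, -, -⟩ := mem_minExt.1 hq
  obtain ⟨x', α', β', rfl, he', hd'⟩ := mem_minExt.1 hp'
  obtain ⟨w', γ', δ', rfl, -, -⟩ := mem_minExt.1 hq'
  rw [comp_path, comp_path] at h1
  obtain ⟨rfl, -⟩ := Sigma.mk.inj h1
  have h1 := path_inj h1
  obtain ⟨h3, h4⟩ := path_eq_of_comp_eq (g := γ) (g' := γ') (f := α ≫ f) (f' := α' ≫ f)
    (by rw [← Category.assoc, h1, Category.assoc]) (hd.trans hd'.symm)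
  obtain ⟨rfl, -⟩ := Sigma.mk.inj h3
  have h5 := path_inj h3
  obtain rfl := (cancel_mono f).1 h5
  rw [he] at he'
  obtain rfl := (cancel_mono g).1 he'
  exact ⟨rfl, Prod.ext h4 h2⟩

/-- The finite set of minimal common extensions in a finitely aligned graph. -/
def minFin (hΛ : Λ.FinitelyAligned) (μ ν : Λ.Path) : Finset (Λ.Path × Λ.Path) := (hΛ μ ν).toFinset

theorem mem_minFin {hΛ : Λ.FinitelyAligned} {μ ν : Λ.Path} {p : Λ.Path × Λ.Path} :
    p ∈ minFin hΛ μ ν ↔ p ∈ Λ.minExt μ ν := Set.Finite.mem_toFinset _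

theorem finsum_minExt (hΛ : Λ.FinitelyAligned) {M : Type*} [AddCommMonoid M] (μ ν : Λ.Path)
    (F : Λ.Path × Λ.Path → M) : ∑ᶠ p ∈ Λ.minExt μ ν, F p = ∑ p ∈ minFin hΛ μ ν, F p :=
  finsum_mem_eq_finite_toFinset_sum _ (hΛ μ ν)

theorem minFin_eq_empty {hΛ : Λ.FinitelyAligned} {μ ν : Λ.Path} (h : μ.2.1 ≠ ν.2.1) :
    minFin hΛ μ ν = ∅ :=
  Finset.eq_empty_of_forall_notMem fun _ hp => h (range_eq_of_mem_minExt (mem_minFin.1 hp))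

theorem minFin_vertex {hΛ : Λ.FinitelyAligned} {v : Λ.Obj} {μ : Λ.Path} (h : μ.2.1 = v) :
    minFin hΛ (Λ.vertex v) μ = {(μ, Λ.vertex μ.1)} := by
  obtain ⟨a, b, f⟩ := μ
  obtain rfl : b = v := h
  ext p
  exact mem_minFin.trans ((Set.ext_iff.1 (minExt_vertex f) p).trans Finset.mem_singleton.symm)

theorem sum_minFin_swap (hΛ : Λ.FinitelyAligned) {M : Type*} [AddCommMonoid M] (μ ν : Λ.Path)
    (F : Λ.Path × Λ.Path → M) : ∑ p ∈ minFin hΛ μ ν, F p.swap = ∑ p ∈ minFin hΛ ν μ, F p :=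
  Finset.sum_nbij' Prod.swap Prod.swap
    (fun _ h => mem_minFin.2 (swap_mem_minExt.2 (mem_minFin.1 h)))
    (fun _ h => mem_minFin.2 (swap_mem_minExt.2 (mem_minFin.1 h))) (fun _ _ => rfl)
    (fun _ _ => rfl) (fun _ _ => rfl)

/-- Summation over the minimal common extensions of `μ` and `νξ` in two steps. -/
theorem sum_minFin_comp_right (hΛ : Λ.FinitelyAligned) {M : Type*} [AddCommMonoid M]
    (μ : Λ.Path) {ν ξ : Λ.Path} (hc : ξ.2.1 = ν.1) (F : Λ.Path → Λ.Path → M) :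
    ∑ r ∈ minFin hΛ μ (Λ.comp ν ξ), F r.1 r.2 =
      ∑ p ∈ minFin hΛ μ ν, ∑ q ∈ minFin hΛ p.2 ξ, F (Λ.comp p.1 q.1) q.2 := by
  obtain ⟨b, c, g⟩ := ν
  obtain ⟨e, b', h⟩ := ξ
  obtain rfl : b' = b := hc
  obtain ⟨a, c', f⟩ := μ
  change ∑ r ∈ minFin hΛ (Λ.path f) (Λ.comp (Λ.path g) (Λ.path h)), _ =
    ∑ p ∈ minFin hΛ (Λ.path f) (Λ.path g), ∑ q ∈ minFin hΛ p.2 (Λ.path h), _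
  rw [comp_path]
  by_cases hcc : c' = c
  swap
  · rw [minFin_eq_empty hcc, minFin_eq_empty hcc, Finset.sum_empty, Finset.sum_empty]
  subst hcc
  rw [Finset.sum_sigma']
  symm
  refine Finset.sum_nbij (fun x => (Λ.comp x.1.1 x.2.1, x.2.2)) ?_ ?_ ?_ (fun _ _ => rfl)
  · rintro ⟨p, q⟩ hpq
    rw [Finset.mem_sigma, mem_minFin, mem_minFin] at hpq
    exact mem_minFin.2 (mem_minExt_comp.2 ⟨p, hpq.1, q, hpq.2, rfl⟩)
  · rintro ⟨p, q⟩ hpq ⟨p', q'⟩ hpq' heq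
    rw [Finset.mem_coe, Finset.mem_sigma, mem_minFin, mem_minFin] at hpq hpq'
    obtain ⟨h1, h2⟩ := Prod.mk.inj heq
    obtain ⟨rfl, rfl⟩ := minExt_comp_injOn hpq.1 hpq.2 hpq'.1 hpq'.2 h1 h2
    rfl
  · intro r hr
    obtain ⟨p, hp, q, hq, rfl⟩ := mem_minExt_comp.1 (mem_minFin.1 hr)
    exact ⟨⟨p, q⟩, by
      rw [Finset.mem_coe, Finset.mem_sigma, mem_minFin, mem_minFin]
      exact ⟨hp, hq⟩, rfl⟩

/-- Summation over the minimal common extensions of `μξ` and `ν` in two steps. -/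
theorem sum_minFin_comp_left (hΛ : Λ.FinitelyAligned) {M : Type*} [AddCommMonoid M]
    {μ ξ : Λ.Path} (ν : Λ.Path) (hc : ξ.2.1 = μ.1) (F : Λ.Path → Λ.Path → M) :
    ∑ r ∈ minFin hΛ (Λ.comp μ ξ) ν, F r.1 r.2 =
      ∑ p ∈ minFin hΛ μ ν, ∑ q ∈ minFin hΛ ξ p.1, F q.1 (Λ.comp p.2 q.2) := by
  rw [← sum_minFin_swap hΛ ν (Λ.comp μ ξ) fun r => F r.1 r.2]
  refine (sum_minFin_comp_right hΛ ν hc fun r s => F s r).trans ?_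
  rw [← sum_minFin_swap hΛ ν μ]
  refine Finset.sum_congr rfl fun p _ => ?_
  exact (sum_minFin_swap hΛ p.2 ξ fun q => F q.1 (Λ.comp p.1 q.2))

end Paths

end KGraph

/-! ### The norm of a Hilbert bimodule -/

namespace IsHilbertBimodule

section Norm

variable {A : Type u} [NonUnitalCStarAlgebra A] {X : BimoduleData A} (h : IsHilbertBimodule X)
include h

theorem inner_add_left (x y z : X.carrier) : X.inner (x + y) z = X.inner x z + X.inner y z := by
  rw [← h.star_inner, h.inner_add_right, star_add, h.star_inner, h.star_inner]

theorem inner_smul_left (c : ℂ) (x y : X.carrier) : X.inner (c • x) y = star c • X.inner x y := by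
  rw [← h.star_inner, h.inner_smul_right, star_smul, h.star_inner]

theorem inner_rsmul_left (x : X.carrier) (a : A) (y : X.carrier) :
    X.inner (X.rsmul x a) y = star a * X.inner x y := by
  rw [← h.star_inner, h.inner_rsmul, star_mul, h.star_inner]

theorem inner_zero_right (x : X.carrier) : X.inner x 0 = 0 := by
  simpa using h.inner_smul_right 0 x 0

theorem inner_neg_right (x y : X.carrier) : X.inner x (-y) = -X.inner x y := by
  simpa using h.inner_smul_right (-1) x y

theorem inner_neg_left (x y : X.carrier) : X.inner (-x) y = -X.inner x y := by
  simpa using h.inner_smul_left (-1) x y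

theorem inner_sub_right (x y z : X.carrier) : X.inner x (y - z) = X.inner x y - X.inner x z := by
  rw [sub_eq_add_neg, h.inner_add_right, h.inner_neg_right, sub_eq_add_neg]

theorem inner_sub_left (x y z : X.carrier) : X.inner (x - y) z = X.inner x z - X.inner y z := by
  rw [sub_eq_add_neg, h.inner_add_left, h.inner_neg_left, sub_eq_add_neg]

/-- The Cauchy--Schwarz inequality. -/
theorem norm_inner_le (x y : X.carrier) :
    ‖X.inner x y‖ ≤ √‖X.inner x x‖ * √‖X.inner y y‖ := by
  let _ := CStarAlgebra.spectralOrder A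
  have _ := CStarAlgebra.spectralOrderedRing A
  rw [← Real.sqrt_mul (norm_nonneg _)]
  refine Real.le_sqrt_of_sq_le ?_
  set c := X.inner x y with hc
  set p := X.inner x x with hp
  set q := X.inner y y with hq
  have hcs : X.inner y x = star c := (h.star_inner y x).symm
  have hpp : 0 ≤ p := by
    obtain ⟨b, hb⟩ := h.inner_self_nonneg x
    rw [hp, hb]
    exact star_mul_self_nonneg b
  rcases eq_or_ne p 0 with hp0 | hp0
  · rw [(h.inner_self_eq_zero x).1 hp0] at hc
    have h0 : c = 0 := by
      rw [hc, ← h.star_inner, h.inner_zero_right, star_zero]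
    rw [h0, norm_zero, zero_pow two_ne_zero]
    exact mul_nonneg (norm_nonneg _) (norm_nonneg _)
  have hn : 0 < ‖p‖ := norm_pos_iff.2 hp0
  -- positivity of `⟨z, z⟩` for the vector `z = ‖p‖ y - x c`
  have hz : 0 ≤ (‖p‖ * ‖p‖) • q - ‖p‖ • (star c * c) - ‖p‖ • (star c * c) + star c * p * c := by
    obtain ⟨b, hb⟩ := h.inner_self_nonneg ((‖p‖ : ℂ) • y - X.rsmul x c)
    have e : X.inner ((‖p‖ : ℂ) • y - X.rsmul x c) ((‖p‖ : ℂ) • y - X.rsmul x c) =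
        (‖p‖ * ‖p‖) • q - ‖p‖ • (star c * c) - ‖p‖ • (star c * c) + star c * p * c := by
      simp only [h.inner_sub_left, h.inner_sub_right, h.inner_smul_left, h.inner_smul_right,
        h.inner_rsmul, h.inner_rsmul_left, hcs, ← hc, ← hp, ← hq, RCLike.star_def,
        Complex.conj_ofReal]
      simp only [Complex.coe_smul, mul_smul]
      abel
    rw [← e, hb]
    exact star_mul_self_nonneg b
  have hle : ‖p‖ • (star c * c) ≤ (‖p‖ * ‖p‖) • q := by
    have h1 : star c * p * c ≤ ‖p‖ • (star c * c) :=
      CStarAlgebra.star_left_conjugate_le_norm_smul hpp.isSelfAdjoint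
    have h2 := add_le_add hz h1
    rw [zero_add] at h2
    have h3 : star c * p * c ≤ star c * p * c + ((‖p‖ * ‖p‖) • q - ‖p‖ • (star c * c)) :=
      h2.trans (le_of_eq (by abel))
    exact sub_nonneg.1 ((le_add_iff_nonneg_right _).1 h3)
  have h4 := CStarAlgebra.norm_le_norm_of_nonneg_of_le
    (smul_nonneg hn.le (star_mul_self_nonneg c)) hle
  rw [norm_smul, norm_smul, CStarRing.norm_star_mul_self, Real.norm_of_nonneg hn.le,
    Real.norm_of_nonneg (mul_nonneg hn.le hn.le), mul_assoc] at h4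
  rw [sq]
  exact le_of_mul_le_mul_left h4 hn

/-- The norm `‖⟨x, x⟩‖^(1/2)` of a Hilbert bimodule, as a seminorm. -/
def innerSeminorm : Seminorm ℂ X.carrier :=
  Seminorm.of (fun x => √‖X.inner x x‖)
    (fun x y => by
      refine Real.sqrt_le_iff.2 ⟨by positivity, ?_⟩
      have h1 := h.norm_inner_le x y
      have h2 := h.norm_inner_le y x
      have hx := Real.sq_sqrt (norm_nonneg (X.inner x x))
      have hy := Real.sq_sqrt (norm_nonneg (X.inner y y))
      have h3 : ‖X.inner (x + y) (x + y)‖ ≤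
          ‖X.inner x x‖ + ‖X.inner x y‖ + (‖X.inner y x‖ + ‖X.inner y y‖) := by
        rw [h.inner_add_left, h.inner_add_right, h.inner_add_right]
        exact (norm_add_le _ _).trans (add_le_add (norm_add_le _ _) (norm_add_le _ _))
      nlinarith)
    (fun c x => by
      rw [h.inner_smul_left, h.inner_smul_right, norm_smul, norm_smul, norm_star, ← mul_assoc,
        Real.sqrt_mul (by positivity), Real.sqrt_mul_self (norm_nonneg c)])

/-- The norm of a Hilbert bimodule. -/
@[reducible] def seminormedAddCommGroup : SeminormedAddCommGroup X.carrier :=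
  h.innerSeminorm.toAddGroupSeminorm.toSeminormedAddCommGroup

/-- The norm of a Hilbert bimodule is a norm of complex vector spaces. -/
@[reducible] def normedSpace :
    letI := h.seminormedAddCommGroup
    NormedSpace ℂ X.carrier :=
  letI := h.seminormedAddCommGroup
  { norm_smul_le := fun c x => le_of_eq (map_smul_eq_mul h.innerSeminorm c x) }

end Norm

end IsHilbertBimodule

/-! ### Toeplitz representations of tensor powers -/

namespace IsToeplitzRep

section

variable {A : Type u} [NonUnitalCStarAlgebra A] {B : Type v} [NonUnitalCStarAlgebra B]
  {X : BimoduleData A} {σ : X.carrier →ₗ[ℂ] B} {π : A →⋆ₙₐ[ℂ] B}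

theorem norm_le (hσ : IsToeplitzRep X σ π) (x : X.carrier) : ‖σ x‖ ≤ √‖X.inner x x‖ := by
  refine Real.le_sqrt_of_sq_le ?_
  rw [sq, ← CStarRing.norm_star_mul_self, hσ.inner]
  exact NonUnitalStarAlgHom.norm_apply_le π _

theorem norm_eq (hσ : IsToeplitzRep X σ π) (hπ : Function.Injective π) (x : X.carrier) :
    ‖σ x‖ = √‖X.inner x x‖ := by
  rw [← NonUnitalStarAlgHom.norm_map π hπ, ← hσ.inner, CStarRing.norm_star_mul_self,
    Real.sqrt_mul_self (norm_nonneg _)]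

theorem injective (hσ : IsToeplitzRep X σ π) (hπ : Function.Injective π)
    (hX : IsHilbertBimodule X) : Function.Injective σ := by
  refine (injective_iff_map_eq_zero σ).2 fun x hx => (hX.inner_self_eq_zero x).1 (hπ ?_)
  rw [← hσ.inner, hx, mul_zero, map_zero]

/-- The range of a Toeplitz representation of a Hilbert bimodule is closed if the coefficient
representation is injective, since the representation is then isometric. -/
theorem isClosed_range (hσ : IsToeplitzRep X σ π) (hπ : Function.Injective π)
    (hX : IsHilbertBimodule X) : IsClosed (Set.range σ) := by
  refine isClosed_of_closure_subset fun b hb => ?_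
  obtain ⟨s, hs, hlim⟩ := mem_closure_iff_seq_limit.1 hb
  choose t ht using hs
  obtain ⟨x, hx⟩ := hX.complete t fun ε hε => by
    obtain ⟨N, hN⟩ := Metric.cauchySeq_iff.1 hlim.cauchySeq ε hε
    refine ⟨N, fun m hm n hn => ?_⟩
    have h1 := hN m hm n hn
    rwa [dist_eq_norm, ← ht, ← ht, ← map_sub, hσ.norm_eq hπ] at h1
  refine ⟨x, tendsto_nhds_unique (Metric.tendsto_atTop.2 fun ε hε => ?_) hlim⟩
  obtain ⟨N, hN⟩ := hx ε hε
  refine ⟨N, fun n hn => ?_⟩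
  rw [dist_eq_norm, ← ht, ← map_sub, hσ.norm_eq hπ]
  exact hN n hn

/-- The Toeplitz representation of `A` over itself given by a `*`-homomorphism. -/
theorem self (π : A →⋆ₙₐ[ℂ] B) : IsToeplitzRep (selfBimodule A) (π : A →ₗ[ℂ] B) π where
  lsmul a (x : A) := map_mul π a x
  rsmul (x : A) a := map_mul π x a
  inner (x : A) (y : A) := by
    change star (π x) * π y = π (star x * y)
    rw [map_mul, map_star]

end

end IsToeplitzRep

section Tensor

variable {A : Type u} [NonUnitalCStarAlgebra A] {B : Type v} [NonUnitalCStarAlgebra B]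

/-- Toeplitz representations `(σ, π)` of `X` and `(σ', π)` of `Y` induce a Toeplitz representation
of the balanced tensor product with `x ⊗ y ↦ σ(x) σ'(y)`. -/
theorem IsBalancedTensor.exists_toeplitzRep {X Y Z : BimoduleData A}
    {τ : X.carrier →ₗ[ℂ] Y.carrier →ₗ[ℂ] Z.carrier} (hτ : IsBalancedTensor X Y Z τ)
    {π : A →⋆ₙₐ[ℂ] B} {σ : X.carrier →ₗ[ℂ] B} {σ' : Y.carrier →ₗ[ℂ] B}
    (hσ : IsToeplitzRep X σ π) (hσ' : IsToeplitzRep Y σ' π) :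
    ∃ ψ : Z.carrier →ₗ[ℂ] B, IsToeplitzRep Z ψ π ∧ ∀ x y, ψ (τ x y) = σ x * σ' y := by
  have hZ := hτ.isHilbertBimodule
  let _ := hZ.seminormedAddCommGroup
  let _ := hZ.normedSpace
  have hnorm : ∀ z : Z.carrier, ‖z‖ = √‖Z.inner z z‖ := fun _ => rfl
  let e : (X.carrier × Y.carrier →₀ ℂ) →ₗ[ℂ] Z.carrier :=
    Finsupp.linearCombination ℂ fun w => τ w.1 w.2
  let f : (X.carrier × Y.carrier →₀ ℂ) →ₗ[ℂ] B :=
    Finsupp.linearCombination ℂ fun w => σ w.1 * σ' w.2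
  have he : ∀ w c, e (Finsupp.single w c) = c • τ w.1 w.2 := fun w c =>
    Finsupp.linearCombination_single ℂ c w
  have hf : ∀ w c, f (Finsupp.single w c) = c • (σ w.1 * σ' w.2) := fun w c =>
    Finsupp.linearCombination_single ℂ c w
  -- `e` and `f` represent formal sums of pairs `(x, y)` in `Z` and in `B`; as `f` preserves inner
  -- products up to `π`, it factors through `e` and extends by continuity
  have hinner : ∀ p q, star (f p) * f q = π (Z.inner (e p) (e q)) := by
    intro p q
    induction p using Finsupp.induction_linear with
    | zero =>
      rw [map_zero, map_zero, star_zero, zero_mul, ← hZ.star_inner, hZ.inner_zero_right, star_zero,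
        map_zero]
    | add p₁ p₂ h₁ h₂ =>
      rw [map_add, map_add, star_add, add_mul, hZ.inner_add_left, map_add, h₁, h₂]
    | single w c =>
      induction q using Finsupp.induction_linear with
      | zero => rw [map_zero, map_zero, mul_zero, hZ.inner_zero_right, map_zero]
      | add q₁ q₂ h₁ h₂ => rw [map_add, map_add, mul_add, hZ.inner_add_right, map_add, h₁, h₂]
      | single w' c' =>
        rw [he, he, hf, hf, hZ.inner_smul_left, hZ.inner_smul_right, map_smul, map_smul, star_smul,
          smul_mul_assoc, mul_smul_comm, hτ.inner_tmul, ← hσ'.inner, hσ'.lsmul, ← hσ.inner,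
          star_mul]
        simp only [mul_assoc]
  have hbound : ∀ p, ‖f p‖ ≤ 1 * ‖e p‖ := by
    intro p
    rw [one_mul, hnorm]
    refine Real.le_sqrt_of_sq_le ?_
    rw [sq, ← CStarRing.norm_star_mul_self, hinner]
    exact NonUnitalStarAlgHom.norm_apply_le π _
  have hdense : DenseRange e := by
    intro z
    refine Metric.mem_closure_iff.2 fun ε hε => ?_
    obtain ⟨w, hw, hlt⟩ := hτ.dense z ε hε
    refine ⟨w, ?_, by rw [dist_eq_norm]; exact hlt⟩
    have hsub : Submodule.span ℂ {w | ∃ x y, w = τ x y} ≤ LinearMap.range e := by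
      rw [Submodule.span_le]
      rintro _ ⟨x, y, rfl⟩
      exact ⟨Finsupp.single (x, y) 1, by rw [he, one_smul]⟩
    exact hsub hw
  let ψ : Z.carrier →L[ℂ] B := f.extendOfNorm e
  have hψ : ∀ p, ψ (e p) = f p := LinearMap.extendOfNorm_eq hdense ⟨1, hbound⟩
  have hψc : Continuous ψ := ψ.continuous
  have hpair : Continuous fun w : Z.carrier × Z.carrier => Z.inner w.1 w.2 := by
    let b : Z.carrier →ₗ⋆[ℂ] Z.carrier →ₗ[ℂ] A := LinearMap.mk₂'ₛₗ (starRingEnd ℂ) (RingHom.id ℂ)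
      Z.inner hZ.inner_add_left hZ.inner_smul_left hZ.inner_add_right hZ.inner_smul_right
    let L := b.mkContinuous₂ 1 fun x y => by
      rw [one_mul]
      exact hZ.norm_inner_le x y
    exact (L.continuous.comp continuous_fst).clm_apply continuous_snd
  have hin : ∀ z w, star (ψ z) * ψ w = π (Z.inner z w) := fun z w => by
    refine hdense.induction_on₂ (isClosed_eq ?_ ((continuous_starHom π).comp hpair))
      (fun p q => ?_) z w
    · exact (hψc.comp continuous_fst).star.mul (hψc.comp continuous_snd)
    · rw [hψ, hψ, hinner]
  have hτψ : ∀ x y, ψ (τ x y) = σ x * σ' y := fun x y => by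
    have h := hψ (Finsupp.single (x, y) 1)
    rwa [he, hf, one_smul, one_smul] at h
  have hleft : ∀ a p, π a * ψ (e p) = ψ (Z.lsmul a (e p)) := fun a p => by
    induction p using Finsupp.induction_linear with
    | zero =>
      have h0 : Z.lsmul a 0 = 0 := by simpa using hZ.lsmul_smul a 0 0
      rw [map_zero, h0, map_zero, mul_zero]
    | add p q hp hq => rw [map_add, hZ.lsmul_add, map_add, map_add, mul_add, hp, hq]
    | single w c =>
      rw [he, hZ.lsmul_smul, map_smul, map_smul, hτ.lsmul_tmul, hτψ, hτψ, hσ.lsmul, mul_smul_comm,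
        mul_assoc]
  -- the defect `d` of either module law is orthogonal to the range of `ψ`, which forces `d^* d = 0`
  refine ⟨ψ, ⟨fun a z => ?_, fun z a => ?_, hin⟩, hτψ⟩
  · set d := ψ (Z.lsmul a z) - π a * ψ z with hd
    have h1 : ∀ w, star (ψ w) * d = 0 := fun w => by
      refine hdense.induction_on w (isClosed_eq (hψc.star.mul continuous_const) continuous_const)
        fun p => ?_
      rw [hd, mul_sub, hin, ← mul_assoc, ← star_star (π a), ← star_mul, ← map_star, hleft, hin,
        hZ.inner_lsmul, star_star, sub_self]
    have h3 : star (π a * ψ z) * d = 0 := by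
      refine hdense.induction_on (p := fun z => star (π a * ψ z) * d = 0) z
        (isClosed_eq ((hψc.const_mul _).star.mul continuous_const) continuous_const) fun p => ?_
      rw [hleft, h1]
    have h4 : star d * d = 0 := by
      conv_lhs => rw [hd, star_sub, sub_mul]
      rw [← hd, h1, h3, sub_zero]
    exact sub_eq_zero.1 ((CStarRing.star_mul_self_eq_zero_iff d).1 h4)
  · set d := ψ (Z.rsmul z a) - ψ z * π a with hd
    have h1 : ∀ w, star (ψ w) * d = 0 := fun w => by
      rw [hd, mul_sub, ← mul_assoc, hin, hin, hZ.inner_rsmul, map_mul, sub_self]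
    have h4 : star d * d = 0 := by
      conv_lhs => rw [hd, star_sub, sub_mul]
      rw [← hd, h1, star_mul, mul_assoc, h1, mul_zero, sub_zero]
    exact sub_eq_zero.1 ((CStarRing.star_mul_self_eq_zero_iff d).1 h4)

theorem isHilbertBimodule_self : IsHilbertBimodule (selfBimodule A) where
  add_rsmul (x : A) (y : A) a := add_mul x y a
  rsmul_add (x : A) a b := mul_add x a b
  rsmul_mul (x : A) a b := (mul_assoc x a b).symm
  smul_rsmul c (x : A) a := smul_mul_assoc c x a
  rsmul_smul c (x : A) a := mul_smul_comm c x a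
  inner_add_right (x : A) (y : A) (z : A) := mul_add (star x) y z
  inner_smul_right c (x : A) (y : A) := mul_smul_comm c (star x) y
  star_inner (x : A) (y : A) := by
    change star (star y * x) = star x * y
    rw [star_mul, star_star]
  inner_rsmul (x : A) (y : A) a := (mul_assoc (star x) y a).symm
  inner_self_nonneg (x : A) := ⟨x, rfl⟩
  inner_self_eq_zero (x : A) := CStarRing.star_mul_self_eq_zero_iff x
  complete (s : ℕ → A) hs := by
    have hn : ∀ x : A, √‖(selfBimodule A).inner x x‖ = ‖x‖ := fun x => by
      change √‖star x * x‖ = ‖x‖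
      rw [CStarRing.norm_star_mul_self, Real.sqrt_mul_self (norm_nonneg _)]
    have hc : CauchySeq s := Metric.cauchySeq_iff.2 fun ε hε => by
      obtain ⟨N, hN⟩ := hs ε hε
      exact ⟨N, fun m hm n hn' => by rw [dist_eq_norm, ← hn]; exact hN m hm n hn'⟩
    obtain ⟨x, hx⟩ := cauchySeq_tendsto_of_complete hc
    refine ⟨x, fun ε hε => ?_⟩
    obtain ⟨N, hN⟩ := Metric.tendsto_atTop.1 hx ε hε
    refine ⟨N, fun n hn' => ?_⟩
    have h1 := hN n hn'
    rw [dist_eq_norm, ← hn] at h1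
    exact h1
  lsmul_add a (x : A) (y : A) := mul_add a x y
  lsmul_smul a c (x : A) := mul_smul_comm c a x
  lsmul_rsmul a (x : A) b := (mul_assoc a x b).symm
  inner_lsmul a (x : A) (y : A) := by
    change star (a * x) * y = star x * (star a * y)
    rw [star_mul, mul_assoc]
  add_lsmul a b (x : A) := add_mul a b x
  smul_lsmul c a (x : A) := smul_mul_assoc c a x
  mul_lsmul a b (x : A) := mul_assoc a b x

namespace TensorPowers

variable {X : BimoduleData A} (T : TensorPowers X)

theorem isHilbertBimodule_pow (hX : IsHilbertBimodule X) : ∀ n, IsHilbertBimodule (T.pow n)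
  | 0 => isHilbertBimodule_self
  | 1 => hX
  | n + 2 => (T.isBalancedTensor n).isHilbertBimodule

/-- A Toeplitz representation of `X` induces compatible Toeplitz representations of its tensor
powers. -/
theorem exists_toeplitzRep {π : A →⋆ₙₐ[ℂ] B} {σ : X.carrier →ₗ[ℂ] B} (hσ : IsToeplitzRep X σ π) :
    ∃ ψ : ∀ n, (T.pow n).carrier →ₗ[ℂ] B, (∀ a : A, ψ 0 a = π a) ∧
      (∀ x : X.carrier, ψ 1 x = σ x) ∧ (∀ n x y, ψ (n + 1) (T.tmul n x y) = σ x * ψ n y) ∧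
      ∀ n, IsToeplitzRep (T.pow n) (ψ n) π := by
  let R : ℕ → Type _ := fun n => {ρ : (T.pow n).carrier →ₗ[ℂ] B // IsToeplitzRep (T.pow n) ρ π}
  let r1 : R 1 := ⟨σ, hσ⟩
  have step : ∀ n (ρ : R (n + 1)), ∃ ρ' : R (n + 2),
      ∀ x y, ρ'.1 (T.tmul (n + 1) x y) = σ x * ρ.1 y := fun n ρ => by
    obtain ⟨ψ, h1, h2⟩ := (T.isBalancedTensor n).exists_toeplitzRep hσ ρ.2
    exact ⟨⟨ψ, h1⟩, h2⟩
  choose next hnext using step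
  let r : ∀ n, R (n + 1) := fun n => Nat.rec r1 (fun n ρ => next n ρ) n
  let ψ : ∀ n, R n := fun n => match n with
    | 0 => ⟨(π : A →ₗ[ℂ] B), IsToeplitzRep.self π⟩
    | n + 1 => r n
  refine ⟨fun n => (ψ n).1, fun a => rfl, fun x => rfl, fun n => ?_, fun n => (ψ n).2⟩
  cases n with
  | zero => exact fun x a => hσ.rsmul x a
  | succ n => exact hnext n (r n)

end TensorPowers

end Tensor

/-! ### Positive functionals on C*-algebras -/

section States

open scoped ComplexOrder

/-- A functional of norm one that attains its norm at `1 + c` has the values `1` at `1` and `‖c‖` at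
`c`, because `‖1 + c‖ = 1 + ‖c‖`; its hermitian part is then positive. -/
theorem exists_positive_apply_eq_norm {U : Type u} [CStarAlgebra U] [PartialOrder U]
    [StarOrderedRing U] [Nontrivial U] {c : U} (hc : 0 ≤ c) :
    ∃ f : U →ₚ[ℂ] ℂ, f c = ‖c‖ := by
  have hnorm : ‖1 + c‖ = 1 + ‖c‖ := by
    refine le_antisymm ((norm_add_le _ _).trans (by rw [CStarRing.norm_one])) ?_
    have h1 : 1 + ‖c‖ ∈ spectrum ℝ (1 + c) := by
      have h2 := CStarAlgebra.norm_mem_spectrum_of_nonneg hc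
      have h3 := spectrum.singleton_add_eq c (1 : ℝ)
      rw [map_one] at h3
      rw [← h3]
      exact Set.add_mem_add rfl h2
    have h4 := spectrum.norm_le_norm_of_mem h1
    rwa [Real.norm_of_nonneg (by positivity)] at h4
  obtain ⟨g, hg1, hg⟩ := exists_dual_vector'' ℂ (1 + c)
  have hgle : ∀ x, ‖g x‖ ≤ ‖x‖ := fun x =>
    (g.le_opNorm x).trans (mul_le_of_le_one_left (norm_nonneg x) hg1)
  -- the real parts of `g 1` and `g c` are maximal, because `‖1 + c‖ = ‖1‖ + ‖c‖`
  have hre : (g 1).re + (g c).re = 1 + ‖c‖ := by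
    rw [← Complex.add_re, ← map_add, hg, hnorm]
    exact Complex.ofReal_re _
  have h1 : (g 1).re ≤ 1 := (Complex.re_le_norm _).trans ((hgle 1).trans CStarRing.norm_one.le)
  have h2 : (g c).re ≤ ‖c‖ := (Complex.re_le_norm _).trans (hgle c)
  let f : U →ₗ[ℂ] ℂ :=
    { toFun := fun x => (g x + star (g (star x))) / 2
      map_add' := fun x y => by
        rw [star_add, map_add, map_add, star_add]
        ring
      map_smul' := fun a x => by
        rw [star_smul, map_smul, map_smul, star_smul, star_star]
        simp only [smul_eq_mul, RingHom.id_apply]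
        ring }
  have hf : ∀ x, IsSelfAdjoint x → f x = ((g x).re : ℂ) := fun x hx => by
    change (g x + star (g (star x))) / 2 = _
    rw [hx.star_eq]
    exact Complex.re_eq_add_conj (g x) |>.symm
  have hpos : ∀ x, 0 ≤ x → 0 ≤ f x := fun x hx => by
    rw [hf x hx.isSelfAdjoint]
    refine Complex.zero_le_real.2 ?_
    rcases eq_or_ne x 0 with rfl | hx0
    · simp
    have hn : 0 < ‖x‖ := norm_pos_iff.2 hx0
    have hle : x ≤ algebraMap ℝ U ‖x‖ := hx.isSelfAdjoint.le_algebraMap_norm_self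
    have h3 : ‖algebraMap ℝ U ‖x‖ - x‖ ≤ ‖x‖ := by
      rw [CStarAlgebra.norm_le_iff_le_algebraMap _ hn.le (sub_nonneg.2 hle)]
      exact sub_le_self _ hx
    have h4 := (Complex.re_le_norm _).trans ((hgle (algebraMap ℝ U ‖x‖ - x)).trans h3)
    have h5 : g (algebraMap ℝ U ‖x‖) = (‖x‖ : ℂ) * g 1 := by
      rw [Algebra.algebraMap_eq_smul_one, ← Complex.coe_smul, map_smul, smul_eq_mul]
    rw [map_sub, Complex.sub_re, h5, Complex.re_ofReal_mul] at h4
    have h6 : (g 1).re = 1 := by linarith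
    rw [h6] at h4
    linarith
  refine ⟨PositiveLinearMap.mk₀ f hpos, ?_⟩
  change f c = _
  rw [hf c hc.isSelfAdjoint]
  congr 1
  linarith

/-- The positive functionals of a C*-algebra separate its points. -/
theorem exists_positive_star_mul_self_ne_zero {A : Type u} [NonUnitalCStarAlgebra A]
    [PartialOrder A] [StarOrderedRing A] {a : A} (ha : a ≠ 0) :
    ∃ f : A →ₚ[ℂ] ℂ, f (star a * a) ≠ 0 := by
  obtain ⟨g, hg⟩ := exists_positive_apply_eq_norm (U := Unitization ℂ A)
    (c := ((star a * a : A) : Unitization ℂ A))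
    (Unitization.inr_nonneg_iff.2 (star_mul_self_nonneg a))
  refine ⟨PositiveLinearMap.mk₀ ((g : Unitization ℂ A →ₗ[ℂ] ℂ) ∘ₗ Unitization.inrHom ℂ ℂ A)
    fun x hx => ?_, ?_⟩
  · exact g.map_nonneg (Unitization.inr_nonneg_iff.2 hx)
  · change g ((star a * a : A) : Unitization ℂ A) ≠ 0
    rw [hg, Unitization.norm_inr, CStarRing.norm_star_mul_self]
    simpa using ha

end States

/-! ### Products in Toeplitz--Cuntz--Krieger families -/

namespace IsTCKFamily

variable {k : ℕ} {Λ : KGraph.{u} k} {B : Type v} [NonUnitalCStarAlgebra B] {q : Λ.Path → B}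
  (hq : IsTCKFamily Λ q)
include hq

theorem mul_comp {μ ν : Λ.Path} (h : ν.2.1 = μ.1) : q μ * q ν = q (Λ.comp μ ν) := by
  obtain ⟨b, c, f⟩ := μ
  obtain ⟨a, b', g⟩ := ν
  obtain rfl : b' = b := h
  exact (hq.mul f g).trans (congrArg q (KGraph.comp_path f g).symm)

theorem mul_vertex (μ : Λ.Path) : q μ * q (Λ.vertex μ.1) = q μ := by
  obtain ⟨a, b, f⟩ := μ
  have h := hq.mul f (𝟙 a)
  rwa [Category.id_comp] at h

theorem vertex_mul (μ : Λ.Path) : q (Λ.vertex μ.2.1) * q μ = q μ := by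
  obtain ⟨a, b, f⟩ := μ
  have h := hq.mul (𝟙 b) f
  rwa [Category.comp_id] at h

theorem mul_eq_zero {μ ν : Λ.Path} (h : ν.2.1 ≠ μ.1) : q μ * q ν = 0 := by
  rw [← hq.mul_vertex μ, ← hq.vertex_mul ν, mul_assoc, ← mul_assoc (q (Λ.vertex _)),
    hq.orth _ _ h.symm, zero_mul, mul_zero]

theorem mul_eq_zero_or (μ ν : Λ.Path) : q μ * q ν = 0 ∨ ∃ ξ, q μ * q ν = q ξ := by
  by_cases h : ν.2.1 = μ.1
  · exact Or.inr ⟨_, hq.mul_comp h⟩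
  · exact Or.inl (hq.mul_eq_zero h)

theorem star_vertex (v : Λ.Obj) : star (q (Λ.vertex v)) = q (Λ.vertex v) :=
  (hq.proj v).isSelfAdjoint.star_eq

end IsTCKFamily

/-! ### Representations of `TC*(Λ)` on Hilbert spaces -/

section HilbertRep

variable {k : ℕ} {Λ : KGraph.{u} k}

/-- Linear maps `T_μ` with formal adjoints `S_μ` on a dense subspace of a Hilbert space which
satisfy the Toeplitz--Cuntz--Krieger relations there are automatically bounded, and extend to a
representation of `TC*(Λ)`. -/
theorem exists_rep_of_formal_adjoints (hΛ : Λ.FinitelyAligned) {V : Type*} [AddCommGroup V]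
    [Module ℂ V] {H : Type v} [NormedAddCommGroup H] [InnerProductSpace ℂ H] [CompleteSpace H]
    (W : V →ₗ[ℂ] H) (hW : DenseRange W) (T S : Λ.Path → V →ₗ[ℂ] V)
    (adj : ∀ μ x y, inner ℂ (W (T μ x)) (W y) = inner ℂ (W x) (W (S μ y)))
    (symm : ∀ v x y, inner ℂ (W (T (Λ.vertex v) x)) (W y) = inner ℂ (W x) (W (T (Λ.vertex v) y)))
    (orth : ∀ v w, v ≠ w → ∀ x, T (Λ.vertex v) (T (Λ.vertex w) x) = 0)
    (mul : ∀ {a b c : Λ.Obj} (f : b ⟶ c) (g : a ⟶ b) x,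
      T (Λ.path f) (T (Λ.path g) x) = T (Λ.path (g ≫ f)) x)
    (star_mul : ∀ μ ν x, S μ (T ν x) = ∑ p ∈ KGraph.minFin hΛ μ ν, T p.1 (S p.2 x)) :
    ∃ ρ : TCK Λ →⋆ₙₐ[ℂ] (H →L[ℂ] H), Continuous ρ ∧ (∀ μ x, ρ (tck Λ μ) (W x) = W (T μ x)) ∧
      ∀ μ x, star (ρ (tck Λ μ)) (W x) = W (S μ x) := by
  have idem : ∀ v x, T (Λ.vertex v) (T (Λ.vertex v) x) = T (Λ.vertex v) x := fun v x => by
    have h := mul (𝟙 v) (𝟙 v) x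
    rwa [Category.comp_id] at h
  have bound_vertex : ∀ v x, ‖W (T (Λ.vertex v) x)‖ ≤ ‖W x‖ := fun v x => by
    have h := norm_inner_le_norm (𝕜 := ℂ) (W x) (W (T (Λ.vertex v) x))
    rw [← idem v x, ← symm, idem, inner_self_eq_norm_sq_to_K, norm_pow, RCLike.norm_ofReal,
      abs_norm] at h
    nlinarith [norm_nonneg (W x), norm_nonneg (W (T (Λ.vertex v) x))]
  -- `T_μ^* T_μ` is the projection at the source of `μ`, so `T_μ` is contractive
  have bound : ∀ μ x, ‖W (T μ x)‖ ≤ 1 * ‖W x‖ := fun μ x => by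
    obtain ⟨a, b, f⟩ := μ
    change ‖W (T (Λ.path f) x)‖ ≤ _
    have h : KGraph.minFin hΛ (Λ.path f) (Λ.path f) = {(Λ.vertex a, Λ.vertex a)} := by
      ext p
      exact KGraph.mem_minFin.trans
        ((Set.ext_iff.1 (KGraph.minExt_self f) p).trans Finset.mem_singleton.symm)
    have h1 : inner ℂ (W (T (Λ.path f) x)) (W (T (Λ.path f) x)) =
        inner ℂ (W (T (Λ.vertex a) x)) (W x) := by
      rw [adj, star_mul, h, Finset.sum_singleton, ← symm, ← adj, idem]
    have h2 := norm_inner_le_norm (𝕜 := ℂ) (W (T (Λ.vertex a) x)) (W x)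
    rw [← h1, inner_self_eq_norm_sq_to_K, norm_pow, RCLike.norm_ofReal, abs_norm] at h2
    nlinarith [bound_vertex a x, norm_nonneg (W x), norm_nonneg (W (T (Λ.path f) x))]
  let q : Λ.Path → H →L[ℂ] H := fun μ => (W ∘ₗ T μ).extendOfNorm W
  have hq : ∀ μ x, q μ (W x) = W (T μ x) := fun μ x =>
    LinearMap.extendOfNorm_eq (f := W ∘ₗ T μ) hW ⟨1, bound μ⟩ x
  have hext : ∀ {P Q : H →L[ℂ] H}, (∀ x, P (W x) = Q (W x)) → P = Q := fun {P Q} h =>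
    DFunLike.coe_injective (hW.equalizer P.continuous Q.continuous (funext h))
  have hstar : ∀ {P Q : H →L[ℂ] H}, (∀ x y, inner ℂ (P (W x)) (W y) = inner ℂ (W x) (Q (W y))) →
      star P = Q := fun {P Q} h => by
    refine ((ContinuousLinearMap.eq_adjoint_iff Q P).2 fun x y => ?_).symm
    refine hW.induction_on₂ (p := fun x y => inner ℂ (Q x) y = inner ℂ x (P y)) (isClosed_eq ?_ ?_)
      (fun x y => ?_) x y
    · exact (Q.continuous.comp continuous_fst).inner continuous_snd
    · exact continuous_fst.inner (P.continuous.comp continuous_snd)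
    · rw [← inner_conj_symm, ← h, inner_conj_symm]
  have hqs : ∀ μ x, star (q μ) (W x) = W (S μ x) := fun μ y => by
    refine hW.eq_of_inner_right ℂ fun x => ?_
    rw [ContinuousLinearMap.star_eq_adjoint, ContinuousLinearMap.adjoint_inner_right, hq, adj]
  have hfam : IsTCKFamily Λ q :=
    { proj := fun v => ⟨hext fun x => by
          rw [mul_apply_eq_comp, hq, hq, idem],
        hstar fun x y => by rw [hq, hq, symm]⟩
      orth := fun v w hvw => hext fun x => by
        rw [mul_apply_eq_comp, hq, hq, orth v w hvw, map_zero]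
        rfl
      mul := fun f g => hext fun x => by
        rw [mul_apply_eq_comp, hq, hq, hq, mul]
      star_mul := fun μ ν => hext fun x => by
        rw [KGraph.finsum_minExt hΛ, mul_apply_eq_comp, hq, hqs, star_mul, map_sum,
          sum_apply]
        refine Finset.sum_congr rfl fun p _ => ?_
        rw [mul_apply_eq_comp, hqs, hq] }
  obtain ⟨ρ, hρ, -⟩ := tck_lift hΛ q hfam
  exact ⟨ρ, continuous_starHom ρ, fun μ x => by rw [hρ, hq], fun μ x => by rw [hρ, hqs]⟩

/-- The elements `t_μ t_ν^*` span a dense subspace of `TC*(Λ)`. -/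
theorem mem_topologicalClosure_span (hΛ : Λ.FinitelyAligned) (a : TCK Λ) :
    a ∈ (Submodule.span ℂ {x | ∃ μ ν : Λ.Path,
      x = tck Λ μ * star (tck Λ ν)}).topologicalClosure := by
  set G : Set (TCK Λ) := {x | ∃ μ ν : Λ.Path, x = tck Λ μ * star (tck Λ ν)} with hG
  set M := (Submodule.span ℂ G).topologicalClosure with hM
  have hcl : IsClosed (M : Set (TCK Λ)) := Submodule.isClosed_topologicalClosure _
  have hgen : ∀ μ ν, tck Λ μ * star (tck Λ ν) ∈ M := fun μ ν =>
    Submodule.le_topologicalClosure _ (Submodule.subset_span ⟨μ, ν, rfl⟩)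
  have htck : ∀ μ, tck Λ μ ∈ M := fun μ => by
    have h := hgen μ (Λ.vertex μ.1)
    rwa [(isTCKFamily_tck hΛ).star_vertex, (isTCKFamily_tck hΛ).mul_vertex] at h
  have hind : ∀ L : TCK Λ →ₗ[ℂ] TCK Λ, Continuous L →
      (∀ μ ν, L (tck Λ μ * star (tck Λ ν)) ∈ M) → ∀ x ∈ M, L x ∈ M := fun L hL h x hx => by
    have hle : Submodule.span ℂ G ≤ M.comap L := by
      rw [Submodule.span_le]
      rintro _ ⟨μ, ν, rfl⟩
      exact h μ ν
    exact Submodule.topologicalClosure_minimal _ hle (hcl.preimage hL) hx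
  have hmul : ∀ ξ μ ν, tck Λ ξ * (tck Λ μ * star (tck Λ ν)) ∈ M := fun ξ μ ν => by
    rw [← mul_assoc]
    obtain h | ⟨η, h⟩ := (isTCKFamily_tck hΛ).mul_eq_zero_or ξ μ
    · rw [h, zero_mul]
      exact zero_mem M
    · rw [h]
      exact hgen η ν
  have hstarmul : ∀ ξ μ ν, star (tck Λ ξ) * (tck Λ μ * star (tck Λ ν)) ∈ M := fun ξ μ ν => by
    rw [← mul_assoc, (isTCKFamily_tck hΛ).star_mul, KGraph.finsum_minExt hΛ, Finset.sum_mul]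
    refine Submodule.sum_mem _ fun p _ => ?_
    rw [mul_assoc, ← star_mul]
    obtain h | ⟨η, h⟩ := (isTCKFamily_tck hΛ).mul_eq_zero_or ν p.2
    · rw [h, star_zero, mul_zero]
      exact zero_mem M
    · rw [h]
      exact hgen p.1 η
  have hstar : ∀ x ∈ M, star x ∈ M := fun x hx => by
    refine closure_minimal (t := {x | star x ∈ M}) ?_ (hcl.preimage continuous_star) hx
    intro y hy
    induction hy using Submodule.span_induction with
    | mem y hy =>
      obtain ⟨μ, ν, rfl⟩ := hy
      change star (tck Λ μ * star (tck Λ ν)) ∈ M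
      rw [star_mul, star_star]
      exact hgen ν μ
    | zero =>
      change star (0 : TCK Λ) ∈ M
      rw [star_zero]
      exact zero_mem M
    | add y z _ _ hy hz =>
      change star (y + z) ∈ M
      rw [star_add]
      exact add_mem hy hz
    | smul c y _ hy =>
      change star (c • y) ∈ M
      rw [star_smul]
      exact M.smul_mem _ hy
  refine (?_ : a ∈ M ∧ (∀ x ∈ M, a * x ∈ M) ∧ ∀ x ∈ M, star a * x ∈ M).1
  refine tck_induction (P := fun a => a ∈ M ∧ (∀ x ∈ M, a * x ∈ M) ∧ ∀ x ∈ M, star a * x ∈ M)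
    ?_ (fun μ => ?_) ?_ ?_ ?_ ?_ ?_ a
  · have h1 : IsClosed (⋂ x ∈ M, {a : TCK Λ | a * x ∈ M}) := isClosed_iInter fun x =>
      isClosed_iInter fun _ => hcl.preimage (continuous_mul_const x)
    have h2 : IsClosed (⋂ x ∈ M, {a : TCK Λ | star a * x ∈ M}) := isClosed_iInter fun x =>
      isClosed_iInter fun _ => hcl.preimage ((continuous_mul_const x).comp continuous_star)
    convert hcl.inter (h1.inter h2) using 1
    ext a
    simp
  · exact ⟨htck μ, hind (LinearMap.mulLeft ℂ (tck Λ μ)) (continuous_const_mul _) (hmul μ),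
      hind (LinearMap.mulLeft ℂ (star (tck Λ μ))) (continuous_const_mul _) (hstarmul μ)⟩
  · exact ⟨zero_mem M, fun x _ => (zero_mul x).symm ▸ zero_mem M,
      fun x _ => by rw [star_zero, zero_mul]; exact zero_mem M⟩
  · rintro a b ⟨a1, a2, a3⟩ ⟨b1, b2, b3⟩
    refine ⟨add_mem a1 b1, fun x hx => ?_, fun x hx => ?_⟩
    · rw [add_mul]
      exact add_mem (a2 x hx) (b2 x hx)
    · rw [star_add, add_mul]
      exact add_mem (a3 x hx) (b3 x hx)
  · rintro a b ⟨a1, a2, a3⟩ ⟨b1, b2, b3⟩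
    refine ⟨a2 b b1, fun x hx => ?_, fun x hx => ?_⟩
    · rw [mul_assoc]
      exact a2 _ (b2 x hx)
    · rw [star_mul, mul_assoc]
      exact b3 _ (a3 x hx)
  · rintro c a ⟨a1, a2, a3⟩
    refine ⟨M.smul_mem c a1, fun x hx => ?_, fun x hx => ?_⟩
    · rw [smul_mul_assoc]
      exact M.smul_mem c (a2 x hx)
    · rw [star_smul, smul_mul_assoc]
      exact M.smul_mem _ (a3 x hx)
  · rintro a ⟨a1, a2, a3⟩
    refine ⟨hstar a a1, a3, fun x hx => ?_⟩
    rw [star_star]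
    exact a2 x hx

end HilbertRep

/-! ### The kernel of the Fock representation -/

section Fock

variable {k : ℕ} {Λ : KGraph.{u} (k + 1)}

/-- A path `μ` of `Λ` with `d(μ)_i = 0`, as a path of `Λ^i`. -/
def KGraph.restrict (Λ : KGraph.{u} (k + 1)) (i : Fin (k + 1)) (μ : Λ.Path) (h : Λ.deg μ i = 0) :
    (Λ.remove i).Path :=
  ⟨μ.1, μ.2.1, (⟨μ.2.2, h⟩ : {f : μ.1 ⟶ μ.2.1 // Λ.d f i = 0})⟩

theorem KGraph.incl_restrict (i : Fin (k + 1)) (μ : Λ.Path) (h : Λ.deg μ i = 0) :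
    Λ.incl i (Λ.restrict i μ h) = μ := rfl

theorem KGraph.deg_comp {μ ν : Λ.Path} (h : ν.2.1 = μ.1) :
    Λ.deg (Λ.comp μ ν) = Λ.deg μ + Λ.deg ν := by
  obtain ⟨b, c, f⟩ := μ
  obtain ⟨a, b', g⟩ := ν
  obtain rfl : b' = b := h
  change Λ.deg (Λ.comp (Λ.path f) (Λ.path g)) = _
  rw [KGraph.comp_path]
  exact (Λ.d_comp g f).trans (add_comm _ _)

/-- Every path factors as `ητ` with `d(η) ∈ ℕ e_i` and `d(τ)_i = 0`. -/
theorem KGraph.exists_head_tail (i : Fin (k + 1)) (μ : Λ.Path) :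
    ∃ p : Λ.Path × Λ.Path, p.2.2.1 = p.1.1 ∧ μ = Λ.comp p.1 p.2 ∧
      Λ.deg p.1 = Pi.single i (Λ.deg μ i) ∧ Λ.deg p.2 i = 0 := by
  obtain ⟨a, b, f⟩ := μ
  obtain ⟨c, g, r, hg, hr⟩ := KGraph.exists_factor f (m := Pi.single i (Λ.d f i))
    (fun j => by
      rcases eq_or_ne j i with rfl | hj
      · rw [Pi.single_eq_same]
      · rw [Pi.single_eq_of_ne hj]
        exact Nat.zero_le _)
  refine ⟨(Λ.path g, Λ.path r), rfl, ?_, hg, ?_⟩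
  · rw [KGraph.comp_path, hr]
    rfl
  · have h := congrFun (Λ.d_comp r g) i
    rw [hr, hg, Pi.add_apply, Pi.single_eq_same] at h
    exact right_eq_add.1 h

/-- The initial segment of `μ` of degree `d(μ)_i e_i`. -/
def KGraph.head (i : Fin (k + 1)) (μ : Λ.Path) : Λ.Path := (exists_head_tail i μ).choose.1

/-- The path `τ` with `d(τ)_i = 0` that remains of `μ` after its initial segment of degree
`d(μ)_i e_i`. -/
def KGraph.tail (i : Fin (k + 1)) (μ : Λ.Path) : Λ.Path := (exists_head_tail i μ).choose.2

theorem KGraph.head_tail (i : Fin (k + 1)) (μ : Λ.Path) :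
    (tail i μ).2.1 = (head i μ).1 ∧ μ = Λ.comp (head i μ) (tail i μ) ∧
      Λ.deg (head i μ) = Pi.single i (Λ.deg μ i) ∧ Λ.deg (tail i μ) i = 0 :=
  (exists_head_tail i μ).choose_spec

theorem KGraph.minFin_comp_comp (hΛ : Λ.FinitelyAligned) {η μ ν : Λ.Path} (hμ : μ.2.1 = η.1)
    (hν : ν.2.1 = η.1) : minFin hΛ (Λ.comp η μ) (Λ.comp η ν) = minFin hΛ μ ν := by
  obtain ⟨c, e, f⟩ := η
  obtain ⟨a, c', g⟩ := μ
  obtain ⟨b, c'', h⟩ := ν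
  obtain rfl : c' = c := hμ
  obtain rfl : c'' = c' := hν
  change minFin hΛ (Λ.comp (Λ.path f) (Λ.path g)) (Λ.comp (Λ.path f) (Λ.path h)) =
    minFin hΛ (Λ.path g) (Λ.path h)
  ext p
  rw [comp_path, comp_path, mem_minFin, mem_minFin, minExt_comp_comp]

/-- Two paths with a common extension by paths of degree zero in direction `i` have the same
initial segment of degree in `ℕ e_i`. -/
theorem KGraph.head_eq_of_mem_minExt {i : Fin (k + 1)} {μ ν : Λ.Path} {p : Λ.Path × Λ.Path}
    (hp : p ∈ Λ.minExt μ ν) (h1 : Λ.deg p.1 i = 0) (h2 : Λ.deg p.2 i = 0) :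
    head i μ = head i ν := by
  obtain ⟨d1, d2⟩ := deg_of_mem_minExt hp
  have hdeg : Λ.deg μ i = Λ.deg ν i := by
    have e := congrFun (d1.trans d2.symm) i
    simpa [h1, h2] using e
  obtain ⟨cμ, eμ, hdμ, -⟩ := head_tail i μ
  obtain ⟨cν, eν, hdν, -⟩ := head_tail i ν
  generalize head i μ = η at *
  generalize tail i μ = τ at *
  generalize head i ν = η' at *
  generalize tail i ν = τ' at *
  obtain ⟨b, c, f⟩ := η
  obtain ⟨a, b', g⟩ := τ
  obtain rfl : b' = b := cμ
  obtain ⟨e, c', f'⟩ := η'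
  obtain ⟨a', e', g'⟩ := τ'
  obtain rfl : e' = e := cν
  obtain rfl : μ = Λ.path (g ≫ f) := eμ.trans (comp_path f g)
  obtain rfl : ν = Λ.path (g' ≫ f') := eν.trans (comp_path f' g')
  obtain rfl : c = c' := range_eq_of_mem_minExt hp
  obtain ⟨w, α, β, rfl, he, -⟩ := mem_minExt.1 hp
  refine (path_eq_of_comp_eq (g := α ≫ g) (g' := β ≫ g') (f := f) (f' := f') ?_ ?_).1
  · rw [Category.assoc, he, Category.assoc]
  · exact hdμ.trans ((congrArg (Pi.single i) hdeg).trans hdν.symm)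

variable (Λ) in
/-- The family in `TC*(Λ^i)` consisting of `t_μ` if `d(μ)_i = 0` and of `0` otherwise. -/
def cutTck (i : Fin (k + 1)) (μ : Λ.Path) : TCK (Λ.remove i) :=
  if h : Λ.deg μ i = 0 then tck (Λ.remove i) (Λ.restrict i μ h) else 0

theorem cutTck_incl (i : Fin (k + 1)) (μ : (Λ.remove i).Path) :
    cutTck Λ i (Λ.incl i μ) = tck (Λ.remove i) μ := dif_pos μ.2.2.2

theorem cutTck_eq_zero {i : Fin (k + 1)} {μ : Λ.Path} (h : Λ.deg μ i ≠ 0) : cutTck Λ i μ = 0 :=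
  dif_neg h

theorem cutTck_comp (hΛ : Λ.FinitelyAligned) (i : Fin (k + 1)) {μ ν : Λ.Path} (h : ν.2.1 = μ.1) :
    cutTck Λ i (Λ.comp μ ν) = cutTck Λ i μ * cutTck Λ i ν := by
  have hd := congrFun (KGraph.deg_comp h) i
  rw [Pi.add_apply] at hd
  by_cases hμ : Λ.deg μ i = 0
  swap
  · rw [cutTck_eq_zero hμ, zero_mul, cutTck_eq_zero (by omega)]
  by_cases hν : Λ.deg ν i = 0
  swap
  · rw [cutTck_eq_zero hν, mul_zero, cutTck_eq_zero (by omega)]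
  rw [← KGraph.incl_restrict i μ hμ, ← KGraph.incl_restrict i ν hν, cutTck_incl, cutTck_incl,
    (isTCKFamily_tck (hΛ.remove i)).mul_comp h, ← cutTck_incl]
  congr 1
  obtain ⟨b, c, f⟩ := μ
  obtain ⟨a, b', g⟩ := ν
  obtain rfl : b' = b := h
  refine (KGraph.comp_path f g).trans ?_
  exact (congrArg (Λ.incl i) (KGraph.comp_path (Λ := Λ.remove i) (a := a) (b := b') (c := c)
    ⟨f, hμ⟩ ⟨g, hν⟩)).symm

theorem cutTck_star_mul (hΛ : Λ.FinitelyAligned) (i : Fin (k + 1)) {μ ν : Λ.Path}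
    (hμ : Λ.deg μ i = 0) (hν : Λ.deg ν i = 0) : star (cutTck Λ i μ) * cutTck Λ i ν =
      ∑ p ∈ KGraph.minFin hΛ μ ν, cutTck Λ i p.1 * star (cutTck Λ i p.2) := by
  rw [← KGraph.incl_restrict i μ hμ, ← KGraph.incl_restrict i ν hν, cutTck_incl, cutTck_incl,
    (isTCKFamily_tck (hΛ.remove i)).star_mul, ← KGraph.finsum_minExt hΛ]
  refine finsum_mem_eq_of_bijOn _ (Λ.bijOn_minExt i _ _) fun p _ => ?_
  rw [Prod.map_fst, Prod.map_snd, cutTck_incl, cutTck_incl]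

theorem cutTck_vertex (i : Fin (k + 1)) (v : Λ.Obj) :
    cutTck Λ i (Λ.vertex v) = tck (Λ.remove i) ((Λ.remove i).vertex v) :=
  cutTck_incl i ((Λ.remove i).vertex v)

/-- The element of `TC*(Λ^i)` which takes the place of `t_μ^* t_ν`: its formal expansion along the
minimal common extensions, cut down to degree zero in direction `i`. -/
def fockKernel (hΛ : Λ.FinitelyAligned) (i : Fin (k + 1)) (μ ν : Λ.Path) : TCK (Λ.remove i) :=
  ∑ p ∈ KGraph.minFin hΛ μ ν, cutTck Λ i p.1 * star (cutTck Λ i p.2)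

/-- The identity behind the adjointness of `fockCreate` and `fockAnnihilate`. -/
theorem fockKernel_comp_left (hΛ : Λ.FinitelyAligned) (i : Fin (k + 1)) {μ ξ : Λ.Path} (ν : Λ.Path)
    (h : ξ.2.1 = μ.1) : fockKernel hΛ i (Λ.comp μ ξ) ν =
      ∑ p ∈ KGraph.minFin hΛ μ ν, fockKernel hΛ i ξ p.1 * star (cutTck Λ i p.2) := by
  rw [fockKernel, KGraph.sum_minFin_comp_left hΛ ν h
    fun α β => cutTck Λ i α * star (cutTck Λ i β)]
  refine Finset.sum_congr rfl fun p hp => ?_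
  rw [fockKernel, Finset.sum_mul]
  refine Finset.sum_congr rfl fun q hq => ?_
  have hc : q.2.2.1 = p.2.1 := (KGraph.composable_of_mem_minExt (KGraph.mem_minFin.1 hq)).2.trans
    (KGraph.source_eq_of_mem_minExt (KGraph.mem_minFin.1 hp))
  rw [cutTck_comp hΛ i hc, star_mul, mul_assoc]

theorem fockKernel_eq_zero (hΛ : Λ.FinitelyAligned) (i : Fin (k + 1)) {μ ν : Λ.Path}
    (h : μ.2.1 ≠ ν.2.1) : fockKernel hΛ i μ ν = 0 := by
  rw [fockKernel, KGraph.minFin_eq_empty h, Finset.sum_empty]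

open scoped Classical in
/-- The kernel is of the form `W_μ^* W_ν`, hence positive definite. -/
theorem fockKernel_eq (hΛ : Λ.FinitelyAligned) (i : Fin (k + 1)) (μ ν : Λ.Path) :
    fockKernel hΛ i μ ν = if KGraph.head i μ = KGraph.head i ν then
      star (cutTck Λ i (KGraph.tail i μ)) * cutTck Λ i (KGraph.tail i ν) else 0 := by
  split_ifs with h
  · obtain ⟨cμ, eμ, -, hdμ⟩ := KGraph.head_tail i μ
    obtain ⟨cν, eν, -, hdν⟩ := KGraph.head_tail i ν
    rw [cutTck_star_mul hΛ i hdμ hdν, ← KGraph.minFin_comp_comp hΛ (η := KGraph.head i μ) cμ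
      (cν.trans (congrArg Sigma.fst h.symm)), ← eμ, h, ← eν]
    rfl
  · refine Finset.sum_eq_zero fun p hp => ?_
    by_cases h1 : Λ.deg p.1 i = 0
    · by_cases h2 : Λ.deg p.2 i = 0
      · exact absurd (KGraph.head_eq_of_mem_minExt (KGraph.mem_minFin.1 hp) h1 h2) h
      · rw [cutTck_eq_zero h2, star_zero, mul_zero]
    · rw [cutTck_eq_zero h1, zero_mul]

theorem KGraph.vertex_comp {v : Λ.Obj} {μ : Λ.Path} (h : μ.2.1 = v) :
    Λ.comp (Λ.vertex v) μ = μ := by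
  obtain ⟨a, b, f⟩ := μ
  obtain rfl : b = v := h
  exact (comp_path (𝟙 b) f).trans (congrArg Λ.path (Category.comp_id f))

theorem KGraph.comp_vertex (μ : Λ.Path) : Λ.comp μ (Λ.vertex μ.1) = μ := by
  obtain ⟨a, b, f⟩ := μ
  exact (comp_path f (𝟙 a)).trans (congrArg Λ.path (Category.id_comp f))

theorem cutTck_mul_vertex (hΛ : Λ.FinitelyAligned) (i : Fin (k + 1)) (μ : Λ.Path) :
    cutTck Λ i μ * cutTck Λ i (Λ.vertex μ.1) = cutTck Λ i μ := by
  rw [← cutTck_comp hΛ i (rfl : (Λ.vertex μ.1).2.1 = μ.1), KGraph.comp_vertex]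

theorem star_cutTck_vertex (hΛ : Λ.FinitelyAligned) (i : Fin (k + 1)) (v : Λ.Obj) :
    star (cutTck Λ i (Λ.vertex v)) = cutTck Λ i (Λ.vertex v) := by
  rw [cutTck_vertex]
  exact (isTCKFamily_tck (hΛ.remove i)).star_vertex v

theorem fockKernel_vertex (hΛ : Λ.FinitelyAligned) {i : Fin (k + 1)} (v : Λ.Obj)
    {μ : Λ.Path} (hμ : Λ.deg μ i = 0) :
    fockKernel hΛ i (Λ.vertex v) μ = cutTck Λ i (Λ.vertex v) * cutTck Λ i μ := by
  rw [← star_cutTck_vertex hΛ, cutTck_star_mul hΛ i (μ := Λ.vertex v) (congrFun (Λ.d_id v) i) hμ]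
  rfl

end Fock

/-! ### The Fock representation and injectivity of `TC*(Λ^i) → TC*(Λ)` -/

section FockRep

variable {k : ℕ} {Λ : KGraph.{u} (k + 1)}

open scoped Classical in
/-- The operator `ξ ⊗ a ↦ μξ ⊗ a`, or `0` if `s(μ) ≠ r(ξ)`. -/
def fockCreate (Λ : KGraph.{u} (k + 1)) (i : Fin (k + 1)) (μ : Λ.Path) :
    (Λ.Path →₀ TCK (Λ.remove i)) →ₗ[ℂ] (Λ.Path →₀ TCK (Λ.remove i)) :=
  Finsupp.lsum ℂ fun ξ => if ξ.2.1 = μ.1 then Finsupp.lsingle (Λ.comp μ ξ) else 0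

/-- The formal adjoint `ξ ⊗ a ↦ ∑ α ⊗ t_β^* a` of `fockCreate`, the sum being over the minimal
common extensions `(α, β)` of `μ` and `ξ` with `d(β)_i = 0`. -/
def fockAnnihilate (hΛ : Λ.FinitelyAligned) (i : Fin (k + 1)) (μ : Λ.Path) :
    (Λ.Path →₀ TCK (Λ.remove i)) →ₗ[ℂ] (Λ.Path →₀ TCK (Λ.remove i)) :=
  Finsupp.lsum ℂ fun ξ => ∑ p ∈ KGraph.minFin hΛ μ ξ,
    Finsupp.lsingle p.1 ∘ₗ LinearMap.mulLeft ℂ (star (cutTck Λ i p.2))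

theorem fockCreate_single {i : Fin (k + 1)} {μ ξ : Λ.Path} (h : ξ.2.1 = μ.1)
    (a : TCK (Λ.remove i)) :
    fockCreate Λ i μ (Finsupp.single ξ a) = Finsupp.single (Λ.comp μ ξ) a := by
  rw [fockCreate, Finsupp.lsum_single, if_pos h, Finsupp.lsingle_apply]

theorem fockCreate_single_of_ne {i : Fin (k + 1)} {μ ξ : Λ.Path} (h : ξ.2.1 ≠ μ.1)
    (a : TCK (Λ.remove i)) : fockCreate Λ i μ (Finsupp.single ξ a) = 0 := by
  rw [fockCreate, Finsupp.lsum_single, if_neg h, LinearMap.zero_apply]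

theorem fockAnnihilate_single (hΛ : Λ.FinitelyAligned) {i : Fin (k + 1)} (μ ξ : Λ.Path)
    (a : TCK (Λ.remove i)) : fockAnnihilate hΛ i μ (Finsupp.single ξ a) =
      ∑ p ∈ KGraph.minFin hΛ μ ξ, Finsupp.single p.1 (star (cutTck Λ i p.2) * a) := by
  rw [fockAnnihilate, Finsupp.lsum_single, LinearMap.sum_apply]
  rfl

theorem KGraph.range_comp {μ ν : Λ.Path} (h : ν.2.1 = μ.1) : (Λ.comp μ ν).2.1 = μ.2.1 := by
  obtain ⟨b, c, f⟩ := μ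
  obtain ⟨a, b', g⟩ := ν
  obtain rfl : b' = b := h
  change (Λ.comp (Λ.path f) (Λ.path g)).2.1 = c
  rw [comp_path]
  rfl

theorem KGraph.comp_assoc {b c e : Λ.Obj} (f : c ⟶ e) (g : b ⟶ c) {ξ : Λ.Path} (h : ξ.2.1 = b) :
    Λ.comp (Λ.path f) (Λ.comp (Λ.path g) ξ) = Λ.comp (Λ.path (g ≫ f)) ξ := by
  obtain ⟨a, b', r⟩ := ξ
  obtain rfl : b' = b := h
  change Λ.comp (Λ.path f) (Λ.comp (Λ.path g) (Λ.path r)) = Λ.comp (Λ.path (g ≫ f)) (Λ.path r)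
  rw [comp_path, comp_path, comp_path, Category.assoc]

theorem fockAnnihilate_fockCreate (hΛ : Λ.FinitelyAligned) (i : Fin (k + 1)) (μ ν : Λ.Path)
    (x : Λ.Path →₀ TCK (Λ.remove i)) : fockAnnihilate hΛ i μ (fockCreate Λ i ν x) =
      ∑ p ∈ KGraph.minFin hΛ μ ν, fockCreate Λ i p.1 (fockAnnihilate hΛ i p.2 x) := by
  induction x using Finsupp.induction_linear with
  | zero => simp
  | add x y hx hy => simp only [map_add, hx, hy, Finset.sum_add_distrib]
  | single ξ a =>
    by_cases h : ξ.2.1 = ν.1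
    · rw [fockCreate_single h, fockAnnihilate_single,
        KGraph.sum_minFin_comp_right hΛ μ h
          fun α β => Finsupp.single α (star (cutTck Λ i β) * a)]
      refine Finset.sum_congr rfl fun p hp => ?_
      rw [fockAnnihilate_single, map_sum]
      refine Finset.sum_congr rfl fun q hq => (fockCreate_single ?_ _).symm
      exact (KGraph.composable_of_mem_minExt (KGraph.mem_minFin.1 hq)).1.trans
        (KGraph.source_eq_of_mem_minExt (KGraph.mem_minFin.1 hp)).symm
    · rw [fockCreate_single_of_ne h, map_zero]
      refine (Finset.sum_eq_zero fun p hp => ?_).symm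
      have hne : p.2.2.1 ≠ ξ.2.1 := fun e => h (e.symm.trans
        (KGraph.composable_of_mem_minExt (KGraph.mem_minFin.1 hp)).2)
      rw [fockAnnihilate_single, KGraph.minFin_eq_empty hne, Finset.sum_empty, map_zero]

open scoped ComplexOrder in
open scoped Classical in
/-- The map from formal sums of symbols `ξ ⊗ a` to the Hilbert space of the Fock representation that
is induced from a positive functional `f`: if `ξ = ητ` with `d(η) ∈ ℕ e_i` and `d(τ)_i = 0`, then
`ξ ⊗ a` is sent to the vector `t_τ a` in the `η`-th copy of the GNS space of `f`. -/
def fockVector {i : Fin (k + 1)} [PartialOrder (TCK (Λ.remove i))]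
    [StarOrderedRing (TCK (Λ.remove i))] (f : TCK (Λ.remove i) →ₚ[ℂ] ℂ) :
    (Λ.Path →₀ TCK (Λ.remove i)) →ₗ[ℂ] lp (fun _ : Λ.Path => f.GNS) 2 :=
  Finsupp.lsum ℂ fun ξ => lp.lsingle (𝕜 := ℂ) (E := fun _ : Λ.Path => f.GNS) 2 (KGraph.head i ξ) ∘ₗ
    (UniformSpace.Completion.toComplL (𝕜 := ℂ) (E := f.PreGNS) : f.PreGNS →ₗ[ℂ] f.GNS) ∘ₗ
      f.toPreGNS.toLinearMap ∘ₗ LinearMap.mulLeft ℂ (cutTck Λ i (KGraph.tail i ξ))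

open scoped ComplexOrder in
theorem inner_fockVector_single (hΛ : Λ.FinitelyAligned) {i : Fin (k + 1)}
    [PartialOrder (TCK (Λ.remove i))] [StarOrderedRing (TCK (Λ.remove i))]
    (f : TCK (Λ.remove i) →ₚ[ℂ] ℂ) (ξ ζ : Λ.Path) (a b : TCK (Λ.remove i)) :
    inner ℂ (fockVector f (Finsupp.single ξ a)) (fockVector f (Finsupp.single ζ b)) =
      f (star a * fockKernel hΛ i ξ ζ * b) := by
  classical
  rw [fockVector, Finsupp.lsum_single, Finsupp.lsum_single]
  change inner ℂ (lp.single 2 (KGraph.head i ξ) _) (lp.single 2 (KGraph.head i ζ) _) = _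
  rw [lp.inner_single_left, lp.single_apply, fockKernel_eq]
  split_ifs with h
  · rw [h, Pi.single_eq_same]
    refine (UniformSpace.Completion.inner_coe _ _).trans ?_
    rw [PositiveLinearMap.preGNS_inner_def]
    change f (star (_ * a) * (_ * b)) = _
    rw [star_mul]
    simp only [mul_assoc]
  · rw [Pi.single_eq_of_ne h, inner_zero_right, mul_zero, zero_mul, map_zero]

open scoped ComplexOrder in
theorem inner_fockVector_fockCreate (hΛ : Λ.FinitelyAligned) {i : Fin (k + 1)}
    [PartialOrder (TCK (Λ.remove i))] [StarOrderedRing (TCK (Λ.remove i))]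
    (f : TCK (Λ.remove i) →ₚ[ℂ] ℂ) (μ : Λ.Path) (x y : Λ.Path →₀ TCK (Λ.remove i)) :
    inner ℂ (fockVector f (fockCreate Λ i μ x)) (fockVector f y) =
      inner ℂ (fockVector f x) (fockVector f (fockAnnihilate hΛ i μ y)) := by
  induction x using Finsupp.induction_linear with
  | zero => simp
  | add x x' hx hx' => simp only [map_add, inner_add_left, hx, hx']
  | single ξ a =>
    induction y using Finsupp.induction_linear with
    | zero => simp
    | add y y' hy hy' => simp only [map_add, inner_add_right, hy, hy']
    | single ζ b =>
      rw [fockAnnihilate_single, map_sum, inner_sum]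
      simp only [inner_fockVector_single hΛ]
      by_cases h : ξ.2.1 = μ.1
      · rw [fockCreate_single h, inner_fockVector_single hΛ, fockKernel_comp_left hΛ i ζ h,
          Finset.mul_sum, Finset.sum_mul, map_sum]
        simp only [mul_assoc]
      · rw [fockCreate_single_of_ne h, map_zero, inner_zero_left]
        refine (Finset.sum_eq_zero fun p hp => ?_).symm
        rw [fockKernel_eq_zero hΛ i fun e => h (e.trans
          (KGraph.composable_of_mem_minExt (KGraph.mem_minFin.1 hp)).1), mul_zero, zero_mul,
          map_zero]

open scoped ComplexOrder in
theorem inner_fockVector_fockCreate_vertex (hΛ : Λ.FinitelyAligned) {i : Fin (k + 1)}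
    [PartialOrder (TCK (Λ.remove i))] [StarOrderedRing (TCK (Λ.remove i))]
    (f : TCK (Λ.remove i) →ₚ[ℂ] ℂ) (v : Λ.Obj) (x y : Λ.Path →₀ TCK (Λ.remove i)) :
    inner ℂ (fockVector f (fockCreate Λ i (Λ.vertex v) x)) (fockVector f y) =
      inner ℂ (fockVector f x) (fockVector f (fockCreate Λ i (Λ.vertex v) y)) := by
  induction x using Finsupp.induction_linear with
  | zero => simp
  | add x x' hx hx' => simp only [map_add, inner_add_left, hx, hx']
  | single ξ a =>
    induction y using Finsupp.induction_linear with
    | zero => simp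
    | add y y' hy hy' => simp only [map_add, inner_add_right, hy, hy']
    | single ζ b =>
      by_cases h : ξ.2.1 = v <;> by_cases h' : ζ.2.1 = v
      · rw [fockCreate_single (μ := Λ.vertex v) h, fockCreate_single (μ := Λ.vertex v) h',
          KGraph.vertex_comp h, KGraph.vertex_comp h']
      · rw [fockCreate_single (μ := Λ.vertex v) h, fockCreate_single_of_ne (μ := Λ.vertex v) h',
          KGraph.vertex_comp h, inner_fockVector_single hΛ,
          fockKernel_eq_zero hΛ i fun e => h' (e.symm.trans h)]
        simp
      · rw [fockCreate_single_of_ne (μ := Λ.vertex v) h, fockCreate_single (μ := Λ.vertex v) h',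
          KGraph.vertex_comp h', inner_fockVector_single hΛ,
          fockKernel_eq_zero hΛ i fun e => h (e.trans h')]
        simp
      · rw [fockCreate_single_of_ne (μ := Λ.vertex v) h,
          fockCreate_single_of_ne (μ := Λ.vertex v) h']
        simp

theorem fockCreate_mul (i : Fin (k + 1)) {a b c : Λ.Obj} (f : b ⟶ c) (g : a ⟶ b)
    (x : Λ.Path →₀ TCK (Λ.remove i)) : fockCreate Λ i (Λ.path f) (fockCreate Λ i (Λ.path g) x) =
      fockCreate Λ i (Λ.path (g ≫ f)) x := by
  induction x using Finsupp.induction_linear with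
  | zero => simp
  | add x y hx hy => simp only [map_add, hx, hy]
  | single ξ y =>
    by_cases h : ξ.2.1 = a
    · rw [fockCreate_single (μ := Λ.path g) h, fockCreate_single (μ := Λ.path f)
        (KGraph.range_comp (μ := Λ.path g) h), fockCreate_single (μ := Λ.path (g ≫ f)) h,
        KGraph.comp_assoc f g h]
    · rw [fockCreate_single_of_ne (μ := Λ.path g) h, map_zero,
        fockCreate_single_of_ne (μ := Λ.path (g ≫ f)) h]

theorem fockCreate_orth (i : Fin (k + 1)) {v w : Λ.Obj} (hvw : v ≠ w)
    (x : Λ.Path →₀ TCK (Λ.remove i)) :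
    fockCreate Λ i (Λ.vertex v) (fockCreate Λ i (Λ.vertex w) x) = 0 := by
  induction x using Finsupp.induction_linear with
  | zero => simp
  | add x y hx hy => simp only [map_add, hx, hy, add_zero]
  | single ξ y =>
    by_cases h : ξ.2.1 = w
    · rw [fockCreate_single (μ := Λ.vertex w) h, KGraph.vertex_comp h,
        fockCreate_single_of_ne (μ := Λ.vertex v) fun e => hvw (e.symm.trans h)]
    · rw [fockCreate_single_of_ne (μ := Λ.vertex w) h, map_zero]

theorem KGraph.minFin_vertex_right (hΛ : Λ.FinitelyAligned) {v : Λ.Obj} {μ : Λ.Path}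
    (h : μ.2.1 = v) : minFin hΛ μ (Λ.vertex v) = {(Λ.vertex μ.1, μ)} := by
  ext p
  rw [mem_minFin, ← swap_mem_minExt, ← mem_minFin (hΛ := hΛ), minFin_vertex h,
    Finset.mem_singleton, Finset.mem_singleton, Prod.swap_eq_iff_eq_swap]
  rfl

theorem fockAnnihilate_single_vertex (hΛ : Λ.FinitelyAligned) {i : Fin (k + 1)} {μ : Λ.Path}
    (hμ : Λ.deg μ i = 0) (v : Λ.Obj) (c : TCK (Λ.remove i)) :
    fockAnnihilate hΛ i μ (Finsupp.single (Λ.vertex v) c) = Finsupp.single (Λ.vertex μ.1)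
      (star (cutTck Λ i (Λ.vertex v) * cutTck Λ i μ) * c) := by
  rw [fockAnnihilate_single]
  by_cases h : μ.2.1 = v
  · rw [KGraph.minFin_vertex_right hΛ h, Finset.sum_singleton,
      ← cutTck_comp hΛ i (μ := Λ.vertex v) h, KGraph.vertex_comp h]
  · rw [KGraph.minFin_eq_empty (ν := Λ.vertex v) h, Finset.sum_empty, ← fockKernel_vertex hΛ v hμ,
      fockKernel_eq_zero hΛ i fun e => h e.symm, star_zero, zero_mul, Finsupp.single_zero]

open scoped ComplexOrder in
/-- The Fock representation of `TC*(Λ)` induced from a positive functional `f` of `TC*(Λ^i)`. -/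
theorem exists_fock_rep (hΛ : Λ.FinitelyAligned) {i : Fin (k + 1)}
    [PartialOrder (TCK (Λ.remove i))] [StarOrderedRing (TCK (Λ.remove i))]
    (f : TCK (Λ.remove i) →ₚ[ℂ] ℂ) :
    ∃ (H : Type u) (_ : NormedAddCommGroup H) (_ : InnerProductSpace ℂ H) (_ : CompleteSpace H)
      (W : (Λ.Path →₀ TCK (Λ.remove i)) →ₗ[ℂ] H) (ρ : TCK Λ →⋆ₙₐ[ℂ] (H →L[ℂ] H)),
      Continuous ρ ∧ (∀ μ x, ρ (tck Λ μ) (W x) = W (fockCreate Λ i μ x)) ∧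
      (∀ μ x, star (ρ (tck Λ μ)) (W x) = W (fockAnnihilate hΛ i μ x)) ∧
      ∀ ξ ζ a b, inner ℂ (W (Finsupp.single ξ a)) (W (Finsupp.single ζ b)) =
        f (star a * fockKernel hΛ i ξ ζ * b) := by
  let R := (LinearMap.range (fockVector f)).topologicalClosure
  let W : (Λ.Path →₀ TCK (Λ.remove i)) →ₗ[ℂ] R := (fockVector f).codRestrict R fun x =>
    Submodule.le_topologicalClosure _ (LinearMap.mem_range_self _ x)
  have hW : DenseRange W := by
    intro y
    rw [closure_subtype]
    have h : Subtype.val '' Set.range W = LinearMap.range (fockVector f) := by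
      rw [← Set.range_comp]
      rfl
    rw [h]
    exact y.2
  have : CompleteSpace R := (Submodule.isClosed_topologicalClosure _).completeSpace_coe
  obtain ⟨ρ, hρ, h1, h2⟩ := exists_rep_of_formal_adjoints hΛ W hW (fockCreate Λ i)
    (fockAnnihilate hΛ i) (inner_fockVector_fockCreate hΛ f)
    (inner_fockVector_fockCreate_vertex hΛ f) (fun v w h x => fockCreate_orth i h x)
    (fun f g x => fockCreate_mul i f g x) (fockAnnihilate_fockCreate hΛ i)
  exact ⟨R, inferInstance, inferInstance, this, W, ρ, hρ, h1, h2, inner_fockVector_single hΛ f⟩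

open scoped ComplexOrder in
/-- The vector functionals of the Fock representation at vertices restrict to the functionals
`a ↦ f(c^* t_v a t_w b)` on `TC*(Λ^i)`, which therefore vanish on the kernel of
`TC*(Λ^i) → TC*(Λ)`. -/
theorem apply_eq_zero_of_inclHom_eq_zero (hΛ : Λ.FinitelyAligned) {i : Fin (k + 1)}
    [PartialOrder (TCK (Λ.remove i))] [StarOrderedRing (TCK (Λ.remove i))]
    (f : TCK (Λ.remove i) →ₚ[ℂ] ℂ) {a : TCK (Λ.remove i)} (ha : inclHom hΛ i a = 0)
    (v w : Λ.Obj) (b c : TCK (Λ.remove i)) :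
    f (star c * (cutTck Λ i (Λ.vertex v) * a * cutTck Λ i (Λ.vertex w)) * b) = 0 := by
  obtain ⟨H, _, _, _, W, ρ, hρ, h1, h2, hW⟩ := exists_fock_rep hΛ f
  have key : ∀ a, inner ℂ (W (Finsupp.single (Λ.vertex v) c))
      (ρ (inclHom hΛ i a) (W (Finsupp.single (Λ.vertex w) b))) =
        f (star c * (cutTck Λ i (Λ.vertex v) * a * cutTck Λ i (Λ.vertex w)) * b) := by
    intro a
    have hf : Continuous f := map_continuous f
    have hc : Continuous fun a => ρ (inclHom hΛ i a) :=
      hρ.comp (continuous_starHom (inclHom hΛ i))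
    refine closure_minimal (t := {a | inner ℂ (W (Finsupp.single (Λ.vertex v) c))
      (ρ (inclHom hΛ i a) (W (Finsupp.single (Λ.vertex w) b))) =
        f (star c * (cutTck Λ i (Λ.vertex v) * a * cutTck Λ i (Λ.vertex w)) * b)}) ?_
      (isClosed_eq ?_ ?_) (mem_topologicalClosure_span (hΛ.remove i) a)
    · intro a ha
      change _ = _
      induction ha using Submodule.span_induction with
      | zero => simp
      | add x y _ _ hx hy =>
        simp only [map_add, add_apply, inner_add_right, mul_add, add_mul, hx, hy]
      | smul z x _ hx =>
        simp only [map_smul, smul_apply, inner_smul_right, mul_smul_comm,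
          smul_mul_assoc, hx, smul_eq_mul]
      | mem x hx =>
        obtain ⟨μ, ν, rfl⟩ := hx
        have hμ := deg_incl i μ
        have hν := deg_incl i ν
        rw [map_mul, map_star, inclHom_tck, inclHom_tck, map_mul, map_star,
          mul_apply_eq_comp, h2, ← cutTck_incl, ← cutTck_incl]
        generalize Λ.incl i μ = μ at *
        generalize Λ.incl i ν = ν at *
        rw [← ContinuousLinearMap.adjoint_inner_left, ← ContinuousLinearMap.star_eq_adjoint, h2,
          fockAnnihilate_single_vertex hΛ hμ, fockAnnihilate_single_vertex hΛ hν, hW,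
          fockKernel_vertex hΛ _ (μ := Λ.vertex ν.1) (congrFun (Λ.d_id _) i)]
        congr 1
        have e1 : ∀ x, cutTck Λ i μ * (cutTck Λ i (Λ.vertex μ.1) * x) = cutTck Λ i μ * x :=
          fun x => by rw [← mul_assoc, cutTck_mul_vertex hΛ]
        have e2 : ∀ x, cutTck Λ i (Λ.vertex ν.1) * (star (cutTck Λ i ν) * x) =
            star (cutTck Λ i ν) * x := fun x => by
          rw [← mul_assoc, ← star_cutTck_vertex hΛ, ← star_mul, cutTck_mul_vertex hΛ]
        simp only [star_mul, star_star, star_cutTck_vertex hΛ, mul_assoc, e1, e2]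
    · exact continuous_const.inner (hc.clm_apply continuous_const)
    · exact hf.comp (((continuous_const.mul continuous_id).mul continuous_const).const_mul _
        |>.mul continuous_const)
  rw [← key, ha, map_zero, zero_apply, inner_zero_right]

/-- The vertex projections act nondegenerately. -/
theorem eq_zero_of_vertex_mul {k : ℕ} {Λ : KGraph.{u} k} (hΛ : Λ.FinitelyAligned) {z : TCK Λ}
    (hz : ∀ v, tck Λ (Λ.vertex v) * z = 0) : z = 0 := by
  have hq := isTCKFamily_tck hΛ
  have h : ∀ y : TCK Λ, y * z = 0 ∧ star y * z = 0 := by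
    refine tck_induction ?_ (fun μ => ⟨?_, ?_⟩) ?_ ?_ ?_ ?_ ?_
    · exact (isClosed_eq (continuous_mul_const z) continuous_const).inter
        (isClosed_eq ((continuous_mul_const z).comp continuous_star) continuous_const)
    · rw [← hq.mul_vertex μ, mul_assoc, hz, mul_zero]
    · rw [← hq.vertex_mul μ, star_mul, hq.star_vertex, mul_assoc, hz, mul_zero]
    · simp
    · rintro a b ⟨a1, a2⟩ ⟨b1, b2⟩
      simp only [star_add, add_mul, a1, a2, b1, b2, add_zero, and_self]
    · rintro a b ⟨a1, a2⟩ ⟨b1, b2⟩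
      simp only [star_mul, mul_assoc, b1, a2, mul_zero, and_self]
    · rintro c a ⟨a1, a2⟩
      simp only [star_smul, smul_mul_assoc, a1, a2, smul_zero, and_self]
    · rintro a ⟨a1, a2⟩
      exact ⟨a2, (star_star a).symm ▸ a1⟩
  exact (CStarRing.star_mul_self_eq_zero_iff z).1 (h (star z)).1

/-- The canonical homomorphism `TC*(Λ^i) → TC*(Λ)` is injective. -/
theorem inclHom_injective (hΛ : Λ.FinitelyAligned) (i : Fin (k + 1)) :
    Function.Injective (inclHom hΛ i) := by
  let _ := CStarAlgebra.spectralOrder (TCK (Λ.remove i))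
  have _ := CStarAlgebra.spectralOrderedRing (TCK (Λ.remove i))
  refine (injective_iff_map_eq_zero _).2 fun a ha => ?_
  have h1 : ∀ v w, cutTck Λ i (Λ.vertex v) * a * cutTck Λ i (Λ.vertex w) = 0 := fun v w => by
    by_contra hne
    obtain ⟨f, hf⟩ := exists_positive_star_mul_self_ne_zero hne
    refine hf ?_
    have h := apply_eq_zero_of_inclHom_eq_zero hΛ f ha v w (cutTck Λ i (Λ.vertex w))
      (cutTck Λ i (Λ.vertex v) * a * cutTck Λ i (Λ.vertex w))
    have hw : cutTck Λ i (Λ.vertex w) * cutTck Λ i (Λ.vertex w) = cutTck Λ i (Λ.vertex w) :=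
      cutTck_mul_vertex hΛ i (Λ.vertex w)
    rwa [mul_assoc, mul_assoc _ (cutTck Λ i (Λ.vertex w)), hw] at h
  have h2 : ∀ w, a * cutTck Λ i (Λ.vertex w) = 0 := fun w =>
    eq_zero_of_vertex_mul (hΛ.remove i) fun v => by
      have h := h1 v w
      rwa [mul_assoc, cutTck_vertex i v] at h
  refine star_eq_zero.1 (eq_zero_of_vertex_mul (hΛ.remove i) fun (w : Λ.Obj) => ?_)
  have h : star (a * cutTck Λ i (Λ.vertex w)) = 0 := by rw [h2, star_zero]
  rwa [star_mul, star_cutTck_vertex hΛ, cutTck_vertex] at h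

end FockRep

/-! ### The bimodules `X_n` as Hilbert bimodules -/

/-- An injective `*`-homomorphism reflects positivity: it commutes with the absolute value, and
positive elements are those equal to their absolute value. -/
theorem exists_star_mul_self_of_map {A : Type u} {B : Type v} [NonUnitalCStarAlgebra A]
    [NonUnitalCStarAlgebra B] {φ : A →⋆ₙₐ[ℂ] B} (hφ : Function.Injective φ) {c : A} {x : B}
    (h : φ c = star x * x) : ∃ b, c = star b * b := by
  let _ := CStarAlgebra.spectralOrder A
  have _ := CStarAlgebra.spectralOrderedRing A
  let _ := CStarAlgebra.spectralOrder B
  have _ := CStarAlgebra.spectralOrderedRing B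
  have hsa : IsSelfAdjoint c := hφ (by rw [map_star, h, star_mul, star_star])
  have hpos : 0 ≤ φ c := h ▸ star_mul_self_nonneg x
  have habs : CFC.abs c = c := hφ <| by
    rw [CFC.abs_eq_cfcₙ_norm c hsa, NonUnitalStarAlgHomClass.map_cfcₙ (S := ℂ) φ _ c (by fun_prop)
      (by simp) (continuous_starHom φ) hsa hpos.isSelfAdjoint,
      ← CFC.abs_eq_cfcₙ_norm (φ c) hpos.isSelfAdjoint, CFC.abs_of_nonneg (φ c) hpos]
  have hc : 0 ≤ c := habs ▸ CFC.abs_nonneg c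
  exact CStarAlgebra.nonneg_iff_eq_star_mul_self.1 hc

section GradedBimodule

variable {k : ℕ} {Λ : KGraph.{u} (k + 1)}

/-- A closed property that holds for the elements `t_μ t_ν^*` of `X_n` and is stable under the
vector space operations holds on `X_n`. -/
theorem graded_induction {i : Fin (k + 1)} {n : ℕ} {P : TCK Λ → Prop} (closed : IsClosed {x | P x})
    (gen : ∀ μ ν : Λ.Path, Λ.deg μ i = n → Λ.deg ν i = 0 → P (tck Λ μ * star (tck Λ ν)))
    (zero : P 0) (add : ∀ x y, P x → P y → P (x + y)) (smul : ∀ (c : ℂ) x, P x → P (c • x))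
    {x : TCK Λ} (hx : x ∈ gradedSubspace Λ i n) : P x := by
  refine closure_minimal (t := {x | P x}) (fun y hy => ?_) closed hx
  induction hy using Submodule.span_induction with
  | mem y hy =>
    obtain ⟨μ, ν, hμ, hν, rfl⟩ := hy
    exact gen μ ν hμ hν
  | zero => exact zero
  | add y z _ _ hy hz => exact add y z hy hz
  | smul c y _ hy => exact smul c y hy

theorem isClosed_gradedSubspace (i : Fin (k + 1)) (n : ℕ) :
    IsClosed (gradedSubspace Λ i n : Set (TCK Λ)) :=
  Submodule.isClosed_topologicalClosure _

theorem tck_mul_mem_add (hΛ : Λ.FinitelyAligned) {i : Fin (k + 1)} {m n l : ℕ} (hl : m + n = l)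
    {ξ : Λ.Path} (hξ : Λ.deg ξ i = m) {x : TCK Λ} (hx : x ∈ gradedSubspace Λ i n) :
    tck Λ ξ * x ∈ gradedSubspace Λ i l := by
  refine gradedSubspace_induction (f := LinearMap.mulLeft ℂ (tck Λ ξ))
    (continuous_const_mul _) (fun μ ν hμ hν => ?_) hx
  rw [LinearMap.mulLeft_apply, ← mul_assoc]
  obtain h | ⟨η, h, hd⟩ := tck_mul_tck hΛ ξ μ
  · rw [h, zero_mul]
    exact zero_mem _
  · rw [h]
    exact mul_star_mem i (by rw [hd, Pi.add_apply, hξ, hμ, hl]) hν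

theorem star_tck_mul_mem_sub (hΛ : Λ.FinitelyAligned) {i : Fin (k + 1)} {m n l : ℕ}
    (hl : m + n = l) {ξ : Λ.Path} (hξ : Λ.deg ξ i = m) {x : TCK Λ}
    (hx : x ∈ gradedSubspace Λ i l) : star (tck Λ ξ) * x ∈ gradedSubspace Λ i n := by
  refine gradedSubspace_induction (f := LinearMap.mulLeft ℂ (star (tck Λ ξ)))
    (continuous_const_mul _) (fun μ ν hμ hν => ?_) hx
  rw [LinearMap.mulLeft_apply, ← mul_assoc, (isTCKFamily_tck hΛ).star_mul,
    KGraph.finsum_minExt hΛ, Finset.sum_mul]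
  refine Submodule.sum_mem _ fun p hp => ?_
  obtain ⟨h1, h2⟩ := deg_of_mem_minExt (KGraph.mem_minFin.1 hp)
  have h1 := congrFun h1 i
  have h2 := congrFun h2 i
  simp only [Pi.add_apply, Pi.sup_apply, hμ, hξ] at h1 h2
  rw [sup_of_le_right (by omega)] at h1 h2
  rw [mul_assoc, ← star_mul]
  obtain h | ⟨η, h, hd⟩ := tck_mul_tck hΛ ν p.2
  · rw [h, star_zero, mul_zero]
    exact zero_mem _
  · rw [h]
    exact mul_star_mem i (by omega) (by rw [hd, Pi.add_apply, hν]; omega)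

/-- `X_m X_n ⊆ X_{m + n}`. -/
theorem graded_mul_mem (hΛ : Λ.FinitelyAligned) {i : Fin (k + 1)} {m n l : ℕ} (hl : m + n = l)
    {x y : TCK Λ} (hx : x ∈ gradedSubspace Λ i m) (hy : y ∈ gradedSubspace Λ i n) :
    x * y ∈ gradedSubspace Λ i l := by
  refine graded_induction (P := fun x => x * y ∈ gradedSubspace Λ i l)
    ((isClosed_gradedSubspace i l).preimage (continuous_mul_const y)) (fun μ ν hμ hν => ?_) ?_
    (fun x z hx hz => ?_) (fun c x hx => ?_) hx
  · rw [mul_assoc]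
    exact tck_mul_mem_add hΛ hl hμ (star_tck_mul_mem hΛ hν hy)
  · rw [zero_mul]
    exact zero_mem _
  · rw [add_mul]
    exact add_mem hx hz
  · rw [smul_mul_assoc]
    exact Submodule.smul_mem _ _ hx

/-- `X_m^* X_{m + n} ⊆ X_n`. -/
theorem graded_star_mul_mem (hΛ : Λ.FinitelyAligned) {i : Fin (k + 1)} {m n l : ℕ} (hl : m + n = l)
    {x y : TCK Λ} (hx : x ∈ gradedSubspace Λ i m) (hy : y ∈ gradedSubspace Λ i l) :
    star x * y ∈ gradedSubspace Λ i n := by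
  refine graded_induction (P := fun x => star x * y ∈ gradedSubspace Λ i n)
    ((isClosed_gradedSubspace i n).preimage ((continuous_mul_const y).comp continuous_star))
    (fun μ ν hμ hν => ?_) ?_ (fun x z hx hz => ?_) (fun c x hx => ?_) hx
  · rw [star_mul, star_star, mul_assoc]
    exact tck_mul_mem hΛ hν (star_tck_mul_mem_sub hΛ hl hμ hy)
  · rw [star_zero, zero_mul]
    exact zero_mem _
  · rw [star_add, add_mul]
    exact add_mem hx hz
  · rw [star_smul, smul_mul_assoc]
    exact Submodule.smul_mem _ _ hx

/-- The subspace `X_0` is the range of `φ`. -/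
theorem mem_gradedSubspace_zero (hΛ : Λ.FinitelyAligned) {i : Fin (k + 1)} {x : TCK Λ} :
    x ∈ gradedSubspace Λ i 0 ↔ ∃ a, inclHom hΛ i a = x := by
  constructor
  · intro hx
    have hcl : IsClosed (Set.range (inclHom hΛ i)) :=
      (NonUnitalStarAlgHom.isometry _ (inclHom_injective hΛ i)).isClosedEmbedding.isClosed_range
    refine graded_induction (P := fun x => x ∈ Set.range (inclHom hΛ i)) hcl
      (fun μ ν hμ hν => ?_) ⟨0, map_zero _⟩ ?_ ?_ hx
    · refine ⟨tck _ (Λ.restrict i μ hμ) * star (tck _ (Λ.restrict i ν hν)), ?_⟩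
      rw [map_mul, map_star, inclHom_tck, inclHom_tck, KGraph.incl_restrict, KGraph.incl_restrict]
    · rintro _ _ ⟨a, rfl⟩ ⟨b, rfl⟩
      exact ⟨a + b, map_add _ a b⟩
    · rintro c _ ⟨a, rfl⟩
      exact ⟨c • a, map_smul _ c a⟩
  · rintro ⟨a, rfl⟩
    have hc : Continuous (inclHom hΛ i) := continuous_starHom _
    have hcl := isClosed_gradedSubspace (Λ := Λ) i 0
    have h0 : ∀ v, Λ.deg (Λ.vertex v) i = 0 := fun v => congrFun (Λ.d_id v) i
    have hgen : ∀ μ : Λ.Path, Λ.deg μ i = 0 →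
        tck Λ μ ∈ gradedSubspace Λ i 0 ∧ star (tck Λ μ) ∈ gradedSubspace Λ i 0 := fun μ hμ => by
      have h1 := mul_star_mem i hμ (h0 μ.1)
      have h2 := mul_star_mem i (h0 μ.1) hμ
      rw [(isTCKFamily_tck hΛ).star_vertex, tck_mul_vertex hΛ] at h1
      rw [← (isTCKFamily_tck hΛ).star_vertex, ← star_mul, tck_mul_vertex hΛ] at h2
      exact ⟨h1, h2⟩
    refine (tck_induction (P := fun a => inclHom hΛ i a ∈ gradedSubspace Λ i 0 ∧
      star (inclHom hΛ i a) ∈ gradedSubspace Λ i 0) ?_ (fun μ => ?_) ?_ (fun a b ha hb => ?_)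
      (fun a b ha hb => ?_) (fun c a ha => ?_) (fun a ha => ?_) a).1
    · exact IsClosed.inter (hcl.preimage hc) (hcl.preimage hc.star)
    · rw [inclHom_tck]
      exact hgen _ (deg_incl i μ)
    · rw [map_zero, star_zero]
      exact ⟨zero_mem _, zero_mem _⟩
    · rw [map_add, star_add]
      exact ⟨add_mem ha.1 hb.1, add_mem ha.2 hb.2⟩
    · rw [map_mul, star_mul]
      exact ⟨graded_mul_mem hΛ (add_zero 0) ha.1 hb.1, graded_mul_mem hΛ (add_zero 0) hb.2 ha.2⟩
    · rw [map_smul, star_smul]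
      exact ⟨Submodule.smul_mem _ _ ha.1, Submodule.smul_mem _ _ ha.2⟩
    · rw [map_star, star_star]
      exact ha.symm

variable (hΛ : Λ.FinitelyAligned) (i : Fin (k + 1)) (n : ℕ)

theorem gradedIncl_mem (x : (gradedBimodule hΛ i n).carrier) :
    gradedIncl hΛ i n x ∈ gradedSubspace Λ i n := x.2

theorem gradedIncl_injective : Function.Injective (gradedIncl hΛ i n) := Subtype.val_injective

theorem exists_gradedIncl {x : TCK Λ} (hx : x ∈ gradedSubspace Λ i n) :
    ∃ y, gradedIncl hΛ i n y = x := ⟨⟨x, hx⟩, rfl⟩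

theorem gradedIncl_gen (μ : Λ.Path) (hμ : Λ.deg μ i = n) :
    gradedIncl hΛ i n (gradedGen hΛ i n μ hμ) = tck Λ μ := rfl

theorem gradedIncl_elt (μ ν : Λ.Path) (hμ : Λ.deg μ i = n) (hν : Λ.deg ν i = 0) :
    gradedIncl hΛ i n (gradedElt hΛ i n μ ν hμ hν) = tck Λ μ * star (tck Λ ν) := rfl

/-- The inclusion of `X_n` and `φ` form a Toeplitz representation. Its last law says that `x^* y`
lies in the range of `φ`, so that `φ⁻¹(x^* y)` is meaningful. -/
theorem isToeplitzRep_gradedIncl :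
    IsToeplitzRep (gradedBimodule hΛ i n) (gradedIncl hΛ i n) (inclHom hΛ i) where
  lsmul _ _ := rfl
  rsmul _ _ := rfl
  inner x y := (Function.invFun_eq ((mem_gradedSubspace_zero hΛ).1
    (graded_star_mul_mem hΛ (add_zero n) x.2 y.2))).symm

/-- `X_n` is a Hilbert bimodule whose norm is that of `TC*(Λ)`. -/
theorem isHilbertBimodule_graded : IsHilbertBimodule (gradedBimodule hΛ i n) := by
  have hφ := inclHom_injective hΛ i
  have hι := gradedIncl_injective hΛ i n
  have hr := isToeplitzRep_gradedIncl hΛ i n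
  have hn := hr.norm_eq hφ
  constructor
  · intro x y a
    apply hι
    simp only [hr.rsmul, map_add, add_mul]
  · intro x a b
    apply hι
    simp only [hr.rsmul, map_add, mul_add]
  · intro x a b
    apply hι
    simp only [hr.rsmul, map_mul, mul_assoc]
  · intro c x a
    apply hι
    simp only [hr.rsmul, map_smul, smul_mul_assoc]
  · intro c x a
    apply hι
    simp only [hr.rsmul, map_smul, mul_smul_comm]
  · intro x y z
    apply hφ
    simp only [map_add, ← hr.inner, mul_add]
  · intro c x y
    apply hφ
    simp only [map_smul, ← hr.inner, mul_smul_comm]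
  · intro x y
    apply hφ
    simp only [map_star, ← hr.inner, star_mul, star_star]
  · intro x y a
    apply hφ
    simp only [map_mul, ← hr.inner, hr.rsmul, mul_assoc]
  · exact fun x => exists_star_mul_self_of_map hφ (hr.inner x x).symm
  · intro x
    rw [← map_eq_zero_iff _ hφ, ← hr.inner, CStarRing.star_mul_self_eq_zero_iff,
      map_eq_zero_iff _ hι]
  · intro s hs
    have hc : CauchySeq fun m => gradedIncl hΛ i n (s m) := Metric.cauchySeq_iff.2 fun ε hε => by
      obtain ⟨N, hN⟩ := hs ε hε
      refine ⟨N, fun m hm m' hm' => ?_⟩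
      rw [dist_eq_norm, ← map_sub, hn]
      exact hN m hm m' hm'
    obtain ⟨x, hx⟩ := cauchySeq_tendsto_of_complete hc
    obtain ⟨y, rfl⟩ := exists_gradedIncl hΛ i n ((isClosed_gradedSubspace i n).mem_of_tendsto hx
      (Filter.Eventually.of_forall fun m => gradedIncl_mem hΛ i n (s m)))
    refine ⟨y, fun ε hε => ?_⟩
    obtain ⟨N, hN⟩ := Metric.tendsto_atTop.1 hx ε hε
    refine ⟨N, fun m hm => ?_⟩
    rw [← hn, map_sub, ← dist_eq_norm]
    exact hN m hm
  · intro a x y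
    apply hι
    simp only [hr.lsmul, map_add, mul_add]
  · intro a c x
    apply hι
    simp only [hr.lsmul, map_smul, mul_smul_comm]
  · intro a x b
    apply hι
    simp only [hr.lsmul, hr.rsmul, mul_assoc]
  · intro a x y
    apply hφ
    simp only [← hr.inner, hr.lsmul, star_mul, map_star, mul_assoc]
  · intro a b x
    apply hι
    simp only [hr.lsmul, map_add, add_mul]
  · intro c a x
    apply hι
    simp only [hr.lsmul, map_smul, smul_mul_assoc]
  · intro a b x
    apply hι
    simp only [hr.lsmul, map_mul, mul_assoc]

/-- The multiplication of `TC*(Λ)` as a map `X_1 × X_n → X_{n + 1}`. -/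
def gradedTensor : (gradedBimodule hΛ i 1).carrier →ₗ[ℂ] (gradedBimodule hΛ i n).carrier →ₗ[ℂ]
    (gradedBimodule hΛ i (n + 1)).carrier :=
  LinearMap.mk₂ ℂ
    (fun x y => ⟨gradedIncl hΛ i 1 x * gradedIncl hΛ i n y,
      graded_mul_mem hΛ (add_comm 1 n) (gradedIncl_mem hΛ i 1 x) (gradedIncl_mem hΛ i n y)⟩)
    (fun x y _ => Subtype.ext ((congrArg (· * _) (map_add _ x y)).trans (add_mul _ _ _)))
    (fun c x _ => Subtype.ext ((congrArg (· * _) (map_smul _ c x)).trans (smul_mul_assoc _ _ _)))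
    (fun _ y z => Subtype.ext ((congrArg (_ * ·) (map_add _ y z)).trans (mul_add _ _ _)))
    (fun c _ z => Subtype.ext ((congrArg (_ * ·) (map_smul _ c z)).trans (mul_smul_comm _ _ _)))

theorem gradedIncl_tensor (x : (gradedBimodule hΛ i 1).carrier)
    (y : (gradedBimodule hΛ i n).carrier) : gradedIncl hΛ i (n + 1) (gradedTensor hΛ i n x y) =
      gradedIncl hΛ i 1 x * gradedIncl hΛ i n y := rfl

/-- A path `μ` with `d(μ)_i = m + n` factors as `ξν` with `d(ξ)_i = m` and `d(ν)_i = n`. -/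
theorem KGraph.exists_factor_single {i : Fin (k + 1)} {m n : ℕ} {μ : Λ.Path}
    (hμ : Λ.deg μ i = m + n) : ∃ ξ ν : Λ.Path, ν.2.1 = ξ.1 ∧ μ = Λ.comp ξ ν ∧
      Λ.deg ξ i = m ∧ Λ.deg ν i = n := by
  obtain ⟨a, b, f⟩ := μ
  obtain ⟨c, g, r, hg, hr⟩ := KGraph.exists_factor f (m := Pi.single i m)
    (fun j => by
      rcases eq_or_ne j i with rfl | hj
      · rw [Pi.single_eq_same]
        exact le_of_le_of_eq (Nat.le_add_right m n) hμ.symm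
      · rw [Pi.single_eq_of_ne hj]
        exact Nat.zero_le _)
  refine ⟨Λ.path g, Λ.path r, rfl, ?_, ?_, ?_⟩
  · rw [KGraph.comp_path, hr]
    rfl
  · have h := congrFun hg i
    rwa [Pi.single_eq_same] at h
  · have h := congrFun (Λ.d_comp r g) i
    rw [hr, hg, Pi.add_apply, Pi.single_eq_same] at h
    have h2 : Λ.d r i + m = m + n := h.symm.trans hμ
    exact Nat.add_left_cancel ((add_comm _ _).trans h2)

/-- The products `t_ξ y` with `d(ξ)_i = 1` and `y ∈ X_n` are total in `X_{n + 1}`. -/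
theorem graded_succ_induction {hΛ : Λ.FinitelyAligned} {i : Fin (k + 1)} {n : ℕ}
    {P : TCK Λ → Prop} (closed : IsClosed {x | P x})
    (gen : ∀ ξ : Λ.Path, Λ.deg ξ i = 1 → ∀ (y : (gradedBimodule hΛ i n).carrier),
      P (tck Λ ξ * gradedIncl hΛ i n y))
    (zero : P 0) (add : ∀ x y, P x → P y → P (x + y)) (smul : ∀ (c : ℂ) x, P x → P (c • x))
    {x : TCK Λ} (hx : x ∈ gradedSubspace Λ i (n + 1)) : P x := by
  refine graded_induction closed (fun μ ν hμ hν => ?_) zero add smul hx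
  obtain ⟨ξ, μ', h, rfl, hξ, hμ'⟩ := KGraph.exists_factor_single (hμ.trans (add_comm n 1))
  rw [← (isTCKFamily_tck hΛ).mul_comp h, mul_assoc]
  exact gen ξ hξ (gradedElt hΛ i n μ' ν hμ' hν)

/-- Multiplication exhibits `X_{n + 1}` as the balanced tensor product of `X_1` and `X_n`. -/
theorem isBalancedTensor_graded : IsBalancedTensor (gradedBimodule hΛ i 1)
    (gradedBimodule hΛ i n) (gradedBimodule hΛ i (n + 1)) (gradedTensor hΛ i n) := by
  have hφ := inclHom_injective hΛ i
  have hι := gradedIncl_injective hΛ i (n + 1)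
  have hr := isToeplitzRep_gradedIncl hΛ i (n + 1)
  have hr1 := isToeplitzRep_gradedIncl hΛ i 1
  have hrn := isToeplitzRep_gradedIncl hΛ i n
  refine ⟨isHilbertBimodule_graded hΛ i (n + 1), ?_, ?_, ?_, ?_, ?_⟩
  · intro x a y
    apply hι
    simp only [gradedIncl_tensor, hr1.rsmul, hrn.lsmul, mul_assoc]
  · intro x y x' y'
    apply hφ
    simp only [← hr.inner, ← hrn.inner, gradedIncl_tensor, hrn.lsmul, ← hr1.inner, star_mul,
      mul_assoc]
  · intro a x y
    apply hι
    simp only [gradedIncl_tensor, hr1.lsmul, hr.lsmul, mul_assoc]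
  · intro x y b
    apply hι
    simp only [gradedIncl_tensor, hrn.rsmul, hr.rsmul, mul_assoc]
  · intro z
    set S := Submodule.span ℂ {w | ∃ x y, w = gradedTensor hΛ i n x y} with hS
    have key : gradedIncl hΛ i (n + 1) z ∈
        (S.map (gradedIncl hΛ i (n + 1))).topologicalClosure := by
      refine graded_succ_induction (hΛ := hΛ) (P := fun x =>
          x ∈ (S.map (gradedIncl hΛ i (n + 1))).topologicalClosure)
        (Submodule.isClosed_topologicalClosure _) (fun ξ hξ y => ?_) (zero_mem _)
        (fun x y => add_mem) (fun c x hx => Submodule.smul_mem _ c hx)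
        (gradedIncl_mem hΛ i (n + 1) z)
      exact Submodule.le_topologicalClosure _ ⟨gradedTensor hΛ i n (gradedGen hΛ i 1 ξ hξ) y,
        Submodule.subset_span ⟨_, _, rfl⟩, rfl⟩
    intro ε hε
    obtain ⟨_, ⟨w, hw, rfl⟩, hlt⟩ := Metric.mem_closure_iff.1 key ε hε
    refine ⟨w, hw, ?_⟩
    rwa [← hr.norm_eq hφ, map_sub, ← dist_eq_norm]

/-- The bimodules `X_{n + 2}` and the multiplication of `TC*(Λ)` realise the tensor powers of
`X_1`. -/
theorem nonempty_tensorPowers : Nonempty (TensorPowers (gradedBimodule hΛ i 1)) :=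
  ⟨{ higher := fun n => gradedBimodule hΛ i (n + 2)
     tensor := fun n => match n with
       | 0 => gradedTensor hΛ i 1
       | n + 1 => gradedTensor hΛ i (n + 2)
     isBalancedTensor := fun n => match n with
       | 0 => isBalancedTensor_graded hΛ i 1
       | n + 1 => isBalancedTensor_graded hΛ i (n + 2) }⟩

end GradedBimodule

/-! ### The isomorphisms between `X_n` and the tensor powers of `X_1` -/

/-- A representation of a balanced tensor product maps into every closed subspace that contains the
images of the elementary tensors. -/
theorem IsBalancedTensor.apply_mem {A : Type u} [NonUnitalCStarAlgebra A] {B : Type v}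
    [NonUnitalCStarAlgebra B] {X Y Z : BimoduleData A}
    {τ : X.carrier →ₗ[ℂ] Y.carrier →ₗ[ℂ] Z.carrier} (hτ : IsBalancedTensor X Y Z τ)
    {σ : Z.carrier →ₗ[ℂ] B} {π : A →⋆ₙₐ[ℂ] B} (hσ : IsToeplitzRep Z σ π) {M : Submodule ℂ B}
    (hM : IsClosed (M : Set B)) (h : ∀ x y, σ (τ x y) ∈ M) (z : Z.carrier) : σ z ∈ M := by
  refine hM.closure_subset (Metric.mem_closure_iff.2 fun ε hε => ?_)
  obtain ⟨w, hw, hlt⟩ := hτ.dense z ε hε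
  refine ⟨σ w, ?_, ?_⟩
  · have hle : Submodule.span ℂ {w | ∃ x y, w = τ x y} ≤ M.comap σ := by
      rw [Submodule.span_le]
      rintro _ ⟨x, y, rfl⟩
      exact h x y
    exact hle hw
  · rw [dist_eq_norm, ← map_sub]
    exact (hσ.norm_le _).trans_lt hlt

section TensorIso

variable {k : ℕ} {Λ : KGraph.{u} (k + 1)} {hΛ : Λ.FinitelyAligned} {i : Fin (k + 1)}

/-- The representations of the tensor powers of `X_1` in `TC*(Λ)` induced by the inclusion of `X_1`
have range `X_n`. -/
theorem mem_gradedSubspace_iff_of_tensorPowers (T : TensorPowers (gradedBimodule hΛ i 1))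
    {Θ : ∀ n, (T.pow n).carrier →ₗ[ℂ] TCK Λ}
    (hΘ0 : ∀ a : TCK (Λ.remove i), Θ 0 a = inclHom hΛ i a)
    (hΘ1 : ∀ x : (gradedBimodule hΛ i 1).carrier, Θ 1 x = gradedIncl hΛ i 1 x)
    (hΘm : ∀ n x y, Θ (n + 1) (T.tmul n x y) = gradedIncl hΛ i 1 x * Θ n y)
    (hΘ : ∀ n, IsToeplitzRep (T.pow n) (Θ n) (inclHom hΛ i)) (n : ℕ) :
    ∀ x, x ∈ gradedSubspace Λ i n ↔ ∃ z, Θ n z = x := by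
  have hφ := inclHom_injective hΛ i
  have hT := T.isHilbertBimodule_pow (isHilbertBimodule_graded hΛ i 1)
  induction n with
  | zero =>
    intro x
    rw [mem_gradedSubspace_zero hΛ]
    constructor
    · rintro ⟨a, rfl⟩
      exact ⟨a, hΘ0 a⟩
    · rintro ⟨a, rfl⟩
      exact ⟨a, (hΘ0 a).symm⟩
  | succ n ih =>
    intro x
    constructor
    · intro hx
      refine graded_succ_induction (hΛ := hΛ) (P := fun x => x ∈ Set.range (Θ (n + 1)))
        ((hΘ (n + 1)).isClosed_range hφ (hT (n + 1))) (fun ξ hξ y => ?_) ⟨0, map_zero _⟩ ?_ ?_ hx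
      · obtain ⟨z, hz⟩ := (ih _).1 (gradedIncl_mem hΛ i n y)
        exact ⟨T.tmul n (gradedGen hΛ i 1 ξ hξ) z, by rw [hΘm, hz, gradedIncl_gen]⟩
      · rintro _ _ ⟨a, rfl⟩ ⟨b, rfl⟩
        exact ⟨a + b, map_add _ a b⟩
      · rintro c _ ⟨a, rfl⟩
        exact ⟨c • a, map_smul _ c a⟩
    · rintro ⟨z, rfl⟩
      cases n with
      | zero => exact (hΘ1 z).symm ▸ gradedIncl_mem hΛ i 1 z
      | succ n =>
        refine (T.isBalancedTensor n).apply_mem (hΘ (n + 2)) (isClosed_gradedSubspace i (n + 2))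
          (fun x y => ?_) z
        exact (hΘm (n + 1) x y).symm ▸ graded_mul_mem hΛ (add_comm 1 (n + 1))
          (gradedIncl_mem hΛ i 1 x) ((ih _).2 ⟨y, rfl⟩)

/-- The inverses of the representations of the tensor powers of `X_1` on the spaces `X_n` are
isomorphisms of Hilbert bimodules that turn products into tensors. -/
theorem TensorPowers.exists_iso (T : TensorPowers (gradedBimodule hΛ i 1)) :
    ∃ Ω : ∀ n, (gradedBimodule hΛ i n).carrier →ₗ[ℂ] (T.pow n).carrier,
      (∀ n, IsBimoduleIso (gradedBimodule hΛ i n) (T.pow n) (Ω n)) ∧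
      (∀ n x a, Ω n ((gradedBimodule hΛ i n).rsmul x a) = (T.pow n).rsmul (Ω n x) a) ∧
      (∀ x, inclHom hΛ i (Ω 0 x) = gradedIncl hΛ i 0 x) ∧ (∀ x, Ω 1 x = x) ∧
      ∀ n x y z, gradedIncl hΛ i (n + 1) z = gradedIncl hΛ i 1 x * gradedIncl hΛ i n y →
        Ω (n + 1) z = T.tmul n x (Ω n y) := by
  have hφ := inclHom_injective hΛ i
  have hT := T.isHilbertBimodule_pow (isHilbertBimodule_graded hΛ i 1)
  -- `Θ_n` sends `x_1 ⊗ ⋯ ⊗ x_n` to the product `x_1 ⋯ x_n` in `TC*(Λ)`, and `Ω_n` is its inverse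
  obtain ⟨Θ, hΘ0, hΘ1, hΘm, hΘ⟩ := T.exists_toeplitzRep (isToeplitzRep_gradedIncl hΛ i 1)
  have hinj := fun n => (hΘ n).injective hφ (hT n)
  have hran := mem_gradedSubspace_iff_of_tensorPowers T hΘ0 hΘ1 hΘm hΘ
  have hr := isToeplitzRep_gradedIncl hΛ i
  choose ω hω using fun n (x : (gradedBimodule hΛ i n).carrier) =>
    (hran n _).1 (gradedIncl_mem hΛ i n x)
  refine ⟨fun n =>
    { toFun := ω n
      map_add' := fun x y => hinj n (by rw [map_add, hω, hω, hω, map_add])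
      map_smul' := fun c x => hinj n (by rw [map_smul, hω, hω, map_smul, RingHom.id_apply]) },
    fun n => ⟨fun z => ?_, fun a x => hinj n ?_, fun x y => hφ ?_⟩, fun n x a => hinj n ?_,
    fun x => ?_, fun x => hinj 1 ?_, fun n x y z h => hinj (n + 1) ?_⟩
  · obtain ⟨x, hx⟩ := exists_gradedIncl hΛ i n ((hran n _).2 ⟨z, rfl⟩)
    exact ⟨x, hinj n ((hω n x).trans hx)⟩
  · exact (hω n _).trans (by rw [(hΘ n).lsmul, (hr n).lsmul]; exact congrArg _ (hω n x).symm)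
  · rw [← (hΘ n).inner, ← (hr n).inner]
    exact congrArg₂ (fun s t => star s * t) (hω n x) (hω n y)
  · exact (hω n _).trans
      (by rw [(hΘ n).rsmul, (hr n).rsmul]; exact congrArg (· * _) (hω n x).symm)
  · exact (hΘ0 _).symm.trans (hω 0 x)
  · exact (hω 1 x).trans (hΘ1 x).symm
  · exact (hω (n + 1) z).trans
      (h.trans ((congrArg (_ * ·) (hω n y).symm).trans (hΘm n x (ω n y)).symm))

end TensorIso

/-! ### Toeplitz--Cuntz--Krieger families from representations of the bimodules `X_n` -/

/-- Representations `Ψ_n` of the bimodules `X_n` with the same coefficient representation `π` that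
are compatible with the multiplication of `TC*(Λ)`. The condition `coeff` says `Ψ_0 = π ∘ φ⁻¹`. -/
structure IsGradedRep {k : ℕ} {Λ : KGraph.{u} (k + 1)} (hΛ : Λ.FinitelyAligned) (i : Fin (k + 1))
    {B : Type v} [NonUnitalCStarAlgebra B] (Ψ : ∀ n, (gradedBimodule hΛ i n).carrier →ₗ[ℂ] B)
    (π : TCK (Λ.remove i) →⋆ₙₐ[ℂ] B) : Prop where
  toeplitz : ∀ n, IsToeplitzRep (gradedBimodule hΛ i n) (Ψ n) π
  coeff : ∀ a x, inclHom hΛ i a = gradedIncl hΛ i 0 x → Ψ 0 x = π a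
  mul : ∀ n x y z, gradedIncl hΛ i (n + 1) z = gradedIncl hΛ i 1 x * gradedIncl hΛ i n y →
    Ψ (n + 1) z = Ψ 1 x * Ψ n y

namespace IsGradedRep

variable {k : ℕ} {Λ : KGraph.{u} (k + 1)} {hΛ : Λ.FinitelyAligned} {i : Fin (k + 1)}
  {B : Type v} [NonUnitalCStarAlgebra B] {Ψ : ∀ n, (gradedBimodule hΛ i n).carrier →ₗ[ℂ] B}
  {π : TCK (Λ.remove i) →⋆ₙₐ[ℂ] B}

/-- The degree `n` may be replaced by `d(μ)_i`, to which it is equal only propositionally. -/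
theorem apply_gen_eq {n : ℕ} {μ : Λ.Path} (hμ : Λ.deg μ i = n) :
    Ψ n (gradedGen hΛ i n μ hμ) = Ψ (Λ.deg μ i) (gradedGen hΛ i _ μ rfl) := by
  subst hμ
  rfl

variable (h : IsGradedRep hΛ i Ψ π)
include h

theorem apply_gen_zero (μ : Λ.Path) (hμ : Λ.deg μ i = 0) :
    Ψ 0 (gradedGen hΛ i 0 μ hμ) = π (tck _ (Λ.restrict i μ hμ)) :=
  h.coeff _ _ (inclHom_tck hΛ i (Λ.restrict i μ hμ))

/-- Compatibility with products `t_μ y`, by factoring `μ` into paths `ξ` with `d(ξ)_i = 1`. -/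
theorem apply_tck_mul {m : ℕ} : ∀ {n l : ℕ}, m + n = l → ∀ (μ : Λ.Path) (hμ : Λ.deg μ i = m)
    (y : (gradedBimodule hΛ i n).carrier) (z : (gradedBimodule hΛ i l).carrier),
    gradedIncl hΛ i l z = tck Λ μ * gradedIncl hΛ i n y →
      Ψ l z = Ψ m (gradedGen hΛ i m μ hμ) * Ψ n y := by
  induction m with
  | zero =>
    intro n l hl μ hμ y z hz
    obtain rfl : n = l := (zero_add n).symm.trans hl
    have hzy : z = (gradedBimodule hΛ i n).lsmul (tck _ (Λ.restrict i μ hμ)) y := by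
      apply gradedIncl_injective hΛ i n
      rw [hz, (isToeplitzRep_gradedIncl hΛ i n).lsmul, inclHom_tck, KGraph.incl_restrict]
    rw [hzy, (h.toeplitz n).lsmul, h.apply_gen_zero]
  | succ m ih =>
    intro n l hl μ hμ y z hz
    obtain rfl : l = m + n + 1 := by omega
    obtain ⟨ξ, μ', hc, rfl, hξ, hμ'⟩ :=
      KGraph.exists_factor_single (m := 1) (hμ.trans (add_comm m 1))
    have hq := (isTCKFamily_tck hΛ).mul_comp hc
    obtain ⟨w, hw⟩ := exists_gradedIncl hΛ i (m + n)
      (tck_mul_mem_add hΛ rfl hμ' (gradedIncl_mem hΛ i n y))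
    rw [h.mul (m + n) (gradedGen hΛ i 1 ξ hξ) w z
        (by rw [hz, hw, gradedIncl_gen, ← hq, mul_assoc]),
      h.mul m (gradedGen hΛ i 1 ξ hξ) (gradedGen hΛ i m μ' hμ') _ hq.symm,
      ih rfl μ' hμ' y w hw, mul_assoc]

theorem apply_elt {n : ℕ} (μ ν : Λ.Path) (hμ : Λ.deg μ i = n) (hν : Λ.deg ν i = 0) :
    Ψ n (gradedElt hΛ i n μ ν hμ hν) =
      Ψ n (gradedGen hΛ i n μ hμ) * star (Ψ 0 (gradedGen hΛ i 0 ν hν)) := by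
  have he : gradedElt hΛ i n μ ν hμ hν = (gradedBimodule hΛ i n).rsmul (gradedGen hΛ i n μ hμ)
      (star (tck _ (Λ.restrict i ν hν))) := by
    apply gradedIncl_injective hΛ i n
    rw [(isToeplitzRep_gradedIncl hΛ i n).rsmul, map_star, inclHom_tck]
    rfl
  rw [he, (h.toeplitz n).rsmul, map_star, h.apply_gen_zero]

/-- The inner products `Ψ(t_μ)^* Ψ(t_ν)` for `d(μ)_i ≤ d(ν)_i`: after splitting off an initial
segment `ν'` of `ν` with `d(ν')_i = d(μ)_i`, they reduce to the coefficient `⟨t_μ, t_ν'⟩`. -/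
theorem star_apply_mul_apply {m n l : ℕ} (hl : m + n = l) (μ ν : Λ.Path) (hμ : Λ.deg μ i = m)
    (hν : Λ.deg ν i = l) (w : (gradedBimodule hΛ i n).carrier)
    (hw : gradedIncl hΛ i n w = star (tck Λ μ) * tck Λ ν) :
    star (Ψ m (gradedGen hΛ i m μ hμ)) * Ψ l (gradedGen hΛ i l ν hν) = Ψ n w := by
  obtain ⟨ν', ν'', hc, rfl, hν', hν''⟩ := KGraph.exists_factor_single (m := m) (hν.trans hl.symm)
  have hq := (isTCKFamily_tck hΛ).mul_comp hc
  rw [h.apply_tck_mul hl ν' hν' (gradedGen hΛ i n ν'' hν'') _ hq.symm, ← mul_assoc,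
    (h.toeplitz m).inner, ← (h.toeplitz n).lsmul]
  congr 1
  apply gradedIncl_injective hΛ i n
  rw [hw, (isToeplitzRep_gradedIncl hΛ i n).lsmul, ← (isToeplitzRep_gradedIncl hΛ i m).inner,
    gradedIncl_gen, gradedIncl_gen, gradedIncl_gen, mul_assoc, hq]

theorem star_apply_mul_apply_eq_sum {μ ν : Λ.Path} (hle : Λ.deg μ i ≤ Λ.deg ν i) :
    star (Ψ _ (gradedGen hΛ i _ μ rfl)) * Ψ _ (gradedGen hΛ i _ ν rfl) =
      ∑ p ∈ KGraph.minFin hΛ μ ν,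
        Ψ _ (gradedGen hΛ i _ p.1 rfl) * star (Ψ _ (gradedGen hΛ i _ p.2 rfl)) := by
  obtain ⟨n, hn⟩ := Nat.exists_eq_add_of_le hle
  have hdeg : ∀ p ∈ KGraph.minFin hΛ μ ν, Λ.deg p.1 i = n ∧ Λ.deg p.2 i = 0 := fun p hp => by
    obtain ⟨h1, h2⟩ := deg_of_mem_minExt (KGraph.mem_minFin.1 hp)
    have h1 := congrFun h1 i
    have h2 := congrFun h2 i
    simp only [Pi.add_apply, Pi.sup_apply, sup_of_le_right hle] at h1 h2
    omega
  rw [h.star_apply_mul_apply hn.symm μ ν rfl rfl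
    (∑ p ∈ (KGraph.minFin hΛ μ ν).attach, gradedElt hΛ i n p.1.1 p.1.2 (hdeg p.1 p.2).1
      (hdeg p.1 p.2).2) ?_, map_sum, ← Finset.sum_attach (KGraph.minFin hΛ μ ν)]
  · refine Finset.sum_congr rfl fun p _ => ?_
    rw [h.apply_elt, apply_gen_eq (hdeg p.1 p.2).1, apply_gen_eq (hdeg p.1 p.2).2]
  · rw [map_sum, (isTCKFamily_tck hΛ).star_mul, KGraph.finsum_minExt hΛ,
      ← Finset.sum_attach (KGraph.minFin hΛ μ ν)]
    rfl

theorem isTCKFamily : IsTCKFamily Λ fun μ => Ψ (Λ.deg μ i) (gradedGen hΛ i _ μ rfl) := by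
  have hv : ∀ v, Ψ _ (gradedGen hΛ i _ (Λ.vertex v) rfl) = π (tck _ ((Λ.remove i).vertex v)) :=
    fun v => by
      have h0 : Λ.deg (Λ.vertex v) i = 0 := congrFun (Λ.d_id v) i
      rw [← apply_gen_eq h0, h.apply_gen_zero]
      rfl
  have hA := isTCKFamily_tck (hΛ.remove i)
  refine ⟨fun v => ?_, fun v w hvw => ?_, fun {a b c} f g => ?_, fun μ ν => ?_⟩
  · rw [hv]
    exact (hA.proj v).map π
  · rw [hv, hv, ← map_mul, hA.orth v w hvw, map_zero]
  · refine (h.apply_tck_mul (l := Λ.deg (Λ.path (g ≫ f)) i) ?_ (Λ.path f) rfl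
      (gradedGen hΛ i _ (Λ.path g) rfl) _ ((isTCKFamily_tck hΛ).mul f g).symm).symm
    exact (add_comm _ _).trans (congrFun (Λ.d_comp g f) i).symm
  · rw [KGraph.finsum_minExt hΛ]
    obtain hle | hle := le_total (Λ.deg μ i) (Λ.deg ν i)
    · exact h.star_apply_mul_apply_eq_sum hle
    · have hs := congrArg star (h.star_apply_mul_apply_eq_sum hle)
      rw [star_mul, star_star, star_sum] at hs
      rw [hs, ← KGraph.sum_minFin_swap hΛ μ ν]
      refine Finset.sum_congr rfl fun p _ => ?_
      rw [star_mul, star_star]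
      rfl

/-- A `*`-homomorphism that undoes `Ψ_1` and `π` undoes all `Ψ_n` on the generators. -/
theorem map_apply_gen {F : B →⋆ₙₐ[ℂ] TCK Λ} (h1 : ∀ x, F (Ψ 1 x) = gradedIncl hΛ i 1 x)
    (h0 : ∀ a, F (π a) = inclHom hΛ i a) (n : ℕ) : ∀ (μ : Λ.Path) (hμ : Λ.deg μ i = n),
      F (Ψ n (gradedGen hΛ i n μ hμ)) = tck Λ μ := by
  induction n with
  | zero =>
    intro μ hμ
    rw [h.apply_gen_zero, h0, inclHom_tck, KGraph.incl_restrict]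
  | succ n ih =>
    intro μ hμ
    obtain ⟨ξ, ν, hc, rfl, hξ, hν⟩ := KGraph.exists_factor_single (m := 1) (hμ.trans (add_comm n 1))
    have hq := (isTCKFamily_tck hΛ).mul_comp hc
    rw [h.mul n (gradedGen hΛ i 1 ξ hξ) (gradedGen hΛ i n ν hν) _ hq.symm, map_mul, h1, ih ν hν,
      gradedIncl_gen, hq]

/-- The homomorphism induced by the family `Ψ(t_μ)` restricts to `Ψ_1` on `X_1` and to `π` on the
coefficient algebra. -/
theorem apply_gradedIncl {f : TCK Λ →⋆ₙₐ[ℂ] B}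
    (hf : ∀ μ, f (tck Λ μ) = Ψ (Λ.deg μ i) (gradedGen hΛ i _ μ rfl)) :
    (∀ n x, f (gradedIncl hΛ i n x) = Ψ n x) ∧ ∀ a, f (inclHom hΛ i a) = π a := by
  refine ⟨fun n x => ?_, fun a => ?_⟩
  · let σ : gradedSubspace Λ i n →ₗ[ℂ] B := Ψ n
    have hσ : Continuous σ := AddMonoidHomClass.continuous_of_bound σ 1 fun y => by
      rw [one_mul]
      exact ((h.toeplitz n).norm_le y).trans_eq
        ((isToeplitzRep_gradedIncl hΛ i n).norm_eq (inclHom_injective hΛ i) y).symm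
    have hcl : IsClosed (Subtype.val '' {y : gradedSubspace Λ i n | f y = σ y}) :=
      (isClosed_gradedSubspace i n).isClosedEmbedding_subtypeVal.isClosedMap _
        (isClosed_eq ((continuous_starHom f).comp continuous_subtype_val) hσ)
    have key := graded_induction (P := fun t => t ∈ Subtype.val ''
      {y : gradedSubspace Λ i n | f y = σ y}) hcl (fun μ ν hμ hν => ?_) ⟨0, ?_, rfl⟩ ?_ ?_
      (gradedIncl_mem hΛ i n x)
    · obtain ⟨y, hy, hyx⟩ := key
      obtain rfl : y = x := Subtype.ext hyx
      exact hy
    · refine ⟨gradedElt hΛ i n μ ν hμ hν, ?_, rfl⟩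
      change f (tck Λ μ * star (tck Λ ν)) = Ψ n (gradedElt hΛ i n μ ν hμ hν)
      rw [h.apply_elt, map_mul, map_star, hf, hf, apply_gen_eq hμ, apply_gen_eq hν]
    · exact (map_zero f).trans (map_zero σ).symm
    · rintro _ _ ⟨y, hy, rfl⟩ ⟨z, hz, rfl⟩
      exact ⟨y + z, (map_add f _ _).trans ((congrArg₂ _ hy hz).trans (map_add σ y z).symm), rfl⟩
    · rintro c _ ⟨y, hy, rfl⟩
      exact ⟨c • y, (map_smul f c _).trans ((congrArg _ hy).trans (map_smul σ c y).symm), rfl⟩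
  · refine DFunLike.congr_fun (f := f.comp (inclHom hΛ i)) (g := π)
      (universal_hom_ext fun μ => ?_) a
    change f (inclHom hΛ i (tck _ μ)) = π (tck _ μ)
    rw [inclHom_tck, hf, ← apply_gen_eq (deg_incl i μ), h.apply_gen_zero]
    rfl

end IsGradedRep

theorem mainTheorem2 {k : ℕ} (Λ : KGraph.{u} (k + 1)) (hΛ : Λ.FinitelyAligned)
    (i : Fin (k + 1)) :
    -- the map `φ`, and the bimodules `X_n` with `⟨x, y⟩ = φ⁻¹(x^* y)`
    Function.Injective (inclHom hΛ i) ∧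
    (∀ n : ℕ, IsHilbertBimodule (gradedBimodule hΛ i n)) ∧
    -- `(ι, φ)` is a Toeplitz representation of `X = X_1`
    IsToeplitzRep (gradedBimodule hΛ i 1) (gradedIncl hΛ i 1) (inclHom hΛ i) ∧
    -- `F` is the induced homomorphism `ι × φ`
    ∃ F : ToeplitzAlgebra (gradedBimodule hΛ i 1) →⋆ₙₐ[ℂ] TCK Λ,
      (∀ x, F (toeplitzX (gradedBimodule hΛ i 1) x) = gradedIncl hΛ i 1 x) ∧
      (∀ a, F (toeplitzA (gradedBimodule hΛ i 1) a) = inclHom hΛ i a) ∧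
      -- the tensor powers of `X` exist, and for any realisation of them:
      Nonempty (TensorPowers (gradedBimodule hΛ i 1)) ∧
      ∀ T : TensorPowers (gradedBimodule hΛ i 1),
        -- the isomorphisms `Ω_n : X_n → X^{⊗ n}`
        ∃ Ω : ∀ n : ℕ, (gradedBimodule hΛ i n).carrier → (T.pow n).carrier,
          (∀ n, IsBimoduleIso (gradedBimodule hΛ i n) (T.pow n) (Ω n)) ∧
          (∀ x, inclHom hΛ i (Ω 0 x) = gradedIncl hΛ i 0 x) ∧
          (∀ (n : ℕ) (a b c : Λ.Obj) (ξ : b ⟶ c) (ν : a ⟶ b) (η : Λ.Path)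
            (hξ : Λ.d ξ = Pi.single i 1) (hξν : Λ.deg (Λ.path (ν ≫ ξ)) i = n + 1)
            (hν : Λ.deg (Λ.path ν) i = n) (hη : Λ.deg η i = 0),
            Ω (n + 1) (gradedElt hΛ i (n + 1) (Λ.path (ν ≫ ξ)) η hξν hη) =
              T.tmul n
                (gradedGen hΛ i 1 (Λ.path ξ) ((congrFun hξ i).trans (Pi.single_eq_same i 1)))
                (Ω n (gradedElt hΛ i n (Λ.path ν) η hν hη))) ∧
          -- the maps `i_X^{⊗ n}`
          ∃ ψ : ∀ n : ℕ, (T.pow n).carrier →ₗ[ℂ] ToeplitzAlgebra (gradedBimodule hΛ i 1),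
            (∀ a : TCK (Λ.remove i), ψ 0 a = toeplitzA (gradedBimodule hΛ i 1) a) ∧
            (∀ x : (gradedBimodule hΛ i 1).carrier,
              ψ 1 x = toeplitzX (gradedBimodule hΛ i 1) x) ∧
            (∀ n x y, ψ (n + 1) (T.tmul n x y) =
              toeplitzX (gradedBimodule hΛ i 1) x * ψ n y) ∧
            (∀ n, IsToeplitzRep (T.pow n) (ψ n) (toeplitzA (gradedBimodule hΛ i 1))) ∧
            -- the family `u_λ = i_X^{⊗ d(λ)_i}(Ω_{d(λ)_i}(t_λ))` and the homomorphism `π_u`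
            IsTCKFamily Λ (fun μ => ψ (Λ.deg μ i) (Ω (Λ.deg μ i) (gradedGen hΛ i _ μ rfl))) ∧
            ∃ π : TCK Λ →⋆ₙₐ[ℂ] ToeplitzAlgebra (gradedBimodule hΛ i 1),
              (∀ μ, π (tck Λ μ) =
                ψ (Λ.deg μ i) (Ω (Λ.deg μ i) (gradedGen hΛ i _ μ rfl))) ∧
              -- `π_u` and `ι × φ` are mutually inverse
              (∀ t, F (π t) = t) ∧ (∀ z, π (F z) = z) := by
  have hX := isToeplitzRep_toeplitz (gradedBimodule hΛ i 1)
  obtain ⟨F, ⟨hF1, hF0⟩, -⟩ := toeplitz_lift (isToeplitzRep_gradedIncl hΛ i 1)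
  refine ⟨inclHom_injective hΛ i, isHilbertBimodule_graded hΛ i, isToeplitzRep_gradedIncl hΛ i 1,
    F, hF1, hF0, nonempty_tensorPowers hΛ i, fun T => ?_⟩
  obtain ⟨Ω, hΩ, hΩr, hΩ0, hΩ1, hΩm⟩ := T.exists_iso
  obtain ⟨ψ, hψ0, hψ1, hψm, hψ⟩ := T.exists_toeplitzRep hX
  -- the representations `Ψ_n = i_X^{⊗ n} ∘ Ω_n` of `X_n` in the Toeplitz algebra
  have hΨ : IsGradedRep hΛ i (fun n => ψ n ∘ₗ Ω n) (toeplitzA (gradedBimodule hΛ i 1)) := by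
    refine ⟨fun n => ⟨fun a x => ?_, fun x a => ?_, fun x y => ?_⟩, fun a x hx => ?_,
      fun n x y z hz => ?_⟩
    · exact (congrArg (ψ n) ((hΩ n).map_lsmul a x)).trans ((hψ n).lsmul a _)
    · exact (congrArg (ψ n) (hΩr n x a)).trans ((hψ n).rsmul _ a)
    · exact ((hψ n).inner _ _).trans (congrArg _ ((hΩ n).inner_map x y))
    · have ha : Ω 0 x = a := inclHom_injective hΛ i ((hΩ0 x).trans hx.symm)
      exact (congrArg (ψ 0) ha).trans (hψ0 a)
    · refine (congrArg (ψ (n + 1)) (hΩm n x y z hz)).trans ((hψm n x _).trans ?_)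
      exact congrArg (· * _) ((congrArg (ψ 1) (hΩ1 x)).trans (hψ1 x)).symm
  have hΨ1 : ∀ x, ψ 1 (Ω 1 x) = toeplitzX (gradedBimodule hΛ i 1) x := fun x =>
    (congrArg (ψ 1) (hΩ1 x)).trans (hψ1 x)
  have hu := hΨ.isTCKFamily
  obtain ⟨π, hπ, -⟩ := tck_lift hΛ _ hu
  refine ⟨fun n => Ω n, hΩ, hΩ0, fun n a b c ξ ν η hξ hξν hν hη => ?_, ψ, hψ0, hψ1, hψm, hψ, hu, π,
    hπ, fun t => ?_, fun z => ?_⟩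
  · refine hΩm n _ _ _ ?_
    rw [gradedIncl_elt, gradedIncl_elt, ← (isTCKFamily_tck hΛ).mul, mul_assoc]
    rfl
  -- both compositions fix the generators, so they are identities by the two universal properties
  · refine DFunLike.congr_fun ((tck_lift hΛ _ (isTCKFamily_tck hΛ)).unique (y₁ := F.comp π)
      (y₂ := NonUnitalStarAlgHom.id ℂ _) (fun μ => ?_) fun μ => rfl) t
    refine (congrArg F (hπ μ)).trans ?_
    exact hΨ.map_apply_gen (fun x => (congrArg F (hΨ1 x)).trans (hF1 x)) hF0 _ μ rfl
  · obtain ⟨h1, h0⟩ := hΨ.apply_gradedIncl hπ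
    refine DFunLike.congr_fun ((toeplitz_lift hX).unique (y₁ := π.comp F)
      (y₂ := NonUnitalStarAlgHom.id ℂ _) ⟨fun x => ?_, fun a => ?_⟩
      ⟨fun x => rfl, fun a => rfl⟩) z
    · exact (congrArg π (hF1 x)).trans ((h1 1 x).trans (hΨ1 x))
    · exact (congrArg π (hF0 a)).trans (h0 a)

end
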